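/- All graphs are finite and may have parallel edges and loops; they need not be connected. A signed graph $(G,\sigma)$ is a graph $G$ together with a map $\sigma:E(G)\to\{+1,-1\}$. A circuit is a connected $2$-regular graph; a circuit in $(G,\sigma)$ is balanced if it contains an even number of negative edges (edges $e$ with $\sigma(e)=-1$), and unbalanced otherwise. A barbell is the union of two unbalanced circuits $C_1,C_2$ and a path $P$ joining a vertex $u$ of $C_1$ to a vertex $v$ of $C_2$ and meeting $C_1$ only in $u$ and $C_2$ only in $v$, such that either $P$ is trivial ($u=v$) and $C_1,C_2$ share exactly the vertex $u$ and no edge, or $u\neq v$ and $C_1,C_2$ are vertex-disjoint. A sign-circuit is a balanced circuit or a barbell. A sign-circuit cover of $(G,\sigma)$ is a family $\mathcal F$ of sign-circuits, each a subgraph of $(G,\sigma)$, such that every edge of $G$ lies in at least one member of $\mathcal F$; its length is $\sum_{C\in\mathcal F}|E(C)|$. An orientation of $(G,\sigma)$ gives each of the two half-edges of every edge a direction, away from or towards its end-vertex, such that exactly one of the two half-edges of a positive edge points away from its end, while the two half-edges of a negative edge both point away from their ends or both point towards them. The signed graph $(G,\sigma)$ is flow-admissible if it admits a nowhere-zero integer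 flow, i.e. an orientation and a map $f:E(G)\to\mathbb Z\setminus\{0\}$ such that at every vertex $v$ the sum of $f$ over the half-edges at $v$ pointing away from $v$ equals the sum of $f$ over the half-edges at $v$ pointing towards $v$. A graph is $3$-edge-colorable if it has no loop and its edges can be colored with three colors so that any two distinct edges sharing an end receive different colors. **Theorem.** Let $(G,\sigma)$ be a flow-admissible signed graph such that $G$ is cubic (every vertex has degree $3$) and $3$-edge-colorable. Then $(G,\sigma)$ has a sign-circuit cover of length at most $\frac{20}{9}|E(G)|$. -/

import Mathlib

open scoped Graph

namespace Graph

variable {α β : Type*}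

/-- The degree of a vertex; every edge at `v` counts once and every loop at `v` once more. -/
noncomputable def deg (G : Graph α β) (v : α) : ℕ :=
  {e | G.Inc e v}.ncard + {e | G.IsLoopAt e v}.ncard

/-- Every vertex has degree `k`. -/
def IsRegular (G : Graph α β) (k : ℕ) : Prop := ∀ v ∈ V(G), G.deg v = k

/-- A (nonempty) graph is connected if any two of its vertices are joined by a walk. -/
def IsConnected (G : Graph α β) : Prop :=
  V(G).Nonempty ∧ ∀ u ∈ V(G), ∀ v ∈ V(G), Relation.ReflTransGen G.Adj u v

/-- A circuit is a finite connected `2`-regular graph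
(a single loop and a pair of parallel edges are circuits). -/
def IsCircuit (C : Graph α β) : Prop :=
  V(C).Finite ∧ C.IsConnected ∧ C.IsRegular 2

/-- `P` is a path with ends `u` and `v`, namely the path
`p 0, e 0, p 1, e 1, …, e (n - 1), p n`; it is trivial (a single vertex) if `n = 0`. -/
def IsPathBetween (P : Graph α β) (u v : α) : Prop :=
  ∃ (n : ℕ) (p : ℕ → α) (e : ℕ → β),
    p 0 = u ∧ p n = v ∧ Set.InjOn p (Set.Iic n) ∧
    (∀ i < n, P.IsLink (e i) (p i) (p (i + 1))) ∧
    V(P) = p '' Set.Iic n ∧ E(P) = e '' Set.Iio n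

/-- A proper edge coloring: the edges at a vertex have different colors.
Both ends of a loop are at the same vertex, so a graph with a loop has none. -/
def IsProperEdgeColoring (G : Graph α β) {κ : Type*} (c : β → κ) : Prop :=
  (∀ e v, ¬ G.IsLoopAt e v) ∧
  ∀ v e f, G.Inc e v → G.Inc f v → e ≠ f → c e ≠ c f

/-- `G` has a proper edge coloring with `k` colors. -/
def IsEdgeColorable (G : Graph α β) (k : ℕ) : Prop :=
  ∃ c : β → Fin k, G.IsProperEdgeColoring c

/-! ### Signed graphs

A signed graph is a pair of a graph `G` and a signature `σ : β → ℤˣ`, of which only the values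
on the edges of `G` matter.  All notions for a subgraph `H` of `G` use the restriction of `σ`. -/

/-- A balanced circuit: a circuit with an even number of negative edges. -/
def IsBalancedCircuit (C : Graph α β) (σ : β → ℤˣ) : Prop :=
  C.IsCircuit ∧ Even {e | e ∈ E(C) ∧ σ e = -1}.ncard

/-- An unbalanced circuit: a circuit with an odd number of negative edges. -/
def IsUnbalancedCircuit (C : Graph α β) (σ : β → ℤˣ) : Prop :=
  C.IsCircuit ∧ Odd {e | e ∈ E(C) ∧ σ e = -1}.ncard

/-- A barbell: the union of two unbalanced circuits `C₁`, `C₂` and a path `P` from `u ∈ V(C₁)` to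
`v ∈ V(C₂)` that meets the circuits only at its ends. If `P` is trivial, the circuits have exactly
the vertex `u = v` in common (and no edge); otherwise they are disjoint. -/
def IsBarbell (B : Graph α β) (σ : β → ℤˣ) : Prop :=
  ∃ (C₁ C₂ P : Graph α β) (u v : α),
    C₁ ≤ B ∧ C₂ ≤ B ∧ P ≤ B ∧
    V(B) = V(C₁) ∪ V(P) ∪ V(C₂) ∧ E(B) = E(C₁) ∪ E(P) ∪ E(C₂) ∧
    C₁.IsUnbalancedCircuit σ ∧ C₂.IsUnbalancedCircuit σ ∧ P.IsPathBetween u v ∧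
    V(C₁) ∩ V(P) = {u} ∧ V(C₂) ∩ V(P) = {v} ∧
    Disjoint E(C₁) E(C₂) ∧
    (u = v ∧ V(C₁) ∩ V(C₂) = {u} ∨ u ≠ v ∧ Disjoint V(C₁) V(C₂))

/-- A sign-circuit is a balanced circuit or a barbell. -/
def IsSignCircuit (C : Graph α β) (σ : β → ℤˣ) : Prop :=
  C.IsBalancedCircuit σ ∨ C.IsBarbell σ

/-- A sign-circuit cover of `(G, σ)`: a family of sign-circuits of `(G, σ)` (repetitions allowed)
that together contain all edges of `G`. -/
def IsSignCircuitCover (G : Graph α β) (σ : β → ℤˣ) (F : Multiset (Graph α β)) : Prop :=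
  (∀ C ∈ F, C ≤ G ∧ C.IsSignCircuit σ) ∧ ∀ e ∈ E(G), ∃ C ∈ F, e ∈ E(C)

/-- The length of a family of graphs: the sum of their numbers of edges. -/
noncomputable def familyLength (F : Multiset (Graph α β)) : ℕ :=
  (F.map fun C => E(C).ncard).sum

/-- An orientation of a signed graph `(G, σ)` (a bidirection). Each edge `e` is split into two
half-edges, one at the end `fst e` and one at the end `snd e` (the same vertex for a loop).
`dirFst e` and `dirSnd e` are the directions of these half-edges: `1` if the half-edge points
away from its end, `-1` if it points towards it. On a positive edge the directions are opposite
(an ordinary directed edge), on a negative edge they agree (an extroverted or introverted edge). -/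
structure SignedOrientation (G : Graph α β) (σ : β → ℤˣ) where
  fst : β → α
  snd : β → α
  isLink : ∀ e ∈ E(G), G.IsLink e (fst e) (snd e)
  dirFst : β → ℤˣ
  dirSnd : β → ℤˣ
  dir_mul : ∀ e ∈ E(G), dirFst e * dirSnd e = - σ e

open Classical in
/-- The net outflow of `f` at the vertex `v`: the sum over all half-edges at `v` of the
direction of the half-edge times the value of `f` on its edge. -/
noncomputable def SignedOrientation.netFlow {G : Graph α β} {σ : β → ℤˣ}
    (τ : G.SignedOrientation σ) (f : β → ℤ) (v : α) : ℤ :=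
  ∑ᶠ e ∈ E(G), ((if τ.fst e = v then (τ.dirFst e : ℤ) * f e else 0) +
    (if τ.snd e = v then (τ.dirSnd e : ℤ) * f e else 0))

/-- A (finite) signed graph is flow-admissible if it admits a nowhere-zero integer flow: an
orientation together with an integer function that vanishes on no edge and whose net outflow is
zero at every vertex. -/
def IsFlowAdmissible (G : Graph α β) (σ : β → ℤˣ) : Prop :=
  ∃ (τ : G.SignedOrientation σ) (f : β → ℤ),
    (∀ e ∈ E(G), f e ≠ 0) ∧ ∀ v ∈ V(G), τ.netFlow f v = 0

end Graph

set_option linter.unusedSectionVars false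
set_option linter.unusedDecidableInType false
set_option linter.unusedFintypeInType false

open scoped symmDiff

/-! Work in one component with `n` vertices and hence `3n/2` edges; the target length is `10n/3`.
Fix a proper 3-edge-coloring. The edges avoiding one color form a spanning 2-regular set of `n`
edges (`offColor`), and the product of the three signs of these sets is positive.

If some coloring has all three signs positive, two of the three sets contain every edge, and each is
covered with length `n + 2n/3` (`cov_of_even`). Such a set has an even number of unbalanced
circuits; they are paired off into barbells along a join of at most `2n/3` edges
(`exists_short_join`). The join lies in a subgraph built from ears through the circuits. An even
vertex set has a join using at most half of each ear, because the complement within an ear serves as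
well. Digons are too numerous for this count, but join edges inside a digon can be dropped by moving
its representative.

Otherwise a Kempe exchange on an unbalanced circuit of a positive set would make all three signs
positive, so every positive set consists of balanced circuits and costs only `n`
(`Proper.balanced`). One set is positive, say that avoiding `i`. Let `j`, `k` be the other colors.
If the set avoiding `j` has two unbalanced circuits, exchanges on them give two more positive sets,
and the three cover everything with length `3n`. If it has a single unbalanced circuit `C`, the
remaining circuits are balanced, and it suffices to cover `C` with length `4n/3 + |C|`
(`cov_of_unbalanced_circ`).

For this, if an unbalanced circuit is disjoint from `C`, one barbell does. If none is, cut `C` open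
and index it by the integers, with a sign potential that changes sign after one turn. The
attachments of a bridge of `C` then lift to classes on a circle of twice the length, in which two
lifts are related if an ear between them is balanced with the arc (`Ear`). Flow-admissibility enters
only here: an edge of `C` under no arc of an ear would be the single negative edge after switching
(`exists_ear_over`), which no nowhere-zero flow tolerates (`not_singleNegative`). If three related
lifts lie in no half circle, two of their three arcs suffice (`cov_of_triple`). Otherwise the arcs
of a smallest cover come from different bridges, and counting vertices bounds its length
(`cov_of_no_triple`). -/

/-- A loopless multigraph given by the two ends of each edge. -/
structure Multigraph (ν ε : Type*) where
  s : ε → ν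
  t : ε → ν
  ne : ∀ e, s e ≠ t e

namespace Multigraph

/-! ### Boundaries modulo 2, reachability, and circuits as minimal even sets. -/

variable {ν ε : Type*} [Fintype ν] [Fintype ε] [DecidableEq ν] [DecidableEq ε]

/-- The indicator function modulo 2 of a vertex. -/
def dl (v : ν) : ν → ZMod 2 := Pi.single v 1

theorem dl_self (v : ν) : dl v v = 1 := Pi.single_eq_same v 1

theorem dl_ne {u v : ν} (h : v ≠ u) : dl u v = 0 := Pi.single_eq_of_ne h 1

theorem dl_apply (u v : ν) : dl u v = if v = u then 1 else 0 := by
  simp [dl, Pi.single_apply]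

theorem add_self_fun (f : ν → ZMod 2) : f + f = 0 := by
  funext v; exact CharTwo.add_self_eq_zero (f v)

theorem zmod_two_cases (a : ZMod 2) : a = 0 ∨ a = 1 := by
  revert a; decide

theorem sum_dl (S : Finset ν) (u : ν) : ∑ v ∈ S, dl u v = if u ∈ S then 1 else 0 := by
  simp [dl_apply]

variable (M : Multigraph ν ε)

/-- The edge `e` joins `x` and `y`. -/
def Link (e : ε) (x y : ν) : Prop := (M.s e = x ∧ M.t e = y) ∨ (M.s e = y ∧ M.t e = x)

/-- The vertex `v` is an end of `e`. -/
def Inc (e : ε) (v : ν) : Prop := M.s e = v ∨ M.t e = v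

instance (e : ε) (v : ν) : Decidable (M.Inc e v) := inferInstanceAs (Decidable (_ ∨ _))

/-- The boundary modulo 2 of an edge set. -/
def bd (A : Finset ε) : ν → ZMod 2 := ∑ e ∈ A, (dl (M.s e) + dl (M.t e))

/-- The vertices incident with an edge set. -/
def verts (A : Finset ε) : Finset ν := Finset.univ.filter fun v => ∃ e ∈ A, M.Inc e v

/-- The degree of a vertex in an edge set. -/
def dg (A : Finset ε) (v : ν) : ℕ := (A.filter fun e => M.Inc e v).card

/-- `v` can be reached from `u` along edges of `K`. -/
def Reach (K : Finset ε) : ν → ν → Prop :=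
  Relation.ReflTransGen fun x y => ∃ e ∈ K, M.Link e x y

/-- A minimal nonempty edge set all of whose degrees are even. -/
def Circ (C : Finset ε) : Prop :=
  C.Nonempty ∧ M.bd C = 0 ∧ ∀ D ⊆ C, D.Nonempty → M.bd D = 0 → D = C

variable {M}

theorem Link.symm {e : ε} {x y : ν} (h : M.Link e x y) : M.Link e y x := Or.symm h

theorem link_st (e : ε) : M.Link e (M.s e) (M.t e) := Or.inl ⟨rfl, rfl⟩

theorem Link.inc_left {e : ε} {x y : ν} (h : M.Link e x y) : M.Inc e x :=
  h.elim (fun h => Or.inl h.1) fun h => Or.inr h.2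

theorem Link.inc_right {e : ε} {x y : ν} (h : M.Link e x y) : M.Inc e y := h.symm.inc_left

theorem Link.inc_iff {e : ε} {x y v : ν} (h : M.Link e x y) : M.Inc e v ↔ v = x ∨ v = y := by
  rcases h with ⟨rfl, rfl⟩ | ⟨rfl, rfl⟩ <;> simp only [Inc] <;> grind

theorem Link.dl_add {e : ε} {x y : ν} (h : M.Link e x y) :
    dl (M.s e) + dl (M.t e) = dl x + dl y := by
  rcases h with ⟨rfl, rfl⟩ | ⟨rfl, rfl⟩
  · rfl
  · exact add_comm _ _

theorem Link.ne {e : ε} {x y : ν} (h : M.Link e x y) : x ≠ y := by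
  have := M.ne e
  rcases h with ⟨rfl, rfl⟩ | ⟨rfl, rfl⟩
  · exact this
  · exact this.symm

theorem Inc.exists_link {e : ε} {x : ν} (h : M.Inc e x) : ∃ y, M.Link e x y := by
  rcases h with rfl | rfl
  · exact ⟨_, link_st e⟩
  · exact ⟨_, (link_st e).symm⟩

theorem mem_verts {A : Finset ε} {v : ν} : v ∈ M.verts A ↔ ∃ e ∈ A, M.Inc e v := by
  simp [verts]

theorem verts_mono {A B : Finset ε} (h : A ⊆ B) : M.verts A ⊆ M.verts B := fun v hv => by
  rw [mem_verts] at *; obtain ⟨e, he, h'⟩ := hv; exact ⟨e, h he, h'⟩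

theorem verts_union (A B : Finset ε) : M.verts (A ∪ B) = M.verts A ∪ M.verts B := by
  ext v; simp only [mem_verts, Finset.mem_union]; grind

@[simp] theorem bd_empty : M.bd ∅ = 0 := by simp [bd]

theorem bd_singleton {e : ε} {x y : ν} (h : M.Link e x y) : M.bd {e} = dl x + dl y := by
  simp [bd, h.dl_add]

theorem bd_union {A B : Finset ε} (h : Disjoint A B) : M.bd (A ∪ B) = M.bd A + M.bd B :=
  Finset.sum_union h

theorem bd_sdiff {A B : Finset ε} (h : B ⊆ A) : M.bd (A \ B) = M.bd A + M.bd B := by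
  have h1 : M.bd (A \ B) + M.bd B = M.bd A := Finset.sum_sdiff h
  rw [← h1, add_assoc, add_self_fun, add_zero]

theorem bd_symmDiff (A B : Finset ε) : M.bd (A ∆ B) = M.bd A + M.bd B := by
  have h1 : A ∆ B = (A \ B) ∪ (B \ A) := rfl
  have hA : M.bd A = M.bd (A \ B) + M.bd (A ∩ B) := by
    rw [← bd_union (Finset.disjoint_sdiff_inter A B), Finset.sdiff_union_inter]
  have hB : M.bd B = M.bd (B \ A) + M.bd (A ∩ B) := by
    rw [Finset.inter_comm, ← bd_union (Finset.disjoint_sdiff_inter B A), Finset.sdiff_union_inter]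
  rw [h1, bd_union disjoint_sdiff_sdiff, hA, hB]
  have := add_self_fun (M.bd (A ∩ B))
  calc _ = M.bd (A \ B) + M.bd (B \ A) + 0 := by rw [add_zero]
    _ = _ := by rw [← this]; abel

theorem bd_biUnion {ι : Type*} [DecidableEq ι] (S : Finset ι) (f : ι → Finset ε)
    (h : ∀ x ∈ S, ∀ y ∈ S, x ≠ y → Disjoint (f x) (f y)) :
    M.bd (S.biUnion f) = ∑ x ∈ S, M.bd (f x) :=
  Finset.sum_biUnion h

theorem bd_eq_dg (A : Finset ε) (v : ν) : M.bd A v = (M.dg A v : ZMod 2) := by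
  simp only [bd, dg, Finset.sum_apply, Pi.add_apply, dl_apply, Finset.card_filter, Nat.cast_sum]
  refine Finset.sum_congr rfl fun e _ => ?_
  have := M.ne e
  simp only [Inc, eq_comm (b := v)]
  by_cases h1 : v = M.s e <;> by_cases h2 : v = M.t e
  · exact absurd (h1.symm.trans h2) this
  all_goals simp [h1, h2, this, this.symm]

theorem bd_zero_iff (A : Finset ε) (v : ν) : M.bd A v = 0 ↔ Even (M.dg A v) := by
  rw [bd_eq_dg, ZMod.natCast_eq_zero_iff_even]

theorem dg_pos_iff {A : Finset ε} {v : ν} : 0 < M.dg A v ↔ v ∈ M.verts A := by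
  rw [dg, Finset.card_pos, mem_verts]; simp [Finset.Nonempty]

theorem dg_mono {A B : Finset ε} (h : A ⊆ B) (v : ν) : M.dg A v ≤ M.dg B v :=
  Finset.card_le_card (Finset.filter_subset_filter _ h)

theorem dg_union {A B : Finset ε} (h : Disjoint A B) (v : ν) :
    M.dg (A ∪ B) v = M.dg A v + M.dg B v := by
  rw [dg, Finset.filter_union, Finset.card_union_of_disjoint]; rfl
  exact Finset.disjoint_filter_filter h

theorem bd_of_notMem {A : Finset ε} {v : ν} (h : v ∉ M.verts A) : M.bd A v = 0 := by
  rw [← dg_pos_iff] at h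
  rw [bd_eq_dg]; simp [Nat.eq_zero_of_not_pos h]

theorem two_le_dg {A : Finset ε} {v : ν} (h : v ∈ M.verts A) (h0 : M.bd A v = 0) :
    2 ≤ M.dg A v := by
  have h1 := dg_pos_iff.2 h
  have h2 := (bd_zero_iff A v).1 h0
  obtain ⟨k, hk⟩ := h2; omega

theorem sum_dg (A : Finset ε) : ∑ v, M.dg A v = 2 * A.card := by
  simp only [dg, Finset.card_filter]
  rw [Finset.sum_comm]
  have : ∀ e ∈ A, (∑ v : ν, if M.Inc e v then 1 else 0) = 2 := fun e _ => by
    rw [← Finset.card_filter]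
    have : (Finset.univ.filter fun v => M.Inc e v) = {M.s e, M.t e} := by
      ext v; simp [Inc, eq_comm]
    rw [this, Finset.card_pair (M.ne e)]
  rw [Finset.sum_congr rfl this]; simp [mul_comm]

theorem sum_bd_closed {A : Finset ε} {S : Finset ν} (h : ∀ e ∈ A, M.s e ∈ S ↔ M.t e ∈ S) :
    ∑ v ∈ S, M.bd A v = 0 := by
  simp only [bd, Finset.sum_apply, Pi.add_apply]
  rw [Finset.sum_comm]
  refine Finset.sum_eq_zero fun e he => ?_
  rw [Finset.sum_add_distrib, sum_dl, sum_dl]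
  by_cases h1 : M.s e ∈ S
  · rw [if_pos h1, if_pos ((h e he).1 h1)]; exact CharTwo.add_self_eq_zero _
  · rw [if_neg h1, if_neg (mt (h e he).2 h1)]; simp

theorem sum_bd (A : Finset ε) : ∑ v, M.bd A v = 0 :=
  sum_bd_closed fun e _ => by simp

theorem Reach.refl {K : Finset ε} (u : ν) : M.Reach K u u := Relation.ReflTransGen.refl

theorem Reach.trans {K : Finset ε} {u v w : ν} (h : M.Reach K u v) (h' : M.Reach K v w) :
    M.Reach K u w := Relation.ReflTransGen.trans h h'

theorem Reach.of_link {K : Finset ε} {e : ε} {u v : ν} (he : e ∈ K) (h : M.Link e u v) :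
    M.Reach K u v := Relation.ReflTransGen.single ⟨e, he, h⟩

theorem Reach.symm {K : Finset ε} {u v : ν} (h : M.Reach K u v) : M.Reach K v u := by
  induction h with
  | refl => exact Reach.refl _
  | tail _ h ih =>
    obtain ⟨e, he, hl⟩ := h
    exact (Reach.of_link he hl.symm).trans ih

theorem Reach.mono {K L : Finset ε} {u v : ν} (hKL : K ⊆ L) (h : M.Reach K u v) :
    M.Reach L u v :=
  Relation.ReflTransGen.mono (fun _ _ => fun ⟨e, he, hl⟩ => ⟨e, hKL he, hl⟩) u v h

/-- The edges that a walk uses an odd number of times have its two ends as boundary. -/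
theorem Reach.exists_bd {K : Finset ε} {u v : ν} (h : M.Reach K u v) :
    ∃ P ⊆ K, M.bd P = dl u + dl v := by
  induction h with
  | refl => exact ⟨∅, by simp, by simp [add_self_fun]⟩
  | @tail x y _ h ih =>
    obtain ⟨e, he, hl⟩ := h
    obtain ⟨P, hP, hb⟩ := ih
    refine ⟨P ∆ {e}, fun f hf => ?_, ?_⟩
    · rw [Finset.mem_symmDiff, Finset.mem_singleton] at hf
      grind
    · rw [bd_symmDiff, hb, bd_singleton hl]
      have := add_self_fun (dl x)
      calc _ = dl u + (dl x + dl x) + dl y := by abel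
        _ = _ := by rw [this, add_zero]

/-- Handshaking in the component of `u`: the number of odd vertices there is even. -/
theorem exists_reach_bd_one {K : Finset ε} {u : ν} (h : M.bd K u = 1) :
    ∃ v, v ≠ u ∧ M.bd K v = 1 ∧ M.Reach K u v := by
  classical
  by_contra! hcon
  set S : Finset ν := Finset.univ.filter fun x => M.Reach K u x with hS
  have h1 : ∑ v ∈ S, M.bd K v = 0 := by
    refine sum_bd_closed fun e he => ?_
    simp only [hS, Finset.mem_filter, Finset.mem_univ, true_and]
    exact ⟨fun h => h.trans (Reach.of_link he (link_st e)),
      fun h => h.trans (Reach.of_link he (link_st e).symm)⟩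
  have h2 : ∑ v ∈ S, M.bd K v = M.bd K u := by
    refine Finset.sum_eq_single u (fun v hv hne => ?_) fun hu => ?_
    · refine (zmod_two_cases _).resolve_right fun h1 => hcon v hne h1 ?_
      simpa [hS] using hv
    · exact absurd (by simp [hS, Reach.refl]) hu
  rw [h1, h] at h2
  exact absurd h2 (by decide)

theorem reach_of_bd {P : Finset ε} {u v : ν} (h : M.bd P = dl u + dl v) : M.Reach P u v := by
  by_cases huv : u = v
  · rw [huv]; exact Reach.refl _
  · have h1 : M.bd P u = 1 := by rw [h, Pi.add_apply, dl_self, dl_ne huv, add_zero]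
    obtain ⟨w, hw, hb, hr⟩ := exists_reach_bd_one h1
    rw [h, Pi.add_apply, dl_ne hw, zero_add] at hb
    by_cases hwv : w = v
    · rwa [hwv] at hr
    · rw [dl_ne hwv] at hb; exact absurd hb (by decide)

/-- The minimal even sets into which an even set decomposes. -/
theorem exists_circ_decomposition (A : Finset ε) (hA : M.bd A = 0) :
    ∃ S : Finset (Finset ε), (∀ C ∈ S, M.Circ C) ∧
      (∀ C ∈ S, ∀ D ∈ S, C ≠ D → Disjoint C D) ∧ S.biUnion id = A := by
  induction A using Finset.strongInduction with
  | H A ih =>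
    rcases A.eq_empty_or_nonempty with rfl | hne
    · exact ⟨∅, by simp, by simp, by simp⟩
    · classical
      obtain ⟨C, hC, hmin⟩ := Finset.exists_min_image
        (A.powerset.filter fun D => D.Nonempty ∧ M.bd D = 0) Finset.card
        ⟨A, by simp [hne, hA]⟩
      simp only [Finset.mem_filter, Finset.mem_powerset] at hC hmin
      have hcirc : M.Circ C := ⟨hC.2.1, hC.2.2, fun D hD hDn hDb =>
        Finset.eq_of_subset_of_card_le hD (hmin D ⟨hD.trans hC.1, hDn, hDb⟩)⟩
      obtain ⟨S, h1, h2, h3⟩ := ih (A \ C) (Finset.sdiff_ssubset hC.1 hC.2.1)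
        (by rw [bd_sdiff hC.1, hA, hC.2.2, add_zero])
      have hdis : ∀ D ∈ S, Disjoint C D := fun D hD => by
        have : D ⊆ A \ C := by
          rw [← h3]; exact Finset.subset_biUnion_of_mem id hD
        exact Finset.disjoint_sdiff.mono_right this
      refine ⟨insert C S, ?_, ?_, ?_⟩
      · intro D hD
        rcases Finset.mem_insert.1 hD with rfl | hD
        · exact hcirc
        · exact h1 D hD
      · intro D hD D' hD' hne
        rcases Finset.mem_insert.1 hD with h | h <;>
          rcases Finset.mem_insert.1 hD' with h' | h'
        · exact absurd (h.trans h'.symm) hne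
        · exact h ▸ hdis _ h'
        · exact h' ▸ (hdis _ h).symm
        · exact h2 _ h _ h' hne
      · rw [Finset.biUnion_insert, h3, id, Finset.union_sdiff_of_subset hC.1]

theorem Circ.reach {C : Finset ε} (h : M.Circ C) {u v : ν} (hu : u ∈ M.verts C)
    (hv : v ∈ M.verts C) : M.Reach C u v := by
  classical
  -- The edges in the component of `u` form a nonempty even subset, so by minimality they are all of
  -- `C`.
  set D := C.filter fun e => M.Reach C u (M.s e) with hD
  have hsub : D ⊆ C := Finset.filter_subset _ _
  have hmem : ∀ e ∈ C, ∀ x, M.Inc e x → (e ∈ D ↔ M.Reach C u x) := by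
    intro e he x hx
    simp only [hD, Finset.mem_filter, he, true_and]
    rcases hx with rfl | rfl
    · rfl
    · exact ⟨fun h => h.trans (Reach.of_link he (link_st e)),
        fun h => h.trans (Reach.of_link he (link_st e).symm)⟩
  have hne : D.Nonempty := by
    obtain ⟨e, he, hi⟩ := mem_verts.1 hu
    exact ⟨e, (hmem e he u hi).2 (Reach.refl u)⟩
  have hbd : M.bd D = 0 := by
    funext x
    by_cases hx : M.Reach C u x
    · have : M.dg D x = M.dg C x := by
        unfold dg; congr 1; ext e
        simp only [Finset.mem_filter]
        constructor
        · exact fun h => ⟨hsub h.1, h.2⟩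
        · exact fun h => ⟨(hmem e h.1 x h.2).2 hx, h.2⟩
      rw [bd_eq_dg, this, ← bd_eq_dg, h.2.1]
    · refine bd_of_notMem fun hxv => hx ?_
      obtain ⟨e, he, hi⟩ := mem_verts.1 hxv
      exact (hmem e (hsub he) x hi).1 he
  have := h.2.2 D hsub hne hbd
  obtain ⟨e, he, hi⟩ := mem_verts.1 hv
  exact (hmem e he v hi).1 (this ▸ he)

/-! ### Paths -/

variable (M) in
/-- `p 0, e 0, p 1, …, p n` is a path. -/
structure IsPath (n : ℕ) (p : ℕ → ν) (e : ℕ → ε) : Prop where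
  inj : Set.InjOn p (Set.Iic n)
  link : ∀ i < n, M.Link (e i) (p i) (p (i + 1))

theorem Reach.exists_walk [Nonempty ε] {K : Finset ε} {u v : ν} (h : M.Reach K u v) :
    ∃ (n : ℕ) (p : ℕ → ν) (e : ℕ → ε), p 0 = u ∧ p n = v ∧
      ∀ i < n, e i ∈ K ∧ M.Link (e i) (p i) (p (i + 1)) := by
  induction h with
  | refl => exact ⟨0, fun _ => u, fun _ => Classical.arbitrary ε, rfl, rfl, by simp⟩
  | @tail x y _ h ih =>
    obtain ⟨f, hf, hl⟩ := h
    obtain ⟨n, p, e, h0, hn, hw⟩ := ih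
    refine ⟨n + 1, fun i => if i ≤ n then p i else y, fun i => if i < n then e i else f, ?_, ?_, ?_⟩
    · simp [h0]
    · simp
    · intro i hi
      rcases Nat.lt_succ_iff_lt_or_eq.1 hi with h | rfl
      · have h1 : i + 1 ≤ n := h
        simp only [h, h.le, h1, if_true]
        exact hw i h
      · simp [hn, hf, hl]

/-- A shortest path between two vertex sets. -/
theorem Reach.exists_isPath [Nonempty ε] {K : Finset ε} {A B : Set ν} {u v : ν}
    (h : M.Reach K u v) (hu : u ∈ A) (hv : v ∈ B) :
    ∃ (n : ℕ) (p : ℕ → ν) (e : ℕ → ε), M.IsPath n p e ∧ (∀ i < n, e i ∈ K) ∧ p 0 ∈ A ∧ p n ∈ B ∧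
      (∀ i ≤ n, p i ∈ A → i = 0) ∧ ∀ i ≤ n, p i ∈ B → i = n := by
  classical
  have hex : ∃ (n : ℕ) (p : ℕ → ν) (e : ℕ → ε), p 0 ∈ A ∧ p n ∈ B ∧
      ∀ i < n, e i ∈ K ∧ M.Link (e i) (p i) (p (i + 1)) := by
    obtain ⟨n, p, e, h0, hn, hw⟩ := h.exists_walk
    exact ⟨n, p, e, h0 ▸ hu, hn ▸ hv, hw⟩
  -- A shortest walk from `A` to `B` is taken: a repeated vertex, a later visit to `A` or an earlier
  -- visit to `B` would each give a shorter one.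
  obtain ⟨p, e, h0, hn, hw⟩ := Nat.find_spec hex
  have hmin := fun m (hm : m < Nat.find hex) => Nat.find_min hex hm
  generalize Nat.find hex = n at hn hw hmin
  have hcut : ∀ i j, i < j → j ≤ n → p i ≠ p j := by
    intro i j hij hj hp
    refine hmin (n - (j - i)) (by omega) ⟨fun k => if k ≤ i then p k else p (k + (j - i)),
      fun k => if k < i then e k else e (k + (j - i)), by simpa using h0, ?_, ?_⟩
    · by_cases hjn : n - (j - i) ≤ i
      · have h1 : n - (j - i) = i := by omega
        have h2 : j = n := by omega
        simp only [h1, le_refl, if_true]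
        rw [hp, h2]; exact hn
      · simp only [hjn, if_false]
        rwa [show n - (j - i) + (j - i) = n by omega]
    · intro k hk
      rcases lt_trichotomy k i with h | h | h
      · have h1 : k + 1 ≤ i := h
        simp only [h, h.le, h1, if_true]
        exact hw k (by omega)
      · subst h
        simp only [lt_irrefl, le_refl, if_true, if_false, Nat.not_succ_le_self]
        have := hw j (by omega)
        rw [show k + (j - k) = j by omega, show k + 1 + (j - k) = j + 1 by omega, hp]
        exact this
      · have h1 : ¬ k + 1 ≤ i := by omega
        have h2 : ¬ k ≤ i := by omega
        have h3 : ¬ k < i := by omega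
        simp only [h1, h2, h3, if_false]
        have := hw (k + (j - i)) (by omega)
        rwa [show k + 1 + (j - i) = k + (j - i) + 1 by omega]
  refine ⟨n, p, e, ⟨?_, fun i hi => (hw i hi).2⟩, fun i hi => (hw i hi).1, h0, hn, ?_, ?_⟩
  · intro i hi j hj hp
    rcases lt_trichotomy i j with h | h | h
    · exact absurd hp (hcut i j h hj)
    · exact h
    · exact absurd hp.symm (hcut j i h hi)
  · intro i hi hA
    by_contra hi0
    refine hmin (n - i) (by omega) ⟨fun k => p (k + i), fun k => e (k + i), by simpa using hA, ?_, ?_⟩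
    · simpa [Nat.sub_add_cancel hi] using hn
    · intro k hk
      have := hw (k + i) (by omega)
      rwa [show k + i + 1 = k + 1 + i by omega] at this
  · intro i hi hB
    by_contra hin
    exact hmin i (by omega) ⟨p, e, h0, hB, fun k hk => hw k (by omega)⟩

namespace IsPath

variable {n : ℕ} {p : ℕ → ν} {e : ℕ → ε}

theorem edge_inj (h : M.IsPath n p e) {i j : ℕ} (hi : i < n) (hj : j < n) (hij : e i = e j) :
    i = j := by
  have h1 := h.link i hi
  have h2 := h.link j hj
  rw [hij] at h1
  have e1 := (h2.inc_iff).1 h1.inc_left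
  have e2 := (h2.inc_iff).1 h1.inc_right
  have inj : ∀ a b, a ≤ n → b ≤ n → p a = p b → a = b := fun a b ha hb hab => h.inj ha hb hab
  rcases e1 with e1 | e1
  · exact inj _ _ (by omega) (by omega) e1
  · have := inj _ _ (by omega) (by omega) e1
    rcases e2 with e2 | e2
    · have := inj _ _ (by omega) (by omega) e2; omega
    · have := inj _ _ (by omega) (by omega) e2; omega

/-- The edges of a path from its vertex number `a` to its vertex number `b`. -/
theorem card_seg (h : M.IsPath n p e) {a b : ℕ} (hb : b ≤ n) :
    ((Finset.Ico a b).image e).card = b - a := by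
  rw [Finset.card_image_of_injOn, Nat.card_Ico]
  intro i hi j hj hij
  simp only [Finset.coe_Ico, Set.mem_Ico] at hi hj
  exact h.edge_inj (by omega) (by omega) hij

theorem bd_seg (h : M.IsPath n p e) {a b : ℕ} (hab : a ≤ b) (hb : b ≤ n) :
    M.bd ((Finset.Ico a b).image e) = dl (p a) + dl (p b) := by
  induction b, hab using Nat.le_induction with
  | base => simp [add_self_fun]
  | succ b hab ih =>
    have hd : Disjoint ((Finset.Ico a b).image e) {e b} := by
      rw [Finset.disjoint_singleton_right, Finset.mem_image]
      rintro ⟨i, hi, hib⟩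
      rw [Finset.mem_Ico] at hi
      have := h.edge_inj (by omega) (by omega) hib
      omega
    have : (Finset.Ico a (b + 1)).image e = (Finset.Ico a b).image e ∪ {e b} := by
      ext f
      simp only [Finset.mem_image, Finset.mem_Ico, Finset.mem_union, Finset.mem_singleton]
      constructor
      · rintro ⟨i, hi, rfl⟩
        by_cases hib : i = b
        · exact Or.inr (by rw [hib])
        · exact Or.inl ⟨i, by omega, rfl⟩
      · rintro (⟨i, hi, rfl⟩ | rfl)
        · exact ⟨i, by omega, rfl⟩
        · exact ⟨b, by omega, rfl⟩
    rw [this, bd_union hd, ih (by omega), bd_singleton (h.link b (by omega))]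
    have := add_self_fun (dl (p b))
    calc _ = dl (p a) + (dl (p b) + dl (p b)) + dl (p (b + 1)) := by abel
      _ = _ := by rw [this, add_zero]

theorem reach_seg (h : M.IsPath n p e) {a b : ℕ} (hab : a ≤ b) (hb : b ≤ n) :
    M.Reach ((Finset.Ico a b).image e) (p a) (p b) :=
  reach_of_bd (h.bd_seg hab hb)

theorem mem_verts_seg (h : M.IsPath n p e) {a b : ℕ} (hb : b ≤ n) {v : ν}
    (hv : v ∈ M.verts ((Finset.Ico a b).image e)) : ∃ i, a ≤ i ∧ i ≤ b ∧ p i = v := by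
  obtain ⟨f, hf, hi⟩ := mem_verts.1 hv
  obtain ⟨i, hi', rfl⟩ := Finset.mem_image.1 hf
  rw [Finset.mem_Ico] at hi'
  rcases ((h.link i (by omega)).inc_iff).1 hi with rfl | rfl
  · exact ⟨i, by omega, by omega, rfl⟩
  · exact ⟨i + 1, by omega, by omega, rfl⟩

end IsPath

/-! ### Signs -/

/-- The sign of an edge set: the product of the signs of its edges. -/
def sgn (σ : ε → ℤˣ) (A : Finset ε) : ℤˣ := ∏ e ∈ A, σ e

theorem sgn_union (σ : ε → ℤˣ) {A B : Finset ε} (h : Disjoint A B) :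
    sgn σ (A ∪ B) = sgn σ A * sgn σ B := Finset.prod_union h

theorem sgn_symmDiff (σ : ε → ℤˣ) (A B : Finset ε) :
    sgn σ (A ∆ B) = sgn σ A * sgn σ B := by
  have h1 : A ∆ B = (A \ B) ∪ (B \ A) := rfl
  have hA : sgn σ A = sgn σ (A \ B) * sgn σ (A ∩ B) := by
    rw [← sgn_union σ (Finset.disjoint_sdiff_inter A B), Finset.sdiff_union_inter]
  have hB : sgn σ B = sgn σ (B \ A) * sgn σ (A ∩ B) := by
    rw [Finset.inter_comm, ← sgn_union σ (Finset.disjoint_sdiff_inter B A),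
      Finset.sdiff_union_inter]
  rw [h1, sgn_union σ disjoint_sdiff_sdiff, hA, hB]
  calc _ = sgn σ (A \ B) * sgn σ (B \ A) * (sgn σ (A ∩ B) * sgn σ (A ∩ B)) := by
        rw [Int.units_mul_self, mul_one]
    _ = _ := by ac_rfl

theorem sgn_cases (σ : ε → ℤˣ) (A : Finset ε) : sgn σ A = 1 ∨ sgn σ A = -1 :=
  Int.units_eq_one_or _

@[simp] theorem sgn_empty (σ : ε → ℤˣ) : sgn σ ∅ = 1 := rfl

@[simp] theorem sgn_singleton (σ : ε → ℤˣ) (e : ε) : sgn σ {e} = σ e := by simp [sgn]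

/-! ### Cubic multigraphs -/

variable (M) in
/-- Every vertex has degree three. -/
def Cubic : Prop := ∀ v, M.dg Finset.univ v = 3

theorem Cubic.dg_le (h : M.Cubic) (A : Finset ε) (v : ν) : M.dg A v ≤ 3 :=
  h v ▸ dg_mono (Finset.subset_univ A) v

theorem Cubic.dg_eq_two (h : M.Cubic) {A : Finset ε} (hA : M.bd A = 0) {v : ν}
    (hv : v ∈ M.verts A) : M.dg A v = 2 := by
  have h1 := two_le_dg hv (congrFun hA v)
  have h2 := h.dg_le A v
  have h3 := (bd_zero_iff A v).1 (congrFun hA v)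
  obtain ⟨k, hk⟩ := h3; omega

theorem Cubic.card_verts (h : M.Cubic) {A : Finset ε} (hA : M.bd A = 0) :
    (M.verts A).card = A.card := by
  have h1 := sum_dg (M := M) A
  have h2 : ∑ v, M.dg A v = ∑ v ∈ M.verts A, 2 := by
    rw [← Finset.sum_subset (Finset.subset_univ (M.verts A))]
    · exact Finset.sum_congr rfl fun v hv => h.dg_eq_two hA hv
    · intro v _ hv
      rw [← dg_pos_iff] at hv; omega
  rw [h2, Finset.sum_const, smul_eq_mul] at h1; omega

/-- A common vertex would have degree two in each set, hence degree four. For this reason barbells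
with a trivial path never arise. -/
theorem Cubic.disjoint_verts (h : M.Cubic) {A B : Finset ε} (hA : M.bd A = 0) (hB : M.bd B = 0)
    (hd : Disjoint A B) : Disjoint (M.verts A) (M.verts B) := by
  rw [Finset.disjoint_left]
  intro v h1 h2
  have h3 := dg_union (M := M) hd v
  have h4 := h.dg_le (A ∪ B) v
  have := h.dg_eq_two hA h1
  have := h.dg_eq_two hB h2
  omega

theorem Circ.card_pos {C : Finset ε} (h : M.Circ C) : 0 < C.card := h.1.card_pos

theorem disjoint_of_verts {A B : Finset ε} (h : Disjoint (M.verts A) (M.verts B)) :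
    Disjoint A B := by
  rw [Finset.disjoint_left] at *
  intro e h1 h2
  exact h (mem_verts.2 ⟨e, h1, Or.inl rfl⟩) (mem_verts.2 ⟨e, h2, Or.inl rfl⟩)

/-! ### Ears through a prescribed vertex -/

variable (M) in
/-- Edges `P` and vertices `I` outside `U` that link `x` and `y` to `U`
(an ear of `U` through `x` if `x = y`). -/
structure Linkage (U : Finset ν) (P : Finset ε) (I : Finset ν) (x y : ν) : Prop where
  disj : Disjoint I U
  ends : ∀ e ∈ P, ∀ v, M.Inc e v → v ∈ I ∪ U
  touch : ∀ e ∈ P, ∃ v ∈ I, M.Inc e v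
  left : x ∈ I ∪ U
  right : y ∈ I ∪ U
  bd : ∀ v ∈ I, M.bd P v = dl x v + dl y v
  reach : ∀ v ∈ I, ∃ u ∈ U, M.Reach P v u
  -- Two paths from `x` and `y` to `U` have as many edges as vertices outside `U`; an ear through
  -- `x` has one edge more.
  card : P.card ≤ I.card + (if x = y ∧ x ∉ U then 1 else 0)

namespace Linkage

variable {U : Finset ν} {P : Finset ε} {I : Finset ν} {x y : ν}

theorem symm (h : M.Linkage U P I x y) : M.Linkage U P I y x where
  disj := h.disj
  ends := h.ends
  touch := h.touch
  left := h.right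
  right := h.left
  bd := fun v hv => by rw [h.bd v hv, add_comm]
  reach := h.reach
  card := by
    refine h.card.trans (Nat.add_le_add_left ?_ _)
    by_cases hxy : x = y
    · subst hxy; exact le_rfl
    · simp [hxy]

theorem trivial (hx : x ∈ U) (hy : y ∈ U) : M.Linkage U ∅ ∅ x y where
  disj := by simp
  ends := by simp
  touch := by simp
  left := by simpa using hx
  right := by simpa using hy
  bd := by simp
  reach := by simp
  card := by simp

/-- The new edges carry the odd ends `x`, `y` back to `q₁`, `q₂`, where the boundary of `P` cancels
theirs. The condition `hq` excludes the one case in which `P` may have more edges than `I` has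
vertices, so a surplus edge can come only from `Q`. -/
theorem extend {q₁ q₂ : ν} (h : M.Linkage U P I q₁ q₂) (hq : q₁ ≠ q₂ ∨ q₁ ∈ U)
    {Q : Finset ε} {J : Finset ν} (hJ : Disjoint J (I ∪ U))
    (hends : ∀ e ∈ Q, ∀ v, M.Inc e v → v ∈ J ∨ v = q₁ ∨ v = q₂)
    (htouch : ∀ e ∈ Q, ∃ v ∈ J, M.Inc e v)
    (hbd : M.bd Q = dl q₁ + dl q₂ + (dl x + dl y))
    (hreach : ∀ v ∈ J, M.Reach Q v q₁ ∨ M.Reach Q v q₂)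
    (hx : x ∈ J ∪ (I ∪ U)) (hy : y ∈ J ∪ (I ∪ U))
    (hcard : Q.card ≤ J.card + (if x = y ∧ x ∉ U then 1 else 0)) :
    M.Linkage U (P ∪ Q) (J ∪ I) x y := by
  have hPQ : Disjoint P Q := by
    rw [Finset.disjoint_left]
    intro e h1 h2
    obtain ⟨v, hv, hi⟩ := htouch e h2
    exact Finset.disjoint_left.1 hJ hv (h.ends e h1 v hi)
  have hJI : Disjoint J I := hJ.mono_right Finset.subset_union_left
  have hq1 := h.left
  have hq2 := h.right
  have hreachI : ∀ v ∈ I ∪ U, ∃ u ∈ U, M.Reach (P ∪ Q) v u := by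
    intro v hv
    rcases Finset.mem_union.1 hv with hv | hv
    · obtain ⟨u, hu, hr⟩ := h.reach v hv
      exact ⟨u, hu, hr.mono Finset.subset_union_left⟩
    · exact ⟨v, hv, Reach.refl v⟩
  refine ⟨?_, ?_, ?_, ?_, ?_, ?_, ?_, ?_⟩
  · exact Finset.disjoint_union_left.2 ⟨hJ.mono_right Finset.subset_union_right, h.disj⟩
  · intro e he v hv
    rw [Finset.union_assoc, Finset.mem_union]
    rcases Finset.mem_union.1 he with he | he
    · exact Or.inr (h.ends e he v hv)
    · rcases hends e he v hv with h' | rfl | rfl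
      · exact Or.inl h'
      · exact Or.inr hq1
      · exact Or.inr hq2
  · intro e he
    rcases Finset.mem_union.1 he with he | he
    · obtain ⟨v, hv, hi⟩ := h.touch e he
      exact ⟨v, Finset.mem_union_right _ hv, hi⟩
    · obtain ⟨v, hv, hi⟩ := htouch e he
      exact ⟨v, Finset.mem_union_left _ hv, hi⟩
  · rwa [Finset.union_assoc]
  · rwa [Finset.union_assoc]
  · intro v hv
    rw [bd_union hPQ, hbd]
    simp only [Pi.add_apply]
    rcases Finset.mem_union.1 hv with hv | hv
    · have hvn := Finset.disjoint_left.1 hJ hv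
      have h1 : v ≠ q₁ := fun h => hvn (h ▸ hq1)
      have h2 : v ≠ q₂ := fun h => hvn (h ▸ hq2)
      have h3 : M.bd P v = 0 := bd_of_notMem fun hm => by
        obtain ⟨e, he, hi⟩ := mem_verts.1 hm
        exact hvn (h.ends e he v hi)
      rw [h3, dl_ne h1, dl_ne h2]; ring
    · rw [h.bd v hv]
      have := CharTwo.add_self_eq_zero (dl q₁ v + dl q₂ v)
      rw [← add_assoc, this, zero_add]
  · intro v hv
    rcases Finset.mem_union.1 hv with hv | hv
    · rcases hreach v hv with hr | hr
      · obtain ⟨u, hu, hr'⟩ := hreachI _ hq1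
        exact ⟨u, hu, (hr.mono Finset.subset_union_right).trans hr'⟩
      · obtain ⟨u, hu, hr'⟩ := hreachI _ hq2
        exact ⟨u, hu, (hr.mono Finset.subset_union_right).trans hr'⟩
    · exact hreachI v (Finset.mem_union_left _ hv)
  · have h1 := h.card
    rw [if_neg (by tauto)] at h1
    rw [Finset.card_union_of_disjoint hPQ, Finset.card_union_of_disjoint hJI]
    omega

end Linkage

theorem Reach.exists_leaving {K : Finset ε} {W : Finset ν} {u v : ν} (h : M.Reach K u v)
    (hu : u ∈ W) (hv : v ∉ W) : ∃ e ∈ K, ∃ x ∈ W, ∃ y ∉ W, M.Link e x y := by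
  induction h with
  | refl => exact absurd hu hv
  | @tail a b _ h ih =>
    by_cases ha : a ∈ W
    · obtain ⟨e, he, hl⟩ := h
      exact ⟨e, he, a, ha, b, hv, hl⟩
    · exact ih ha

variable (M) in
/-- No edge is a bridge. -/
def Bridgeless : Prop := ∀ e x y, M.Link e x y → M.Reach (Finset.univ.erase e) x y

variable (M) in
/-- Any two vertices of `W` are linked to `U` within `W`. -/
def LinkedWithin (U W : Finset ν) : Prop :=
  U ⊆ W ∧ ∀ x ∈ W, ∀ y ∈ W, ∃ P I, I ⊆ W ∧ M.Linkage U P I x y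

/-- An edge leaving `W` is not a bridge, so a path leads from its outer end back to `W`. Edge and
path form an ear of `W`, and a new vertex reaches the old part along either of its two pieces. -/
theorem LinkedWithin.exists_larger (hc : M.Cubic) (hb : M.Bridgeless) {U W : Finset ν}
    (h : M.LinkedWithin U W) {u v : ν} (hr : M.Reach Finset.univ u v) (hu : u ∈ W) (hv : v ∉ W) :
    ∃ W', W ⊂ W' ∧ M.LinkedWithin U W' := by
  obtain ⟨f, -, x, hx, y, hy, hf⟩ := hr.exists_leaving hu hv
  have : Nonempty ε := ⟨f⟩
  obtain ⟨n, q, e, hp, he, h0, hn, -, hW⟩ :=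
    (hb f x y hf).symm.exists_isPath (A := {y}) (B := (W : Set ν)) rfl hx
  simp only [Set.mem_singleton_iff] at h0
  have hn0 : 0 < n := by
    rcases Nat.eq_zero_or_pos n with h | h
    · subst h; exact absurd (h0 ▸ hn) hy
    · exact h
  have hqW : ∀ i < n, q i ∉ W := fun i hi hm => by
    have := hW i hi.le hm; omega
  have hnW : q n ∈ W := hn
  -- the end vertices of the ear
  have hends : x ≠ q n ∨ x ∈ U := by
    -- A closed ear at `x` outside `U` is impossible in a cubic graph: the linkage of `x` with
    -- itself uses two edges at `x`, and `f` and the last edge of the path are two more.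
    by_contra! hcon
    obtain ⟨P, I, hI, hL⟩ := h.2 x hx x hx
    have hxI : x ∈ I := (Finset.mem_union.1 hL.left).resolve_right hcon.2
    have hPW : ∀ g ∈ P, ∀ v, M.Inc g v → v ∈ W := fun g hg v hv => by
      rcases Finset.mem_union.1 (hL.ends g hg v hv) with h' | h'
      · exact hI h'
      · exact h.1 h'
    obtain ⟨w, hw, hr⟩ := hL.reach x hxI
    have hxv : x ∈ M.verts P := by
      rcases Relation.ReflTransGen.cases_head hr with h' | ⟨z, ⟨g, hg, hl⟩, -⟩
      · exact absurd (h' ▸ hw) hcon.2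
      · exact mem_verts.2 ⟨g, hg, hl.inc_left⟩
    have hb0 : M.bd P x = 0 := by rw [hL.bd x hxI]; exact CharTwo.add_self_eq_zero _
    have h2 := two_le_dg hxv hb0
    have hl1 := hp.link (n - 1) (by omega)
    rw [show n - 1 + 1 = n by omega] at hl1
    have hfe : f ≠ e (n - 1) := (Finset.mem_erase.1 (he (n - 1) (by omega))).1.symm
    have hfP : f ∉ P := fun hm => hy (hPW f hm y hf.inc_right)
    have heP : e (n - 1) ∉ P := fun hm => hqW (n - 1) (by omega) (hPW _ hm _ hl1.inc_left)
    have hd : Disjoint P {f, e (n - 1)} := by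
      rw [Finset.disjoint_right]; simp [hfP, heP]
    have h3 := dg_union (M := M) hd x
    have h4 : M.dg {f, e (n - 1)} x = 2 := by
      rw [dg, Finset.filter_true_of_mem, Finset.card_pair hfe]
      intro g hg
      rcases Finset.mem_insert.1 hg with rfl | hg
      · exact hf.inc_left
      · rw [Finset.mem_singleton.1 hg, hcon.1]; exact hl1.inc_right
    have h5 := hc.dg_le (P ∪ {f, e (n - 1)}) x
    omega
  -- the two parts of the ear
  have hqinj : ∀ i j, i ≤ n → j ≤ n → q i = q j → i = j := fun i j hi hj hij => hp.inj hi hj hij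
  let EA : ℕ → Finset ε := fun i => {f} ∪ (Finset.Ico 0 i).image e
  let EB : ℕ → Finset ε := fun j => (Finset.Ico j n).image e
  let JA : ℕ → Finset ν := fun i => (Finset.Ico 0 (i + 1)).image q
  let JB : ℕ → Finset ν := fun j => (Finset.Ico j n).image q
  have hfdis : ∀ a b, b ≤ n → Disjoint {f} ((Finset.Ico a b).image e) := fun a b hb => by
    rw [Finset.disjoint_singleton_left, Finset.mem_image]
    rintro ⟨i, hi, hif⟩
    rw [Finset.mem_Ico] at hi
    exact (Finset.mem_erase.1 (he i (by omega))).1 hif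
  have bdA : ∀ i < n, M.bd (EA i) = dl x + dl (q i) := fun i hi => by
    rw [bd_union (hfdis 0 i hi.le), hp.bd_seg (Nat.zero_le i) hi.le, bd_singleton hf, h0]
    have := add_self_fun (dl y)
    calc _ = dl x + (dl y + dl y) + dl (q i) := by abel
      _ = _ := by rw [this, add_zero]
  have bdB : ∀ j < n, M.bd (EB j) = dl (q n) + dl (q j) := fun j hj => by
    rw [hp.bd_seg hj.le le_rfl, add_comm]
  have cEA : ∀ i < n, (EA i).card = i + 1 := fun i hi => by
    rw [Finset.card_union_of_disjoint (hfdis 0 i hi.le), hp.card_seg hi.le, Finset.card_singleton]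
    omega
  have cEB : ∀ j < n, (EB j).card = n - j := fun j hj => hp.card_seg le_rfl
  have cimg : ∀ s : Finset ℕ, (∀ i ∈ s, i < n) → (s.image q).card = s.card := fun s hs =>
    Finset.card_image_of_injOn fun i hi j hj hij =>
      hqinj i j (hs i hi).le (hs j hj).le hij
  have cJA : ∀ i < n, (JA i).card = i + 1 := fun i hi => by
    rw [cimg _ fun k hk => by rw [Finset.mem_Ico] at hk; omega, Nat.card_Ico]; omega
  have cJB : ∀ j < n, (JB j).card = n - j := fun j hj => by
    rw [cimg _ fun k hk => by rw [Finset.mem_Ico] at hk; omega, Nat.card_Ico]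
  have memJA : ∀ i k, k ≤ i → q k ∈ JA i := fun i k hk =>
    Finset.mem_image_of_mem q (Finset.mem_Ico.2 ⟨Nat.zero_le k, by omega⟩)
  have memJB : ∀ j k, j ≤ k → k < n → q k ∈ JB j := fun j k hk hn =>
    Finset.mem_image_of_mem q (Finset.mem_Ico.2 ⟨hk, hn⟩)
  have JA_W : ∀ i < n, Disjoint (JA i) W := fun i hi => by
    rw [Finset.disjoint_left]
    intro v hv
    obtain ⟨k, hk, rfl⟩ := Finset.mem_image.1 hv
    rw [Finset.mem_Ico] at hk
    exact hqW k (by omega)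
  have JB_W : ∀ j < n, Disjoint (JB j) W := fun j hj => by
    rw [Finset.disjoint_left]
    intro v hv
    obtain ⟨k, hk, rfl⟩ := Finset.mem_image.1 hv
    rw [Finset.mem_Ico] at hk
    exact hqW k (by omega)
  have endsA : ∀ i < n, ∀ g ∈ EA i, ∀ v, M.Inc g v → v ∈ JA i ∨ v = x := by
    intro i hi g hg v hv
    rcases Finset.mem_union.1 hg with hg | hg
    · rw [Finset.mem_singleton.1 hg, hf.inc_iff] at hv
      rcases hv with rfl | rfl
      · exact Or.inr rfl
      · exact Or.inl (h0 ▸ memJA i 0 (Nat.zero_le i))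
    · obtain ⟨k, -, hk, rfl⟩ := hp.mem_verts_seg hi.le (mem_verts.2 ⟨g, hg, hv⟩)
      exact Or.inl (memJA i k hk)
  have endsB : ∀ j < n, ∀ g ∈ EB j, ∀ v, M.Inc g v → v ∈ JB j ∨ v = q n := by
    intro j hj g hg v hv
    obtain ⟨k, hk1, hk, rfl⟩ := hp.mem_verts_seg le_rfl (mem_verts.2 ⟨g, hg, hv⟩)
    rcases Nat.lt_or_eq_of_le hk with h' | rfl
    · exact Or.inl (memJB j k hk1 h')
    · exact Or.inr rfl
  have touchA : ∀ i < n, ∀ g ∈ EA i, ∃ v ∈ JA i, M.Inc g v := by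
    intro i hi g hg
    rcases Finset.mem_union.1 hg with hg | hg
    · rw [Finset.mem_singleton.1 hg]
      exact ⟨q 0, memJA i 0 (Nat.zero_le i), h0 ▸ hf.inc_right⟩
    · obtain ⟨k, hk, rfl⟩ := Finset.mem_image.1 hg
      rw [Finset.mem_Ico] at hk
      exact ⟨q k, memJA i k (by omega), (hp.link k (by omega)).inc_left⟩
  have touchB : ∀ j < n, ∀ g ∈ EB j, ∃ v ∈ JB j, M.Inc g v := by
    intro j hj g hg
    obtain ⟨k, hk, rfl⟩ := Finset.mem_image.1 hg
    rw [Finset.mem_Ico] at hk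
    exact ⟨q k, memJB j k hk.1 hk.2, (hp.link k hk.2).inc_left⟩
  have reachA : ∀ i < n, ∀ v ∈ JA i, M.Reach (EA i) v x := by
    intro i hi v hv
    obtain ⟨k, hk, rfl⟩ := Finset.mem_image.1 hv
    rw [Finset.mem_Ico] at hk
    refine (reach_of_bd (bdA k (by omega))).symm.mono ?_
    exact Finset.union_subset_union le_rfl
      (Finset.image_subset_image (Finset.Ico_subset_Ico le_rfl (by omega)))
  have reachB : ∀ j < n, ∀ v ∈ JB j, M.Reach (EB j) v (q n) := by
    intro j hj v hv
    obtain ⟨k, hk, rfl⟩ := Finset.mem_image.1 hv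
    rw [Finset.mem_Ico] at hk
    refine (reach_of_bd (bdB k hk.2)).symm.mono ?_
    exact Finset.image_subset_image (Finset.Ico_subset_Ico hk.1 le_rfl)
  have hallJ : ∀ i < n, JA i ⊆ JB 0 := fun i hi =>
    Finset.image_subset_image (Finset.Ico_subset_Ico le_rfl (by omega))
  have hallJB : ∀ j, JB j ⊆ JB 0 := fun j =>
    Finset.image_subset_image (Finset.Ico_subset_Ico (Nat.zero_le j) le_rfl)
  have hsubW : ∀ I : Finset ν, I ⊆ W → I ∪ U ⊆ W := fun I hI => Finset.union_subset hI h.1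
  -- a new and an old vertex
  have case1 : ∀ i < n, ∀ w ∈ W, ∃ P I, I ⊆ JB 0 ∪ W ∧ M.Linkage U P I (q i) w := by
    intro i hi w hw
    -- The new vertex leaves towards `x`. If `x = w` lies outside `U`, the linkage of `x` and `w`
    -- could have a surplus edge, so it leaves towards the other end `q n`, which then differs from
    -- `w`.
    by_cases hxw : x ≠ w ∨ x ∈ U
    · obtain ⟨P, I, hI, hL⟩ := h.2 x hx w hw
      refine ⟨_, _, Finset.union_subset_union (hallJ i hi) hI, hL.extend hxw (Q := EA i) (J := JA i)
        ((JA_W i hi).mono_right (hsubW I hI)) (fun g hg v hv => (endsA i hi g hg v hv).imp_right Or.inl)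
        (touchA i hi) ?_ (fun v hv => Or.inl (reachA i hi v hv))
        (Finset.mem_union_left _ (memJA i i le_rfl)) (Finset.mem_union_right _ hL.right) ?_⟩
      · rw [bdA i hi]
        have := add_self_fun (dl w)
        calc _ = dl x + dl (q i) + (dl w + dl w) := by rw [this, add_zero]
          _ = _ := by abel
      · rw [cEA i hi, cJA i hi]; omega
    · push Not at hxw
      have hne : q n ≠ w := fun h' => by
        rcases hends with h'' | h''
        · exact h'' (hxw.1.trans h'.symm)
        · exact hxw.2 h''
      obtain ⟨P, I, hI, hL⟩ := h.2 (q n) hnW w hw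
      refine ⟨_, _, Finset.union_subset_union (hallJB i) hI, hL.extend (Or.inl hne) (Q := EB i)
        (J := JB i) ((JB_W i hi).mono_right (hsubW I hI))
        (fun g hg v hv => (endsB i hi g hg v hv).imp_right Or.inl)
        (touchB i hi) ?_ (fun v hv => Or.inl (reachB i hi v hv))
        (Finset.mem_union_left _ (memJB i i le_rfl hi)) (Finset.mem_union_right _ hL.right) ?_⟩
      · rw [bdB i hi]
        have := add_self_fun (dl w)
        calc _ = dl (q n) + dl (q i) + (dl w + dl w) := by rw [this, add_zero]
          _ = _ := by abel
      · rw [cEB i hi, cJB i hi]; omega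
  -- two new vertices
  have case2 : ∀ i j, i ≤ j → j < n → ∃ P I, I ⊆ JB 0 ∪ W ∧ M.Linkage U P I (q i) (q j) := by
    intro i j hij hj
    have hi : i < n := by omega
    -- Since `i ≤ j`, the piece from `q i` to `x` and the piece from `q j` to `q n` share no edge.
    obtain ⟨P, I, hI, hL⟩ := h.2 x hx (q n) hnW
    have hdE : Disjoint (EA i) (EB j) := by
      refine Finset.disjoint_union_left.2 ⟨hfdis _ _ le_rfl, ?_⟩
      rw [Finset.disjoint_left]
      intro g h1 h2
      obtain ⟨a, ha, rfl⟩ := Finset.mem_image.1 h1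
      obtain ⟨b, hb, hab⟩ := Finset.mem_image.1 h2
      rw [Finset.mem_Ico] at ha hb
      have := hp.edge_inj hb.2 (by omega) hab
      omega
    refine ⟨_, _, Finset.union_subset_union
      (Finset.union_subset (hallJ i hi) (hallJB j)) hI, hL.extend hends (Q := EA i ∪ EB j)
      (J := JA i ∪ JB j) (Disjoint.mono_right (hsubW I hI)
        (Finset.disjoint_union_left.2 ⟨JA_W i hi, JB_W j hj⟩))
      ?_ ?_ ?_ ?_ ?_ ?_ ?_⟩
    · intro g hg v hv
      rcases Finset.mem_union.1 hg with hg | hg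
      · rcases endsA i hi g hg v hv with h' | h'
        · exact Or.inl (Finset.mem_union_left _ h')
        · exact Or.inr (Or.inl h')
      · rcases endsB j hj g hg v hv with h' | h'
        · exact Or.inl (Finset.mem_union_right _ h')
        · exact Or.inr (Or.inr h')
    · intro g hg
      rcases Finset.mem_union.1 hg with hg | hg
      · obtain ⟨v, hv, hi'⟩ := touchA i hi g hg
        exact ⟨v, Finset.mem_union_left _ hv, hi'⟩
      · obtain ⟨v, hv, hi'⟩ := touchB j hj g hg
        exact ⟨v, Finset.mem_union_right _ hv, hi'⟩
    · rw [bd_union hdE, bdA i hi, bdB j hj]; abel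
    · intro v hv
      rcases Finset.mem_union.1 hv with hv | hv
      · exact Or.inl ((reachA i hi v hv).mono Finset.subset_union_left)
      · exact Or.inr ((reachB j hj v hv).mono Finset.subset_union_right)
    · exact Finset.mem_union_left _ (Finset.mem_union_left _ (memJA i i le_rfl))
    · exact Finset.mem_union_left _ (Finset.mem_union_right _ (memJB j j le_rfl hj))
    · rw [Finset.card_union_of_disjoint hdE, cEA i hi, cEB j hj]
      rcases Nat.lt_or_eq_of_le hij with h' | rfl
      · have : Disjoint (JA i) (JB j) := by
          rw [Finset.disjoint_left]
          intro g h1 h2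
          obtain ⟨a, ha, rfl⟩ := Finset.mem_image.1 h1
          obtain ⟨b, hb, hab⟩ := Finset.mem_image.1 h2
          rw [Finset.mem_Ico] at ha hb
          have := hqinj _ _ (by omega) (by omega) hab
          omega
        rw [Finset.card_union_of_disjoint this, cJA i hi, cJB j hj]; omega
      -- For `i = j` the pieces make up the whole ear, with `n` inner vertices and `n + 1` edges:
      -- the permitted surplus.
      · have h1 : (JB 0).card ≤ (JA i ∪ JB i).card := by
          refine Finset.card_le_card fun v hv => ?_
          obtain ⟨k, hk, rfl⟩ := Finset.mem_image.1 hv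
          rw [Finset.mem_Ico] at hk
          rcases le_total k i with h' | h'
          · exact Finset.mem_union_left _ (memJA i k h')
          · exact Finset.mem_union_right _ (memJB i k h' hk.2)
        rw [cJB 0 hn0] at h1
        rw [if_pos ⟨rfl, fun hm => hqW i hi (h.1 hm)⟩]; omega
  refine ⟨JB 0 ∪ W, ?_, h.1.trans Finset.subset_union_right, ?_⟩
  · refine Finset.ssubset_iff_subset_ne.2 ⟨Finset.subset_union_right, fun h' => ?_⟩
    exact hqW 0 hn0 (h' ▸ Finset.mem_union_left _ (memJB 0 0 le_rfl hn0))
  · intro a ha b hb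
    rcases Finset.mem_union.1 ha with ha | ha <;> rcases Finset.mem_union.1 hb with hb | hb
    · obtain ⟨i, hi, rfl⟩ := Finset.mem_image.1 ha
      obtain ⟨j, hj, rfl⟩ := Finset.mem_image.1 hb
      rw [Finset.mem_Ico] at hi hj
      rcases le_total i j with h' | h'
      · exact case2 i j h' hj.2
      · obtain ⟨P, I, hI, hL⟩ := case2 j i h' hi.2
        exact ⟨P, I, hI, hL.symm⟩
    · obtain ⟨i, hi, rfl⟩ := Finset.mem_image.1 ha
      rw [Finset.mem_Ico] at hi
      exact case1 i hi.2 b hb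
    · obtain ⟨i, hi, rfl⟩ := Finset.mem_image.1 hb
      rw [Finset.mem_Ico] at hi
      obtain ⟨P, I, hI, hL⟩ := case1 i hi.2 a ha
      exact ⟨P, I, hI, hL.symm⟩
    · obtain ⟨P, I, hI, hL⟩ := h.2 a ha b hb
      exact ⟨P, I, hI.trans Finset.subset_union_right, hL⟩

/-- By connectedness a largest set that is linked to `U` within itself contains every vertex. -/
theorem exists_ear (hc : M.Cubic) (hb : M.Bridgeless)
    (hconn : ∀ u v, M.Reach Finset.univ u v) {U : Finset ν} (hU : U.Nonempty) (v : ν) :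
    ∃ P I, M.Linkage U P I v v := by
  classical
  obtain ⟨W, hW, hmax⟩ := Finset.exists_max_image
    (Finset.univ.filter fun W => M.LinkedWithin U W) Finset.card
    ⟨U, by
      simp only [Finset.mem_filter, Finset.mem_univ, true_and]
      exact ⟨le_rfl, fun x hx y hy => ⟨∅, ∅, by simp, Linkage.trivial hx hy⟩⟩⟩
  simp only [Finset.mem_filter, Finset.mem_univ, true_and] at hW hmax
  by_cases hv : v ∈ W
  · obtain ⟨P, I, -, hL⟩ := hW.2 v hv v hv
    exact ⟨P, I, hL⟩
  · obtain ⟨u, hu⟩ := hU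
    obtain ⟨W', h1, h2⟩ := hW.exists_larger hc hb (hconn u v) (hW.1 hu) hv
    exact absurd (Finset.card_lt_card h1) (hmax W' h2).not_gt

/-! ### Joins in subgraphs built from ears -/

variable (M) in
/-- A connected bridgeless subgraph with vertices `U ∋ v₀` and edges `X`, built from `r` ears;
every even vertex set has a join using at most half of the edges outside `Δ`. -/
structure EarBuilt (Δ : Finset ε) (v₀ : ν) (U : Finset ν) (X : Finset ε) (r : ℕ) : Prop where
  base : v₀ ∈ U
  ends : ∀ e ∈ X, ∀ v, M.Inc e v → v ∈ U
  card : X.card + 1 ≤ U.card + r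
  dg : ∀ u ∈ U, u ≠ v₀ → 2 ≤ M.dg X u
  join : ∀ τ : ν → ZMod 2, (∀ v ∉ U, τ v = 0) → ∑ v, τ v = 0 →
    ∃ K ⊆ X, M.bd K = τ ∧ 2 * (K \ Δ).card ≤ (X \ Δ).card

theorem EarBuilt.single (Δ : Finset ε) (v₀ : ν) : M.EarBuilt Δ v₀ {v₀} ∅ 0 where
  base := by simp
  ends := by simp
  card := by simp
  dg := by simp
  join := fun τ hτ hs => by
    refine ⟨∅, le_rfl, ?_, by simp⟩
    have h1 : ∑ v, τ v = τ v₀ := Finset.sum_eq_single v₀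
      (fun v _ hv => hτ v (by simpa using hv)) (by simp)
    funext v
    by_cases hv : v = v₀
    · rw [hv, ← h1, hs]; simp
    · rw [hτ v (by simpa using hv)]; simp

/-- The ear is even at its inner vertices, so a subset of `P` and its complement in `P` have the
same boundary there. The one with fewer edges outside `Δ` is used, and the boundary that remains
lies in `U`, where the old subgraph supplies a join. -/
theorem EarBuilt.add_ear {Δ : Finset ε} {v₀ : ν} {U : Finset ν} {X : Finset ε} {r : ℕ}
    (h : M.EarBuilt Δ v₀ U X r) {P : Finset ε} {I : Finset ν} {v : ν}
    (hL : M.Linkage U P I v v) : M.EarBuilt Δ v₀ (U ∪ I) (X ∪ P) (r + 1) := by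
  have hXP : Disjoint X P := by
    rw [Finset.disjoint_left]
    intro e h1 h2
    obtain ⟨w, hw, hi⟩ := hL.touch e h2
    exact Finset.disjoint_left.1 hL.disj hw (h.ends e h1 w hi)
  have hbd0 : ∀ w ∈ I, M.bd P w = 0 := fun w hw => by
    rw [hL.bd w hw]; exact CharTwo.add_self_eq_zero _
  have hPout : ∀ w, w ∉ U ∪ I → ∀ A ⊆ P, M.bd A w = 0 := fun w hw A hA => bd_of_notMem fun hm => by
    obtain ⟨e, he, hi⟩ := mem_verts.1 hm
    exact hw (Finset.union_comm I U ▸ hL.ends e (hA he) w hi)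
  -- Parities are corrected one vertex at a time by paths inside the ear to `U`.
  have hjoin : ∀ (τ : ν → ZMod 2) (J : Finset ν), J ⊆ I →
      ∃ A ⊆ P, ∀ w ∈ I, M.bd A w = if w ∈ J then τ w else 0 := by
    intro τ J
    induction J using Finset.induction_on with
    | empty => exact fun _ => ⟨∅, by simp, by simp⟩
    | insert a J ha ih =>
      intro hJ
      obtain ⟨A, hA, hA'⟩ := ih ((Finset.subset_insert a J).trans hJ)
      have haI := hJ (Finset.mem_insert_self a J)
      rcases zmod_two_cases (τ a) with h0 | h1
      · refine ⟨A, hA, fun w hw => ?_⟩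
        rw [hA' w hw]
        by_cases hwa : w = a
        · subst hwa; simp [ha, h0]
        · simp [hwa]
      · obtain ⟨u, hu, hr⟩ := hL.reach a haI
        obtain ⟨B, hB, hB'⟩ := hr.exists_bd
        refine ⟨A ∆ B, fun e he => ?_, fun w hw => ?_⟩
        · rcases Finset.mem_symmDiff.1 he with he | he
          · exact hA he.1
          · exact hB he.1
        · have hwu : w ≠ u := fun h' => Finset.disjoint_left.1 hL.disj hw (h' ▸ hu)
          rw [bd_symmDiff, hB', Pi.add_apply, hA' w hw, Pi.add_apply, dl_ne hwu]
          by_cases hwa : w = a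
          · subst hwa; simp [ha, h1, dl_self]
          · simp [hwa, dl_ne hwa]
  refine ⟨Finset.mem_union_left _ h.base, ?_, ?_, ?_, ?_⟩
  · intro e he w hw
    rcases Finset.mem_union.1 he with he | he
    · exact Finset.mem_union_left _ (h.ends e he w hw)
    · rw [Finset.union_comm]; exact hL.ends e he w hw
  · have h1 := h.card
    have h2 := hL.card
    have h3 : (if v = v ∧ v ∉ U then 1 else 0) ≤ 1 := by split_ifs <;> omega
    rw [Finset.card_union_of_disjoint hXP, Finset.card_union_of_disjoint hL.disj.symm]
    omega
  · intro u hu hne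
    rcases Finset.mem_union.1 hu with hu | hu
    · exact (h.dg u hu hne).trans (dg_mono Finset.subset_union_left u)
    · refine le_trans (two_le_dg ?_ (hbd0 u hu)) (dg_mono Finset.subset_union_right u)
      obtain ⟨w, hw, hr⟩ := hL.reach u hu
      rcases Relation.ReflTransGen.cases_head hr with h' | ⟨z, ⟨g, hg, hl⟩, -⟩
      · exact absurd (h' ▸ hw) (Finset.disjoint_left.1 hL.disj hu)
      · exact mem_verts.2 ⟨g, hg, hl.inc_left⟩
  · intro τ hτ hs
    obtain ⟨A, hA, hA', hAc⟩ : ∃ A ⊆ P, (∀ w ∈ I, M.bd A w = τ w) ∧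
        2 * (A \ Δ).card ≤ (P \ Δ).card := by
      obtain ⟨A, hA, hA'⟩ := hjoin τ I le_rfl
      have hsplit : (A \ Δ).card + ((P \ A) \ Δ).card = (P \ Δ).card := by
        rw [← Finset.card_union_of_disjoint]
        · congr 1
          ext e
          have := @hA e
          simp only [Finset.mem_union, Finset.mem_sdiff]
          tauto
        · exact Finset.disjoint_sdiff.mono Finset.sdiff_subset Finset.sdiff_subset
      rcases le_total (A \ Δ).card ((P \ A) \ Δ).card with hle | hle
      · exact ⟨A, hA, fun w hw => by rw [hA' w hw, if_pos hw], by omega⟩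
      · refine ⟨P \ A, Finset.sdiff_subset, fun w hw => ?_, by omega⟩
        rw [bd_sdiff hA, Pi.add_apply, hbd0 w hw, hA' w hw, if_pos hw, zero_add]
    obtain ⟨K, hK, hKb, hKc⟩ := h.join (τ + M.bd A) (fun w hw => by
      by_cases hwI : w ∈ I
      · rw [Pi.add_apply, hA' w hwI]; exact CharTwo.add_self_eq_zero _
      · have hw' : w ∉ U ∪ I := by simp [hw, hwI]
        rw [Pi.add_apply, hτ w hw', hPout w hw' A hA, add_zero]) (by
      simp only [Pi.add_apply]
      rw [Finset.sum_add_distrib, hs, sum_bd, add_zero])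
    have hKA : Disjoint K A := hXP.mono hK hA
    refine ⟨K ∪ A, Finset.union_subset_union hK hA, ?_, ?_⟩
    · rw [bd_union hKA, hKb, add_assoc, add_self_fun, add_zero]
    · rw [Finset.union_sdiff_distrib, Finset.union_sdiff_distrib,
        Finset.card_union_of_disjoint (hKA.mono Finset.sdiff_subset Finset.sdiff_subset),
        Finset.card_union_of_disjoint (hXP.mono Finset.sdiff_subset Finset.sdiff_subset)]
      omega

theorem exists_earBuilt (hc : M.Cubic) (hb : M.Bridgeless)
    (hconn : ∀ u v, M.Reach Finset.univ u v) (Δ : Finset ε) (v₀ : ν)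
    (S : Finset (Finset ε)) (hS : ∀ C ∈ S, (M.verts C).Nonempty) :
    ∃ U X, M.EarBuilt Δ v₀ U X S.card ∧ ∀ C ∈ S, ∃ u ∈ U, u ∈ M.verts C := by
  induction S using Finset.induction_on with
  | empty => exact ⟨_, _, EarBuilt.single Δ v₀, by simp⟩
  | insert C S hC ih =>
    obtain ⟨U, X, hE, hU⟩ := ih fun D hD => hS D (Finset.mem_insert_of_mem hD)
    obtain ⟨v, hv⟩ := hS C (Finset.mem_insert_self C S)
    obtain ⟨P, I, hL⟩ := exists_ear hc hb hconn ⟨v₀, hE.base⟩ v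
    refine ⟨U ∪ I, X ∪ P, ?_, fun D hD => ?_⟩
    · rw [Finset.card_insert_of_notMem hC]; exact hE.add_ear hL
    · rcases Finset.mem_insert.1 hD with rfl | hD
      · exact ⟨v, Finset.union_comm I U ▸ hL.left, hv⟩
      · obtain ⟨u, hu, hu'⟩ := hU D hD
        exact ⟨u, Finset.mem_union_left _ hu, hu'⟩

/-! ### Sign-circuit covers -/

variable (M) in
/-- The union of two vertex-disjoint unbalanced circuits and a path joining them. -/
def Barbell (σ : ε → ℤˣ) (A : Finset ε) : Prop :=
  ∃ (C₁ C₂ : Finset ε) (n : ℕ) (p : ℕ → ν) (e : ℕ → ε),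
    M.Circ C₁ ∧ M.Circ C₂ ∧ sgn σ C₁ = -1 ∧ sgn σ C₂ = -1 ∧
    Disjoint (M.verts C₁) (M.verts C₂) ∧ M.IsPath n p e ∧
    (∀ i ≤ n, p i ∈ M.verts C₁ ↔ i = 0) ∧ (∀ i ≤ n, p i ∈ M.verts C₂ ↔ i = n) ∧
    A = C₁ ∪ (Finset.Ico 0 n).image e ∪ C₂

variable (M) in
/-- A balanced circuit or a barbell. -/
def SignCircuit (σ : ε → ℤˣ) (A : Finset ε) : Prop :=
  (M.Circ A ∧ sgn σ A = 1) ∨ M.Barbell σ A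

variable (M) in
/-- The edges of `S` can be covered by sign-circuits of total length at most `L`. -/
def Cov (σ : ε → ℤˣ) (S : Finset ε) (L : ℕ) : Prop :=
  ∃ F : Multiset (Finset ε), (∀ A ∈ F, M.SignCircuit σ A) ∧ (∀ e ∈ S, ∃ A ∈ F, e ∈ A) ∧
    (F.map Finset.card).sum ≤ L

variable {σ : ε → ℤˣ}

theorem Cov.mono {S T : Finset ε} {L L' : ℕ} (h : M.Cov σ T L) (hS : S ⊆ T) (hL : L ≤ L') :
    M.Cov σ S L' := by
  obtain ⟨F, h1, h2, h3⟩ := h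
  exact ⟨F, h1, fun e he => h2 e (hS he), h3.trans hL⟩

theorem Cov.empty : M.Cov σ ∅ 0 := ⟨0, by simp, by simp, by simp⟩

theorem Cov.union {S T : Finset ε} {a b : ℕ} (h : M.Cov σ S a) (h' : M.Cov σ T b) :
    M.Cov σ (S ∪ T) (a + b) := by
  obtain ⟨F, h1, h2, h3⟩ := h
  obtain ⟨F', h1', h2', h3'⟩ := h'
  refine ⟨F + F', ?_, ?_, ?_⟩
  · intro A hA
    rcases Multiset.mem_add.1 hA with hA | hA
    · exact h1 A hA
    · exact h1' A hA
  · intro e he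
    rcases Finset.mem_union.1 he with he | he
    · obtain ⟨A, hA, h⟩ := h2 e he
      exact ⟨A, Multiset.mem_add.2 (Or.inl hA), h⟩
    · obtain ⟨A, hA, h⟩ := h2' e he
      exact ⟨A, Multiset.mem_add.2 (Or.inr hA), h⟩
  · rw [Multiset.map_add, Multiset.sum_add]; omega

theorem Cov.biUnion {ι : Type*} [DecidableEq ι] (S : Finset ι) (f : ι → Finset ε) (L : ι → ℕ)
    (h : ∀ i ∈ S, M.Cov σ (f i) (L i)) : M.Cov σ (S.biUnion f) (∑ i ∈ S, L i) := by
  induction S using Finset.induction_on with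
  | empty => simpa using Cov.empty
  | insert a S ha ih =>
    rw [Finset.biUnion_insert, Finset.sum_insert ha]
    exact (h a (Finset.mem_insert_self a S)).union
      (ih fun i hi => h i (Finset.mem_insert_of_mem hi))

theorem SignCircuit.cov {A : Finset ε} (h : M.SignCircuit σ A) : M.Cov σ A A.card :=
  ⟨{A}, by simpa using h, by simp, by simp⟩

theorem card_biUnion_circ {S : Finset (Finset ε)}
    (hS : ∀ C ∈ S, ∀ D ∈ S, C ≠ D → Disjoint C D) :
    (S.biUnion id).card = ∑ C ∈ S, C.card :=
  Finset.card_biUnion hS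

/-- An even set all of whose circuits are balanced is covered by them. -/
theorem cov_of_balanced {A : Finset ε} (hA : M.bd A = 0)
    (h : ∀ C ⊆ A, M.Circ C → sgn σ C = 1) : M.Cov σ A A.card := by
  obtain ⟨S, h1, h2, h3⟩ := exists_circ_decomposition A hA
  have h4 := Cov.biUnion (M := M) (σ := σ) S id Finset.card fun C hC =>
    SignCircuit.cov (Or.inl ⟨h1 C hC, h C (h3 ▸ Finset.subset_biUnion_of_mem id hC) (h1 C hC)⟩)
  rwa [← card_biUnion_circ h2, h3] at h4

/-- Two disjoint unbalanced circuits joined by a path inside `P`. -/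
theorem exists_barbell {C₁ C₂ : Finset ε} (h₁ : M.Circ C₁) (h₂ : M.Circ C₂)
    (hs₁ : sgn σ C₁ = -1) (hs₂ : sgn σ C₂ = -1) (hd : Disjoint (M.verts C₁) (M.verts C₂))
    {P : Finset ε} {u v : ν} (hP : M.Reach P u v) (hu : u ∈ M.verts C₁) (hv : v ∈ M.verts C₂) :
    ∃ (n : ℕ) (p : ℕ → ν) (e : ℕ → ε), M.IsPath n p e ∧ (∀ i < n, e i ∈ P) ∧
      (∀ i ≤ n, p i ∈ M.verts C₁ ↔ i = 0) ∧ (∀ i ≤ n, p i ∈ M.verts C₂ ↔ i = n) ∧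
      M.SignCircuit σ (C₁ ∪ (Finset.Ico 0 n).image e ∪ C₂) := by
  have : Nonempty ε := ⟨h₁.1.choose⟩
  obtain ⟨n, p, e, hp, he, h0, hn, hA, hB⟩ :=
    hP.exists_isPath (A := (M.verts C₁ : Set ν)) (B := (M.verts C₂ : Set ν)) hu hv
  have hA' : ∀ i ≤ n, p i ∈ M.verts C₁ ↔ i = 0 := fun i hi => ⟨hA i hi, fun h => h ▸ h0⟩
  have hB' : ∀ i ≤ n, p i ∈ M.verts C₂ ↔ i = n := fun i hi => ⟨hB i hi, fun h => h ▸ hn⟩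
  exact ⟨n, p, e, hp, he, hA', hB',
    Or.inr ⟨C₁, C₂, n, p, e, h₁, h₂, hs₁, hs₂, hd, hp, hA', hB', rfl⟩⟩

/-- Disjoint unbalanced circuits are covered by barbells using the edges of a join. -/
theorem cov_of_join (S : Finset (Finset ε)) (rep : Finset ε → ν) (K : Finset ε)
    (hS : ∀ C ∈ S, M.Circ C ∧ sgn σ C = -1)
    (hd : ∀ C ∈ S, ∀ D ∈ S, C ≠ D → Disjoint (M.verts C) (M.verts D))
    (hrep : ∀ C ∈ S, rep C ∈ M.verts C) (hK : M.bd K = ∑ C ∈ S, dl (rep C)) :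
    M.Cov σ (S.biUnion id) (∑ C ∈ S, C.card + K.card) := by
  induction S using Finset.strongInduction generalizing K with
  | H S ih =>
    rcases S.eq_empty_or_nonempty with rfl | ⟨C₁, h₁⟩
    · exact Cov.empty.mono (by simp) (by simp)
    · have hne : ∀ C ∈ S, ∀ D ∈ S, C ≠ D → rep C ≠ rep D := fun C hC D hD hCD h =>
        Finset.disjoint_left.1 (hd C hC D hD hCD) (hrep C hC) (h ▸ hrep D hD)
      have hval : M.bd K (rep C₁) = 1 := by
        rw [hK, Finset.sum_apply, Finset.sum_eq_single C₁ (fun D hD h => dl_ne (hne C₁ h₁ D hD h.symm))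
          (fun h => absurd h₁ h), dl_self]
      obtain ⟨v, hv, hv1, hr⟩ := exists_reach_bd_one hval
      obtain ⟨C₂, h₂, rfl⟩ : ∃ C₂ ∈ S, rep C₂ = v := by
        by_contra! hcon
        rw [hK, Finset.sum_apply, Finset.sum_eq_zero fun D hD => dl_ne (hcon D hD).symm] at hv1
        exact absurd hv1 (by decide)
      have h12 : C₁ ≠ C₂ := fun h => hv (h ▸ rfl)
      -- Removing `P` leaves a join for the representatives other than those of `C₁` and `C₂`, so
      -- all barbell paths together use each edge of `K` at most once.
      obtain ⟨P, hP, hPb⟩ := hr.exists_bd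
      obtain ⟨n, p, e, hp, he, -, -, hsc⟩ := exists_barbell (hS C₁ h₁).1 (hS C₂ h₂).1 (hS C₁ h₁).2
        (hS C₂ h₂).2 (hd C₁ h₁ C₂ h₂ h12) (reach_of_bd hPb) (hrep C₁ h₁) (hrep C₂ h₂)
      have hsub : ∀ C ∈ (S.erase C₁).erase C₂, C ∈ S := fun C hC =>
        Finset.mem_of_mem_erase (Finset.mem_of_mem_erase hC)
      have h₂' : C₂ ∈ S.erase C₁ := Finset.mem_erase.2 ⟨h12.symm, h₂⟩
      have hih := ih ((S.erase C₁).erase C₂)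
        ((Finset.erase_subset _ _).trans_ssubset (Finset.erase_ssubset h₁)) (K \ P)
        (fun C hC => hS C (hsub C hC))
        (fun C hC D hD => hd C (hsub C hC) D (hsub D hD)) (fun C hC => hrep C (hsub C hC)) (by
          rw [bd_sdiff hP, hK, hPb, ← Finset.add_sum_erase S _ h₁, ← Finset.add_sum_erase _ _ h₂']
          have := add_self_fun (dl (rep C₁) + dl (rep C₂))
          calc _ = (dl (rep C₁) + dl (rep C₂) + (dl (rep C₁) + dl (rep C₂))) +
                ∑ C ∈ (S.erase C₁).erase C₂, dl (rep C) := by abel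
            _ = _ := by rw [this, zero_add])
      refine (hsc.cov.union hih).mono ?_ ?_
      · intro f hf
        obtain ⟨C, hC, hfC⟩ := Finset.mem_biUnion.1 hf
        simp only [Finset.mem_union, Finset.mem_biUnion]
        by_cases hC1 : C = C₁
        · subst hC1; exact Or.inl (Or.inl (Or.inl hfC))
        by_cases hC2 : C = C₂
        · subst hC2; exact Or.inl (Or.inr hfC)
        · exact Or.inr ⟨C, by simp [hC1, hC2, hC], hfC⟩
      · have hc1 : ((Finset.Ico 0 n).image e).card ≤ P.card := Finset.card_le_card fun f hf => by
          obtain ⟨i, hi, rfl⟩ := Finset.mem_image.1 hf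
          exact he i (Finset.mem_Ico.1 hi).2
        have hc2 := Finset.card_sdiff_add_card_eq_card hP
        have hc3 := Finset.card_union_le (C₁ ∪ (Finset.Ico 0 n).image e) C₂
        have hc4 := Finset.card_union_le C₁ ((Finset.Ico 0 n).image e)
        rw [← Finset.add_sum_erase S _ h₁, ← Finset.add_sum_erase _ _ h₂']
        omega

theorem Circ.verts_nonempty {C : Finset ε} (h : M.Circ C) : (M.verts C).Nonempty := by
  obtain ⟨e, he⟩ := h.1
  exact ⟨M.s e, mem_verts.2 ⟨e, he, Or.inl rfl⟩⟩

theorem Circ.two_le_card (hc : M.Cubic) {C : Finset ε} (h : M.Circ C) : 2 ≤ C.card := by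
  obtain ⟨e, he⟩ := h.1
  rw [← hc.card_verts h.2.1, ← Finset.card_pair (M.ne e)]
  refine Finset.card_le_card fun v hv => mem_verts.2 ⟨e, he, ?_⟩
  rcases Finset.mem_insert.1 hv with rfl | hv
  · exact Or.inl rfl
  · exact Or.inr (Finset.mem_singleton.1 hv).symm

theorem sgn_biUnion {S : Finset (Finset ε)}
    (hS : ∀ C ∈ S, ∀ D ∈ S, C ≠ D → Disjoint C D) :
    sgn σ (S.biUnion id) = ∏ C ∈ S, sgn σ C :=
  Finset.prod_biUnion hS

/-- A boundary supported on two vertices vanishes or consists of both. -/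
theorem bd_cases {K : Finset ε} {x y : ν} (hxy : x ≠ y)
    (hout : ∀ u, u ≠ x → u ≠ y → M.bd K u = 0) : M.bd K = 0 ∨ M.bd K = dl x + dl y := by
  have hsum := sum_bd (M := M) K
  rw [← Finset.sum_subset (Finset.subset_univ {x, y}) (fun u _ hu => by
    simp only [Finset.mem_insert, Finset.mem_singleton, not_or] at hu
    exact hout u hu.1 hu.2), Finset.sum_pair hxy] at hsum
  rcases zmod_two_cases (M.bd K x) with h0 | h1
  · left; funext u
    by_cases hux : u = x
    · rw [hux, h0]; rfl
    by_cases huy : u = y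
    · rw [h0, zero_add] at hsum; rw [huy, hsum]; rfl
    · exact hout u hux huy
  · have h1' : M.bd K y = 1 := by
      rcases zmod_two_cases (M.bd K y) with h | h
      · rw [h1, h] at hsum; exact absurd hsum (by decide)
      · exact h
    right; funext u
    by_cases hux : u = x
    · rw [hux, h1, Pi.add_apply, dl_self, dl_ne hxy, add_zero]
    by_cases huy : u = y
    · rw [huy, h1', Pi.add_apply, dl_self, dl_ne hxy.symm, zero_add]
    · rw [hout u hux huy, Pi.add_apply, dl_ne hux, dl_ne huy, add_zero]

/-- Inside a digon a set of edges has either no boundary or both vertices as boundary; adding it to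
a representative keeps that vertex or exchanges it for the other. -/
theorem exists_rep_of_digon (hc : M.Cubic) {D : Finset ε} (hD : M.Circ D) (h2 : D.card = 2)
    {K : Finset ε} (hK : K ⊆ D) {v : ν} (hv : v ∈ M.verts D) :
    ∃ w ∈ M.verts D, dl v + M.bd K = dl w := by
  rw [← hc.card_verts hD.2.1, Finset.card_eq_two] at h2
  obtain ⟨x, y, hxy, hV⟩ := h2
  have hout : ∀ u, u ≠ x → u ≠ y → M.bd K u = 0 := fun u hx hy => bd_of_notMem fun hu => by
    have := verts_mono hK hu
    rw [hV] at this; simp [hx, hy] at this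
  have hcase := bd_cases hxy hout
  rcases hcase with h | h
  · exact ⟨v, hv, by rw [h, add_zero]⟩
  · have hv' := hv
    rw [hV, Finset.mem_insert, Finset.mem_singleton] at hv'
    rcases hv' with rfl | rfl
    · exact ⟨y, by simp [hV], by rw [h, ← add_assoc, add_self_fun, zero_add]⟩
    · exact ⟨x, by simp [hV], by rw [h, add_comm (dl x), ← add_assoc, add_self_fun, zero_add]⟩

/-- A family of an even number of disjoint unbalanced circuits has a join on representatives
with at most two thirds as many edges as there are vertices. -/
theorem exists_short_join [Nonempty ν] (hc : M.Cubic) (hb : M.Bridgeless)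
    (hconn : ∀ u v, M.Reach Finset.univ u v) (S : Finset (Finset ε))
    (hS : ∀ C ∈ S, M.Circ C)
    (hd : ∀ C ∈ S, ∀ D ∈ S, C ≠ D → Disjoint (M.verts C) (M.verts D)) (heven : Even S.card) :
    ∃ (rep : Finset ε → ν) (K : Finset ε), (∀ C ∈ S, rep C ∈ M.verts C) ∧
      M.bd K = ∑ C ∈ S, dl (rep C) ∧ 3 * K.card ≤ 2 * Fintype.card ν := by
  rcases S.eq_empty_or_nonempty with rfl | ⟨C₁, h₁⟩
  · exact ⟨fun _ => Classical.arbitrary ν, ∅, by simp, by simp, by simp⟩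
  obtain ⟨v₀, hv₀⟩ := (hS C₁ h₁).verts_nonempty
  -- The bound needs at most a third as many circuits as vertices, which digons may violate; they
  -- are treated separately.
  set 𝒟 := S.filter fun C => C.card = 2 with h𝒟
  have h𝒟S : 𝒟 ⊆ S := Finset.filter_subset _ _
  set Δ := 𝒟.biUnion id with hΔ
  -- The base vertex already lies on `C₁`, so one ear fewer than the number of circuits is needed.
  obtain ⟨U, X, hE, hU⟩ := exists_earBuilt hc hb hconn Δ v₀ (S.erase C₁)
    fun C hC => (hS C (Finset.mem_of_mem_erase hC)).verts_nonempty
  have hU' : ∀ C, ∃ u, C ∈ S → u ∈ U ∧ u ∈ M.verts C := fun C => by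
    by_cases hC : C ∈ S
    · by_cases hC1 : C = C₁
      · exact ⟨v₀, fun _ => ⟨hE.base, hC1 ▸ hv₀⟩⟩
      · obtain ⟨u, hu⟩ := hU C (Finset.mem_erase.2 ⟨hC1, hC⟩)
        exact ⟨u, fun _ => hu⟩
    · exact ⟨v₀, fun h => absurd h hC⟩
  choose rep hrep using hU'
  obtain ⟨K, hKX, hK, hKc⟩ := hE.join (∑ C ∈ S, dl (rep C)) (fun v hv => by
      rw [Finset.sum_apply]
      exact Finset.sum_eq_zero fun C hC => dl_ne fun h => hv (h ▸ (hrep C hC).1)) (by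
      simp only [Finset.sum_apply]
      rw [Finset.sum_comm]
      simp only [sum_dl, Finset.mem_univ, if_true, Finset.sum_const, nsmul_eq_mul, mul_one]
      exact (ZMod.natCast_eq_zero_iff_even).2 heven)
  have hdE : ∀ C ∈ S, ∀ D ∈ S, C ≠ D → Disjoint C D := fun C hC D hD h =>
    disjoint_of_verts (hd C hC D hD h)
  -- Join edges inside a digon are discarded at the price of moving its representative.
  have hrep' : ∀ C, ∃ w, C ∈ S → w ∈ M.verts C ∧
      dl (rep C) + (if C ∈ 𝒟 then M.bd (K ∩ C) else 0) = dl w := fun C => by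
    by_cases hC : C ∈ S
    · by_cases hC2 : C ∈ 𝒟
      · obtain ⟨w, hw⟩ := exists_rep_of_digon hc (hS C hC) (Finset.mem_filter.1 hC2).2
          (K := K ∩ C) Finset.inter_subset_right (hrep C hC).2
        exact ⟨w, fun _ => by rwa [if_pos hC2]⟩
      · exact ⟨rep C, fun _ => ⟨(hrep C hC).2, by rw [if_neg hC2, add_zero]⟩⟩
    · exact ⟨v₀, fun h => absurd h hC⟩
  choose rep' hrep' using hrep'
  refine ⟨rep', K \ Δ, fun C hC => (hrep' C hC).1, ?_, ?_⟩
  · have h1 : K \ Δ = K \ (K ∩ Δ) := by simp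
    have h2 : K ∩ Δ = 𝒟.biUnion fun C => K ∩ C := by
      ext e; simp only [hΔ, Finset.mem_inter, Finset.mem_biUnion, id]; grind
    have h3 : M.bd (K ∩ Δ) = ∑ C ∈ S, if C ∈ 𝒟 then M.bd (K ∩ C) else 0 := by
      rw [h2, bd_biUnion _ _ fun C hC D hD h => (hdE C (h𝒟S hC) D (h𝒟S hD) h).mono
        Finset.inter_subset_right Finset.inter_subset_right, ← Finset.sum_filter,
        Finset.filter_mem_eq_inter, Finset.inter_eq_right.2 h𝒟S]
    rw [h1, bd_sdiff Finset.inter_subset_left, hK, h3, ← Finset.sum_add_distrib]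
    exact Finset.sum_congr rfl fun C hC => (hrep' C hC).2
  -- At its representative both `X` and the digon have degree at least two, so they share an edge.
  -- Every digon other than `C₁` thus removes an edge of `X` from the count.
  · have hmeet : ∀ D ∈ 𝒟.erase C₁, 1 ≤ (X ∩ D).card := by
      intro D hD
      rw [Finset.mem_erase] at hD
      have hDS := h𝒟S hD.2
      obtain ⟨hu, hu'⟩ := hrep D hDS
      have hne : rep D ≠ v₀ := fun h =>
        Finset.disjoint_left.1 (hd D hDS C₁ h₁ hD.1) hu' (h ▸ hv₀)
      have h2 := hE.dg _ hu hne
      have h3 := hc.dg_eq_two (hS D hDS).2.1 hu'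
      rw [Nat.one_le_iff_ne_zero, Finset.card_ne_zero, ← Finset.not_disjoint_iff_nonempty_inter]
      intro hdis
      have h4 := dg_union (M := M) hdis (rep D)
      have h5 := hc.dg_le (X ∪ D) (rep D)
      omega
    have hXΔ : (𝒟.erase C₁).card ≤ (X ∩ Δ).card := by
      calc (𝒟.erase C₁).card = ∑ D ∈ 𝒟.erase C₁, 1 := by simp
        _ ≤ ∑ D ∈ 𝒟.erase C₁, (X ∩ D).card := Finset.sum_le_sum hmeet
        _ = ((𝒟.erase C₁).biUnion fun D => X ∩ D).card := by
          refine (Finset.card_biUnion fun C hC D hD h => ?_).symm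
          exact (hdE C (h𝒟S (Finset.mem_of_mem_erase hC)) D
            (h𝒟S (Finset.mem_of_mem_erase hD)) h).mono
            Finset.inter_subset_right Finset.inter_subset_right
        _ ≤ _ := Finset.card_le_card fun e he => by
          obtain ⟨D, hD, he⟩ := Finset.mem_biUnion.1 he
          rw [Finset.mem_inter] at he
          exact Finset.mem_inter.2
            ⟨he.1, Finset.mem_biUnion.2 ⟨D, Finset.mem_of_mem_erase hD, he.2⟩⟩
    have hlong : 3 * (S \ 𝒟).card ≤ Fintype.card ν := by
      calc 3 * (S \ 𝒟).card = ∑ C ∈ S \ 𝒟, 3 := by simp [mul_comm]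
        _ ≤ ∑ C ∈ S \ 𝒟, (M.verts C).card := Finset.sum_le_sum fun C hC => by
          rw [Finset.mem_sdiff] at hC
          have h1 := (hS C hC.1).two_le_card hc
          have h2 : C.card ≠ 2 := fun h => hC.2 (Finset.mem_filter.2 ⟨hC.1, h⟩)
          rw [hc.card_verts (hS C hC.1).2.1]; omega
        _ = ((S \ 𝒟).biUnion M.verts).card := (Finset.card_biUnion fun C hC D hD h =>
          hd C (Finset.sdiff_subset hC) D (Finset.sdiff_subset hD) h).symm
        _ ≤ _ := Finset.card_le_univ _
    -- Outside the digons `X` has at most `n + (|S| - 1) - 1 - (|𝒟| - 1) = n + |S \ 𝒟| - 1` edges,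
    -- fewer than `4n/3`, and the join uses at most half of them.
    have h1 := hE.card
    have h2 : U.card ≤ Fintype.card ν := Finset.card_le_univ U
    have h3 := Finset.card_erase_of_mem h₁
    have h4 := Finset.pred_card_le_card_erase (s := 𝒟) (a := C₁)
    have h5 := Finset.card_sdiff_add_card_eq_card h𝒟S
    have h6 := Finset.card_sdiff_add_card_inter X Δ
    have h7 : 0 < S.card := Finset.card_pos.2 ⟨C₁, h₁⟩
    omega

/-- An even set of positive sign is covered with an overhead of at most `2 / 3` per vertex. -/
theorem cov_of_even [Nonempty ν] (hc : M.Cubic) (hb : M.Bridgeless)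
    (hconn : ∀ u v, M.Reach Finset.univ u v) {A : Finset ε} (hA : M.bd A = 0)
    (hs : sgn σ A = 1) : ∃ k, 3 * k ≤ 2 * Fintype.card ν ∧ M.Cov σ A (A.card + k) := by
  obtain ⟨T, h1, h2, h3⟩ := exists_circ_decomposition A hA
  set S := T.filter fun C => sgn σ C = -1 with hSdef
  have hST : S ⊆ T := Finset.filter_subset _ _
  -- Each unbalanced circuit contributes a factor `-1` to the positive sign of `A`.
  have heven : Even S.card := by
    have h4 : sgn σ A = (-1) ^ S.card := by
      rw [← h3, sgn_biUnion h2, ← Finset.prod_filter_mul_prod_filter_not T fun C => sgn σ C = -1,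
        Finset.prod_congr rfl fun C hC => (Finset.mem_filter.1 hC).2, Finset.prod_const,
        Finset.prod_eq_one fun C hC => (sgn_cases σ C).resolve_right (Finset.mem_filter.1 hC).2,
        mul_one]
    by_contra hodd
    rw [hs, (Nat.not_even_iff_odd.1 hodd).neg_one_pow] at h4
    exact absurd h4 (by decide)
  have hdv : ∀ C ∈ T, ∀ D ∈ T, C ≠ D → Disjoint (M.verts C) (M.verts D) := fun C hC D hD hCD =>
    hc.disjoint_verts (h1 C hC).2.1 (h1 D hD).2.1 (h2 C hC D hD hCD)
  obtain ⟨rep, K, hr, hK, hKc⟩ := exists_short_join hc hb hconn S (fun C hC => h1 C (hST hC))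
    (fun C hC D hD => hdv C (hST hC) D (hST hD)) heven
  have hcov := cov_of_join (σ := σ) S rep K
    (fun C hC => ⟨h1 C (hST hC), (Finset.mem_filter.1 hC).2⟩)
    (fun C hC D hD => hdv C (hST hC) D (hST hD)) hr hK
  have hcov' := Cov.biUnion (M := M) (σ := σ) (T \ S) id Finset.card fun C hC => by
    rw [Finset.mem_sdiff] at hC
    refine SignCircuit.cov (Or.inl ⟨h1 C hC.1, (sgn_cases σ C).resolve_right fun h => hC.2 ?_⟩)
    exact Finset.mem_filter.2 ⟨hC.1, h⟩
  refine ⟨K.card, hKc, (hcov.union hcov').mono ?_ ?_⟩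
  · rw [← Finset.union_biUnion, Finset.union_sdiff_of_subset hST, h3]
  · rw [← h3, card_biUnion_circ h2, ← Finset.sum_sdiff hST]; omega

/-! ### Edge colorings -/

variable (M) in
/-- A proper edge coloring with three colors. -/
def Proper (c : ε → Fin 3) : Prop :=
  ∀ v e f, M.Inc e v → M.Inc f v → e ≠ f → c e ≠ c f

/-- The edges whose color is not `i`. -/
def offColor (c : ε → Fin 3) (i : Fin 3) : Finset ε := Finset.univ.filter fun e => c e ≠ i

theorem mem_offColor {c : ε → Fin 3} {i : Fin 3} {e : ε} : e ∈ offColor c i ↔ c e ≠ i := by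
  simp [offColor]

theorem Proper.dg_offColor (hc : M.Cubic) {c : ε → Fin 3} (h : M.Proper c) (i : Fin 3) (v : ν) :
    M.dg (offColor c i) v = 2 := by
  set S := Finset.univ.filter fun e => M.Inc e v with hS
  have hcard : S.card = 3 := hc v
  have hinj : Set.InjOn c S := by
    intro e he f hf hef
    by_contra hne
    exact h v e f (by simpa [hS] using he) (by simpa [hS] using hf) hne hef
  have himg : S.image c = Finset.univ := by
    rw [← Finset.card_eq_iff_eq_univ, Finset.card_image_of_injOn hinj, hcard, Fintype.card_fin]
  have h1 : (S.filter fun e => c e = i).card = 1 := by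
    obtain ⟨e, he, hei⟩ := Finset.mem_image.1 (himg ▸ Finset.mem_univ i)
    rw [Finset.card_eq_one]
    refine ⟨e, ?_⟩
    ext f
    simp only [Finset.mem_filter, Finset.mem_singleton]
    constructor
    · rintro ⟨hf, hfi⟩
      exact hinj hf he (hfi.trans hei.symm)
    · rintro rfl; exact ⟨he, hei⟩
  have h2 := Finset.card_filter_add_card_filter_not (s := S) (fun e => c e = i)
  have h3 : M.dg (offColor c i) v = (S.filter fun e => ¬ c e = i).card := by
    unfold dg offColor
    rw [hS, Finset.filter_filter, Finset.filter_filter]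
    congr 1; ext e; simp only [Finset.mem_filter, ne_eq]; tauto
  omega

theorem Proper.bd_offColor (hc : M.Cubic) {c : ε → Fin 3} (h : M.Proper c) (i : Fin 3) :
    M.bd (offColor c i) = 0 := by
  funext v; rw [bd_eq_dg, h.dg_offColor hc]; rfl

theorem Proper.card_offColor (hc : M.Cubic) {c : ε → Fin 3} (h : M.Proper c) (i : Fin 3) :
    (offColor c i).card = Fintype.card ν := by
  have := sum_dg (M := M) (offColor c i)
  simp only [h.dg_offColor hc, Finset.sum_const, Finset.card_univ, smul_eq_mul] at this
  omega

/-- Every edge lies in a two-colored even set, and the rest of that set still joins its ends. -/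
theorem Proper.bridgeless (hc : M.Cubic) {c : ε → Fin 3} (h : M.Proper c) : M.Bridgeless := by
  intro e x y hl
  obtain ⟨i, hi⟩ : ∃ i, c e ≠ i := exists_ne (c e) |>.imp fun _ => Ne.symm
  have hmem : {e} ⊆ offColor c i := by
    rw [Finset.singleton_subset_iff]; exact mem_offColor.2 hi
  have hb : M.bd (offColor c i \ {e}) = dl x + dl y := by
    rw [bd_sdiff hmem, h.bd_offColor hc, zero_add, bd_singleton hl]
  refine (reach_of_bd hb).mono fun f hf => ?_
  simp only [Finset.mem_sdiff, Finset.mem_singleton] at hf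
  exact Finset.mem_erase.2 ⟨hf.2, Finset.mem_univ f⟩

theorem fin_three_cases : ∀ {i j k : Fin 3}, i ≠ j → i ≠ k → j ≠ k → ∀ x, x = i ∨ x = j ∨ x = k := by
  decide

/-- Every edge lies in exactly two of the three sets. -/
theorem sgn_offColor_mul (c : ε → Fin 3) {i j k : Fin 3} (hij : i ≠ j) (hik : i ≠ k) (hjk : j ≠ k) :
    sgn σ (offColor c i) * sgn σ (offColor c j) * sgn σ (offColor c k) = 1 := by
  simp only [sgn, offColor, Finset.prod_filter]
  rw [← Finset.prod_mul_distrib, ← Finset.prod_mul_distrib]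
  refine Finset.prod_eq_one fun e _ => ?_
  have h2 : σ e * σ e = 1 := Int.units_mul_self _
  have h3 := fin_three_cases hij hik hjk (c e)
  rcases h3 with h | h | h <;> simp [h, hij, hik, hjk, hij.symm, hik.symm, hjk.symm, h2]

/-- Exchanging the colors `j` and `k` on `C`. -/
def kempe (c : ε → Fin 3) (C : Finset ε) (j k : Fin 3) (e : ε) : Fin 3 :=
  if e ∈ C then Equiv.swap j k (c e) else c e

/-- At a vertex of `C` both edges of colors other than `i` belong to `C`, so the third edge has
color `i`, which the exchange does not touch. -/
theorem Proper.kempe (hc : M.Cubic) {c : ε → Fin 3} (h : M.Proper c) {i j k : Fin 3}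
    (hij : i ≠ j) (hik : i ≠ k) {C : Finset ε} (hC : M.bd C = 0)
    (hCi : C ⊆ offColor c i) : M.Proper (kempe c C j k) := by
  have key : ∀ v e f, M.Inc e v → M.Inc f v → e ∈ C → f ∉ C →
      Equiv.swap j k (c e) ≠ c f := by
    intro v e f he hf heC hfC
    have hfi : c f = i := by
      by_contra hne
      have hd : Disjoint C {f} := Finset.disjoint_singleton_right.2 hfC
      have h1 := dg_union (M := M) hd v
      have h2 : C ∪ {f} ⊆ offColor c i :=
        Finset.union_subset hCi (Finset.singleton_subset_iff.2 (mem_offColor.2 hne))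
      have h3 := dg_mono (M := M) h2 v
      have h4 := hc.dg_eq_two hC (mem_verts.2 ⟨e, heC, he⟩)
      have h5 : 0 < M.dg {f} v := dg_pos_iff.2 (mem_verts.2 ⟨f, by simp, hf⟩)
      rw [h.dg_offColor hc] at h3
      omega
    rw [hfi]
    intro h'
    have : c e = i := by
      rw [← Equiv.swap_apply_of_ne_of_ne hij hik] at h'
      exact (Equiv.swap j k).injective h'
    exact mem_offColor.1 (hCi heC) this
  intro v e f he hf hne
  unfold Multigraph.kempe
  by_cases h1 : e ∈ C <;> by_cases h2 : f ∈ C <;> simp only [h1, h2, if_true, if_false]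
  · exact fun h' => h v e f he hf hne ((Equiv.swap j k).injective h')
  · exact key v e f he hf h1 h2
  · exact (key v f e hf he h2 h1).symm
  · exact h v e f he hf hne

theorem offColor_kempe_self {c : ε → Fin 3} {i j k : Fin 3} (hij : i ≠ j) (hik : i ≠ k)
    (C : Finset ε) : offColor (kempe c C j k) i = offColor c i := by
  ext e
  rw [mem_offColor, mem_offColor, kempe]
  split_ifs
  · rw [not_iff_not, ← Equiv.swap_apply_of_ne_of_ne hij hik, (Equiv.swap j k).injective.eq_iff,
      Equiv.swap_apply_of_ne_of_ne hij hik]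
  · rfl

theorem offColor_kempe {c : ε → Fin 3} {i j k : Fin 3} (hij : i ≠ j) (hik : i ≠ k) (hjk : j ≠ k)
    {C : Finset ε} (hC : C ⊆ offColor c i) :
    offColor (kempe c C j k) j = offColor c j ∆ C ∧
      offColor (kempe c C j k) k = offColor c k ∆ C := by
  have h3 : ∀ x : Fin 3, x ≠ i → x = j ∨ x = k := fun x hx =>
    (fin_three_cases hij hik hjk x).resolve_left hx
  constructor <;> ext e <;> rw [mem_offColor, Finset.mem_symmDiff, mem_offColor, kempe] <;>
    by_cases he : e ∈ C <;> simp only [he, if_true, if_false, not_true, not_false_eq_true, and_true,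
      and_false, or_false, false_or, true_and, false_and, not_not, ne_eq]
  all_goals
    rcases h3 _ (mem_offColor.1 (hC he)) with h | h <;>
      simp [h, hjk, hjk.symm]

theorem exists_unbalanced {A : Finset ε} (hs : sgn σ A = -1) {T : Finset (Finset ε)}
    (h2 : ∀ C ∈ T, ∀ D ∈ T, C ≠ D → Disjoint C D) (h3 : T.biUnion id = A) :
    ∃ C ∈ T, sgn σ C = -1 := by
  by_contra! hcon
  rw [← h3, sgn_biUnion h2, Finset.prod_eq_one fun C hC => (sgn_cases σ C).resolve_right (hcon C hC)]
    at hs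
  exact absurd hs (by decide)

variable (M) in
/-- Some edge `e` is the only one on which the signature differs from the coboundary of `h`. -/
def SingleNegative (σ : ε → ℤˣ) : Prop :=
  ∃ (e : ε) (h : ν → ℤˣ), σ e = -(h (M.s e) * h (M.t e)) ∧
    ∀ f, f ≠ e → σ f = h (M.s f) * h (M.t f)

/-- If no proper coloring has three color pairs of positive sign, then all circuits in a color
pair of positive sign are balanced. -/
theorem Proper.balanced (hc : M.Cubic)
    (hgood : ¬ ∃ c, M.Proper c ∧ ∀ i, sgn σ (offColor c i) = 1) {c : ε → Fin 3} (h : M.Proper c)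
    {i j k : Fin 3} (hij : i ≠ j) (hik : i ≠ k) (hjk : j ≠ k) (hi : sgn σ (offColor c i) = 1) :
    sgn σ (offColor c j) = -1 ∧ sgn σ (offColor c k) = -1 ∧
      ∀ C ⊆ offColor c i, M.Circ C → sgn σ C = 1 := by
  have h3 := fin_three_cases hij hik hjk
  have hprod := sgn_offColor_mul (σ := σ) c hij hik hjk
  rw [hi, one_mul] at hprod
  have hj : sgn σ (offColor c j) = -1 := by
    refine (sgn_cases σ _).resolve_left fun h' => hgood ⟨c, h, fun x => ?_⟩
    rw [h', one_mul] at hprod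
    rcases h3 x with rfl | rfl | rfl <;> assumption
  have hk : sgn σ (offColor c k) = -1 := by
    rw [hj] at hprod
    rcases sgn_cases σ (offColor c k) with h' | h'
    · rw [h'] at hprod; exact absurd hprod (by decide)
    · exact h'
  refine ⟨hj, hk, fun C hC hCirc => ?_⟩
  -- Exchanging `j` and `k` on an unbalanced circuit `C` keeps the sign of the set avoiding `i` and
  -- turns both negative signs positive.
  refine (sgn_cases σ C).resolve_right fun h' => hgood ⟨_, h.kempe hc hij hik hCirc.2.1 hC, ?_⟩
  intro x
  obtain ⟨e1, e2⟩ := offColor_kempe hij hik hjk hC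
  rcases h3 x with rfl | rfl | rfl
  · rw [offColor_kempe_self hij hik, hi]
  · rw [e1, sgn_symmDiff, hj, h']; rfl
  · rw [e2, sgn_symmDiff, hk, h']; rfl

/-! ### Parametrized circuits -/

/-- `C` is the circuit `v 0, e 0, v 1, …` of length `ℓ`, indexed periodically by the integers,
and `g` is a potential for the signs along it. -/
structure Wheel (M : Multigraph ν ε) (σ : ε → ℤˣ) (C : Finset ε) (ℓ : ℕ) (v : ℤ → ν) (e : ℤ → ε)
    (g : ℤ → ℤˣ) : Prop where
  two_le : 2 ≤ ℓ
  v_add : ∀ i, v (i + ℓ) = v i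
  e_add : ∀ i, e (i + ℓ) = e i
  link : ∀ i, M.Link (e i) (v i) (v (i + 1))
  v_ne : ∀ i j : ℤ, i < j → j < i + ℓ → v i ≠ v j
  e_ne : ∀ i j : ℤ, i < j → j < i + ℓ → e i ≠ e j
  mem : ∀ f, f ∈ C ↔ ∃ i, e i = f
  card : C.card = ℓ
  g_succ : ∀ i, g (i + 1) = g i * σ (e i)
  g_add : ∀ i, g (i + ℓ) = - g i

theorem exists_window (ℓ : ℕ) (hℓ : 0 < ℓ) (m k : ℤ) : ∃ t : ℤ, k ≤ m + t * ℓ ∧ m + t * ℓ < k + ℓ := by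
  have hℓ' : (0 : ℤ) < ℓ := by exact_mod_cast hℓ
  refine ⟨-((m - k) / ℓ), ?_⟩
  have h1 := Int.emod_add_mul_ediv (m - k) ℓ
  have h2 := Int.emod_nonneg (m - k) hℓ'.ne'
  have h3 := Int.emod_lt_of_pos (m - k) hℓ'
  constructor <;> nlinarith

theorem add_mul_of_periodic {γ : Type*} {f : ℤ → γ} {ℓ : ℤ} (h : ∀ i, f (i + ℓ) = f i) (i t : ℤ) :
    f (i + t * ℓ) = f i := by
  induction t using Int.induction_on with
  | zero => simp
  | succ t ih => rw [show i + (t + 1) * ℓ = (i + t * ℓ) + ℓ by ring, h, ih]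
  | pred t ih => rw [← h, ← ih]; congr 1; ring

theorem exists_potential (s : ℤ → ℤˣ) : ∃ g : ℤ → ℤˣ, ∀ i, g (i + 1) = g i * s i := by
  -- One of the two products is always empty. No inverse is needed for negative indices because
  -- signs are their own inverses.
  refine ⟨fun i => (∏ k ∈ Finset.Ico 0 i, s k) * ∏ k ∈ Finset.Ico i 0, s k, fun i => ?_⟩
  rcases le_or_gt 0 i with h | h
  · have h1 : Finset.Ico 0 (i + 1) = insert i (Finset.Ico 0 i) := by
      ext k; simp only [Finset.mem_Ico, Finset.mem_insert]; omega
    have h2 : Finset.Ico i 0 = ∅ := Finset.Ico_eq_empty (by omega)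
    have h3 : Finset.Ico (i + 1) 0 = ∅ := Finset.Ico_eq_empty (by omega)
    simp only [h1, h2, h3]
    rw [Finset.prod_insert (by simp)]; simp [mul_comm]
  · have h1 : Finset.Ico i 0 = insert i (Finset.Ico (i + 1) 0) := by
      ext k; simp only [Finset.mem_Ico, Finset.mem_insert]; omega
    have h2 : Finset.Ico 0 i = ∅ := Finset.Ico_eq_empty (by omega)
    have h3 : Finset.Ico 0 (i + 1) = ∅ := Finset.Ico_eq_empty (by omega)
    simp only [h1, h2, h3]
    rw [Finset.prod_insert (by simp), mul_comm (s i), Finset.prod_empty, one_mul, one_mul, mul_assoc,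
      Int.units_mul_self, mul_one]

/-- The edges of a parametrized circuit from index `i` to index `j`. -/
noncomputable def arc (e : ℤ → ε) (i j : ℤ) : Finset ε := (Finset.Ico i j).image e

theorem bd_arc_of_link {e : ℤ → ε} {v : ℤ → ν} {ℓ : ℕ} (hl : ∀ i, M.Link (e i) (v i) (v (i + 1)))
    (he : ∀ i j : ℤ, i < j → j < i + ℓ → e i ≠ e j) {i j : ℤ} (hij : i ≤ j) (hj : j ≤ i + ℓ) :
    M.bd (arc e i j) = dl (v i) + dl (v j) := by
  have hinj : Set.InjOn e (Finset.Ico i j) := by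
    intro a ha b hb hab
    simp only [Finset.coe_Ico, Set.mem_Ico] at ha hb
    rcases lt_trichotomy a b with h | h | h
    · exact absurd hab (he a b h (by omega))
    · exact h
    · exact absurd hab.symm (he b a h (by omega))
  rw [bd, arc, Finset.sum_image hinj, Finset.sum_congr rfl fun k _ => (hl k).dl_add]
  clear hinj hj
  induction j, hij using Int.leInduction with
  | base => simp [add_self_fun]
  | succ j hij ih =>
    have h1 : Finset.Ico i (j + 1) = insert j (Finset.Ico i j) := by
      ext k; simp only [Finset.mem_Ico, Finset.mem_insert]; omega
    rw [h1, Finset.sum_insert (by simp), ih]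
    have := add_self_fun (dl (v j))
    calc _ = dl (v i) + (dl (v j) + dl (v j)) + dl (v (j + 1)) := by abel
      _ = _ := by rw [this, add_zero]

theorem sgn_arc_of_ne {e : ℤ → ε} {ℓ : ℕ} {g : ℤ → ℤˣ} (hg : ∀ i, g (i + 1) = g i * σ (e i))
    (he : ∀ i j : ℤ, i < j → j < i + ℓ → e i ≠ e j) {i j : ℤ} (hij : i ≤ j) (hj : j ≤ i + ℓ) :
    sgn σ (arc e i j) = g i * g j := by
  have hinj : Set.InjOn e (Finset.Ico i j) := by
    intro a ha b hb hab
    simp only [Finset.coe_Ico, Set.mem_Ico] at ha hb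
    rcases lt_trichotomy a b with h | h | h
    · exact absurd hab (he a b h (by omega))
    · exact h
    · exact absurd hab.symm (he b a h (by omega))
  rw [sgn, arc, Finset.prod_image hinj]
  clear hinj hj
  induction j, hij using Int.leInduction with
  | base => simp
  | succ j hij ih =>
    have h1 : Finset.Ico i (j + 1) = insert j (Finset.Ico i j) := by
      ext k; simp only [Finset.mem_Ico, Finset.mem_insert]; omega
    rw [h1, Finset.prod_insert (by simp), ih, hg, mul_comm, mul_assoc]

/-- Without an edge `f` the set still contains a path between the ends of `f`; this path with `f` is
even, hence by minimality all of `C`. The potential changes sign after one turn because `C` is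
unbalanced. -/
theorem Circ.exists_wheel {C : Finset ε} (hC : M.Circ C) (hs : sgn σ C = -1) :
    ∃ ℓ v e g, Wheel M σ C ℓ v e g := by
  obtain ⟨f, hf⟩ := hC.1
  have : Nonempty ε := ⟨f⟩
  have hfC : {f} ⊆ C := Finset.singleton_subset_iff.2 hf
  have hb : M.bd (C \ {f}) = dl (M.s f) + dl (M.t f) := by
    rw [bd_sdiff hfC, hC.2.1, zero_add, bd_singleton (link_st f)]
  obtain ⟨n, p, e, hp, he, h0, hn, -, -⟩ := (reach_of_bd hb).exists_isPath
    (A := {M.s f}) (B := {M.t f}) rfl rfl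
  simp only [Set.mem_singleton_iff] at h0 hn
  have hsub : (Finset.Ico 0 n).image e ⊆ C \ {f} := fun x hx => by
    obtain ⟨i, hi, rfl⟩ := Finset.mem_image.1 hx
    exact he i (Finset.mem_Ico.1 hi).2
  have hd : Disjoint ((Finset.Ico 0 n).image e) {f} := Finset.sdiff_disjoint.mono_left hsub
  have hEq : (Finset.Ico 0 n).image e ∪ {f} = C := by
    refine hC.2.2 _ (Finset.union_subset (hsub.trans Finset.sdiff_subset) hfC)
      ⟨f, by simp⟩ ?_
    rw [bd_union hd, hp.bd_seg (Nat.zero_le n) le_rfl, bd_singleton (link_st f), h0, hn,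
      add_self_fun]
  have hn0 : n ≠ 0 := fun h => M.ne f (by rw [← h0, ← hn, h])
  have hef : ∀ i < n, e i ≠ f := fun i hi h =>
    Finset.disjoint_left.1 hd (Finset.mem_image_of_mem e (Finset.mem_Ico.2 ⟨Nat.zero_le i, hi⟩))
      (by simp [h])
  have hℓ : (0 : ℤ) < ((n + 1 : ℕ) : ℤ) := by positivity
  let r : ℤ → ℕ := fun i => (i % ((n + 1 : ℕ) : ℤ)).toNat
  have hr : ∀ i, (r i : ℤ) = i % ((n + 1 : ℕ) : ℤ) := fun i =>
    Int.toNat_of_nonneg (Int.emod_nonneg i hℓ.ne')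
  have hrn : ∀ i, r i ≤ n := fun i => by
    have := Int.emod_lt_of_pos i hℓ
    have := hr i; omega
  have hr_add : ∀ i, r (i + ((n + 1 : ℕ) : ℤ)) = r i := fun i => by
    simp only [r]; rw [Int.add_emod_right]
  have hr_succ : ∀ i, (r i < n ∧ r (i + 1) = r i + 1) ∨ (r i = n ∧ r (i + 1) = 0) := fun i => by
    have h1 : (i + 1) % ((n + 1 : ℕ) : ℤ) = ((r i : ℤ) + 1) % ((n + 1 : ℕ) : ℤ) := by
      rw [hr i, Int.emod_add_emod]
    have h2 := hr (i + 1)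
    rw [h1] at h2
    rcases Nat.lt_or_eq_of_le (hrn i) with h | h
    · left
      rw [Int.emod_eq_of_lt (by omega) (by push_cast; omega)] at h2
      exact ⟨h, by omega⟩
    · right
      rw [h, show ((n : ℤ) + 1) = ((n + 1 : ℕ) : ℤ) by push_cast; ring, Int.emod_self] at h2
      exact ⟨h, by omega⟩
  have hr_ne : ∀ i j, i < j → j < i + ((n + 1 : ℕ) : ℤ) → r i ≠ r j := fun i j hij hj h => by
    have h1 : i % ((n + 1 : ℕ) : ℤ) = j % ((n + 1 : ℕ) : ℤ) := by rw [← hr, ← hr, h]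

    have h3 : ((n + 1 : ℕ) : ℤ) ∣ j - i := Int.ModEq.dvd h1
    have := Int.le_of_dvd (by omega) h3
    omega
  have hr_nat : ∀ k : ℕ, k ≤ n → r k = k := fun k hk => by
    have := hr k
    rw [Int.emod_eq_of_lt (by omega) (by push_cast; omega)] at this
    exact_mod_cast this
  let v : ℤ → ν := fun i => p (r i)
  -- The residue `n` is that of `f`, which leads from the last vertex of the path back to the first.
  let e' : ℤ → ε := fun i => if r i < n then e (r i) else f
  have he_ne : ∀ i j, i < j → j < i + ((n + 1 : ℕ) : ℤ) → e' i ≠ e' j := fun i j hij hj h => by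
    have h1 := hr_ne i j hij hj
    have h2 := hrn i
    have h3 := hrn j
    simp only [e'] at h
    split_ifs at h with h4 h5 h5
    · exact h1 (hp.edge_inj h4 h5 h)
    · exact hef _ h4 h
    · exact hef _ h5 h.symm
    · omega
  have hmem : ∀ x, x ∈ C ↔ ∃ i, e' i = x := fun x => by
    rw [← hEq, Finset.mem_union, Finset.mem_image, Finset.mem_singleton]
    constructor
    · rintro (⟨i, hi, rfl⟩ | rfl)
      · rw [Finset.mem_Ico] at hi
        exact ⟨i, by simp only [e']; rw [hr_nat i hi.2.le, if_pos hi.2]⟩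
      · exact ⟨n, by simp only [e']; rw [hr_nat n le_rfl, if_neg (lt_irrefl n)]⟩
    · rintro ⟨i, rfl⟩
      simp only [e']
      split_ifs with h
      · exact Or.inl ⟨r i, Finset.mem_Ico.2 ⟨Nat.zero_le _, h⟩, rfl⟩
      · exact Or.inr rfl
  have he_add : ∀ i, e' (i + ((n + 1 : ℕ) : ℤ)) = e' i := fun i => by simp only [e']; rw [hr_add]
  obtain ⟨g, hg⟩ := exists_potential fun i => σ (e' i)
  refine ⟨n + 1, v, e', g, by omega, fun i => ?_, he_add, fun i => ?_, fun i j hij hj h => ?_, he_ne,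
    hmem, ?_, hg, fun i => ?_⟩
  · simp only [v]; rw [hr_add]
  · simp only [v, e']
    rcases hr_succ i with ⟨h1, h2⟩ | ⟨h1, h2⟩
    · rw [if_pos h1, h2]; exact hp.link _ h1
    · rw [if_neg (by omega), h2, h1, h0, hn]; exact (link_st f).symm
  · exact hr_ne i j hij hj (hp.inj (hrn i) (hrn j) h)
  · rw [← hEq, Finset.card_union_of_disjoint hd, hp.card_seg le_rfl, Finset.card_singleton]; omega
  · have h1 := sgn_arc_of_ne (σ := σ) hg he_ne (i := i) (j := i + ((n + 1 : ℕ) : ℤ)) (by omega) le_rfl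
    have h2 : arc e' i (i + ((n + 1 : ℕ) : ℤ)) = C := by
      ext x
      rw [hmem, arc, Finset.mem_image]
      constructor
      · rintro ⟨k, -, hk⟩; exact ⟨k, hk⟩
      · rintro ⟨k, hk⟩
        obtain ⟨t, ht1, ht2⟩ := exists_window (n + 1) (Nat.succ_pos n) k i
        exact ⟨k + t * ((n + 1 : ℕ) : ℤ), Finset.mem_Ico.2 ⟨ht1, ht2⟩, by
          rw [add_mul_of_periodic he_add, hk]⟩
    rw [h2, hs] at h1
    rcases Int.units_eq_one_or (g i) with h3 | h3 <;>
      rcases Int.units_eq_one_or (g (i + ((n + 1 : ℕ) : ℤ))) with h4 | h4 <;>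
      rw [h3, h4] at h1 ⊢ <;> revert h1 <;> decide

namespace Wheel

variable {C : Finset ε} {ℓ : ℕ} {v : ℤ → ν} {e : ℤ → ε} {g : ℤ → ℤˣ}

theorem v_add_mul (w : Wheel M σ C ℓ v e g) (i t : ℤ) : v (i + t * ℓ) = v i :=
  add_mul_of_periodic w.v_add i t

theorem e_add_mul (w : Wheel M σ C ℓ v e g) (i t : ℤ) : e (i + t * ℓ) = e i :=
  add_mul_of_periodic w.e_add i t

theorem g_sub (w : Wheel M σ C ℓ v e g) (i : ℤ) : g (i - ℓ) = - g i := by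
  have := w.g_add (i - ℓ)
  rw [sub_add_cancel] at this
  rw [this, neg_neg]

theorem bd_arc (w : Wheel M σ C ℓ v e g) {i j : ℤ} (hij : i ≤ j) (hj : j ≤ i + ℓ) :
    M.bd (arc e i j) = dl (v i) + dl (v j) := bd_arc_of_link w.link w.e_ne hij hj

theorem sgn_arc (w : Wheel M σ C ℓ v e g) {i j : ℤ} (hij : i ≤ j) (hj : j ≤ i + ℓ) :
    sgn σ (arc e i j) = g i * g j := sgn_arc_of_ne w.g_succ w.e_ne hij hj

theorem arc_subset (w : Wheel M σ C ℓ v e g) (i j : ℤ) : arc e i j ⊆ C := fun f hf => by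
  obtain ⟨k, -, hk⟩ := Finset.mem_image.1 hf
  exact (w.mem f).2 ⟨k, hk⟩

theorem card_arc (i j : ℤ) : (arc e i j).card ≤ (j - i).toNat :=
  Finset.card_image_le.trans (by rw [Int.card_Ico])

theorem subset_arc (w : Wheel M σ C ℓ v e g) {i j : ℤ} (h : i + ℓ ≤ j) : C ⊆ arc e i j := fun f hf => by
  obtain ⟨k, rfl⟩ := (w.mem f).1 hf
  have := w.two_le
  obtain ⟨t, h1, h2⟩ := exists_window ℓ (by omega) k i
  exact Finset.mem_image.2 ⟨k + t * ℓ, Finset.mem_Ico.2 ⟨h1, by omega⟩, w.e_add_mul k t⟩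

theorem v_mem (w : Wheel M σ C ℓ v e g) (i : ℤ) : v i ∈ M.verts C :=
  mem_verts.2 ⟨e i, (w.mem _).2 ⟨i, rfl⟩, (w.link i).inc_left⟩

theorem exists_v (w : Wheel M σ C ℓ v e g) {u : ν} (hu : u ∈ M.verts C) : ∃ i, v i = u := by
  obtain ⟨f, hf, hi⟩ := mem_verts.1 hu
  obtain ⟨i, rfl⟩ := (w.mem f).1 hf
  rcases (w.link i).inc_iff.1 hi with h | h
  · exact ⟨i, h.symm⟩
  · exact ⟨i + 1, h.symm⟩

theorem eq_add_mul (w : Wheel M σ C ℓ v e g) {i j : ℤ} (h : v i = v j) : ∃ t : ℤ, i = j + t * ℓ := by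
  have := w.two_le
  obtain ⟨t, h1, h2⟩ := exists_window ℓ (by omega) j i
  refine ⟨t, ?_⟩
  by_contra hne
  exact w.v_ne i (j + t * ℓ) (by omega) h2 (by rw [h, w.v_add_mul])

end Wheel

/-! ### Ears of an unbalanced circuit that meets all unbalanced circuits -/

theorem dl_add_cancel (a b c : ν → ZMod 2) : a + b + (b + c) = a + c := by
  have := add_self_fun b
  calc _ = a + (b + b) + c := by abel
    _ = _ := by rw [this, add_zero]

theorem subset_symmDiff {A B K : Finset ε} (hA : A ⊆ K) (hB : B ⊆ K) : A ∆ B ⊆ K := fun f hf => by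
  rcases Finset.mem_symmDiff.1 hf with h | h
  · exact hA h.1
  · exact hB h.1

/-- Every even set avoiding `C` has positive sign. -/
theorem sgn_of_even_compl {C : Finset ε} (hbal : ∀ D, M.Circ D → Disjoint D C → sgn σ D = 1)
    {Q : Finset ε} (hQ : Q ⊆ Cᶜ) (hQb : M.bd Q = 0) : sgn σ Q = 1 := by
  obtain ⟨T, h1, h2, h3⟩ := exists_circ_decomposition Q hQb
  rw [← h3, sgn_biUnion h2]
  refine Finset.prod_eq_one fun D hD => hbal D (h1 D hD) ?_
  have : D ⊆ Q := h3 ▸ Finset.subset_biUnion_of_mem id hD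
  exact disjoint_compl_left.mono_left (this.trans hQ)

/-- A vertex of an even set `C` with boundary zero in `Q ⊆ Cᶜ` is not incident with `Q`. -/
theorem Cubic.notMem_verts (hc : M.Cubic) {C : Finset ε} (hC : M.bd C = 0) {Q : Finset ε}
    (hQ : Q ⊆ Cᶜ) {u : ν} (hu : u ∈ M.verts C) (hb : M.bd Q u = 0) : u ∉ M.verts Q := fun h => by
  have h1 := two_le_dg h hb
  have h2 := hc.dg_eq_two hC hu
  have h3 := dg_union (M := M) (disjoint_compl_left.mono_left hQ) u
  have h4 := hc.dg_le (Q ∪ C) u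
  omega

/-- A path outside an even set `C`, with its inner vertices. -/
theorem IsPath.inner_notMem (hc : M.Cubic) {C : Finset ε} (hC : M.bd C = 0) {n : ℕ} {p : ℕ → ν}
    {e : ℕ → ε} (hp : M.IsPath n p e) (he : ∀ i < n, e i ∈ Cᶜ) {i : ℕ} (h0 : 0 < i) (hi : i < n) :
    p i ∉ M.verts C := fun hm => by
  have hl := hp.link (i - 1) (by omega)
  rw [show i - 1 + 1 = i by omega] at hl
  have hne : e (i - 1) ≠ e i := fun h => by
    have := hp.edge_inj (by omega) hi h; omega
  have hsub : {e (i - 1), e i} ⊆ Cᶜ := by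
    intro f hf
    rcases Finset.mem_insert.1 hf with rfl | hf
    · exact he _ (by omega)
    · rw [Finset.mem_singleton.1 hf]; exact he _ hi
  have h1 : M.dg {e (i - 1), e i} (p i) = 2 := by
    rw [dg, Finset.filter_true_of_mem, Finset.card_pair hne]
    intro f hf
    rcases Finset.mem_insert.1 hf with rfl | hf
    · exact hl.inc_right
    · rw [Finset.mem_singleton.1 hf]; exact (hp.link i hi).inc_left
  refine hc.notMem_verts hC hsub hm ?_ (dg_pos_iff.1 (by omega))
  rw [bd_eq_dg, h1]; rfl

variable (M σ) in
/-- The lifts `i` and `j` are joined by an ear of the circuit `C` that is balanced together with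
the arc between them. -/
def Ear (C : Finset ε) (v : ℤ → ν) (g : ℤ → ℤˣ) (i j : ℤ) : Prop :=
  ∃ Q ⊆ Cᶜ, M.bd Q = dl (v i) + dl (v j) ∧ sgn σ Q = g i * g j

namespace Wheel

variable {C : Finset ε} {ℓ : ℕ} {v : ℤ → ν} {e : ℤ → ε} {g : ℤ → ℤˣ}

theorem ear_symm {i j : ℤ} (h : Ear M σ C v g i j) : Ear M σ C v g j i := by
  obtain ⟨Q, h1, h2, h3⟩ := h
  exact ⟨Q, h1, by rw [h2, add_comm], by rw [h3, mul_comm]⟩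

/-- The symmetric difference concatenates ears, and signs multiply. All lifted attachments of one
bridge thus fall into classes. -/
theorem ear_trans {i j k : ℤ} (h : Ear M σ C v g i j) (h' : Ear M σ C v g j k) :
    Ear M σ C v g i k := by
  obtain ⟨Q, h1, h2, h3⟩ := h
  obtain ⟨Q', h1', h2', h3'⟩ := h'
  refine ⟨Q ∆ Q', subset_symmDiff h1 h1', ?_, ?_⟩
  · rw [bd_symmDiff, h2, h2', dl_add_cancel]
  · rw [sgn_symmDiff, h3, h3']
    calc _ = g i * (g j * g j) * g k := by ac_rfl
      _ = _ := by rw [Int.units_mul_self, mul_one]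

/-- If the sign does not fit, one more turn around `C` changes the potential and makes it fit. -/
theorem ear_of_reach (w : Wheel M σ C ℓ v e g) {i j : ℤ} (h : M.Reach Cᶜ (v i) (v j)) :
    Ear M σ C v g i j ∨ Ear M σ C v g i (j + ℓ) := by
  obtain ⟨Q, h1, h2⟩ := h.exists_bd
  have h3 := w.v_add j
  have h4 := w.g_add j
  by_cases hs : sgn σ Q = g i * g j
  · exact Or.inl ⟨Q, h1, h2, hs⟩
  · refine Or.inr ⟨Q, h1, by rw [h3, h2], ?_⟩
    rw [h4]
    revert hs
    generalize sgn σ Q = a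
    generalize g i = b
    generalize g j = c
    revert a b c; decide

theorem reach_of_ear {i j : ℤ} (h : Ear M σ C v g i j) : M.Reach Cᶜ (v i) (v j) := by
  obtain ⟨Q, h1, h2, -⟩ := h
  exact (reach_of_bd h2).mono h1

theorem ear_shift (w : Wheel M σ C ℓ v e g) {i j : ℤ} (t : ℤ) (h : Ear M σ C v g i j) :
    Ear M σ C v g (i + t * ℓ) (j + t * ℓ) := by
  obtain ⟨Q, h1, h2, h3⟩ := h
  refine ⟨Q, h1, by rw [w.v_add_mul, w.v_add_mul, h2], ?_⟩
  rw [h3]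
  have : ∀ i j : ℤ, g (i + ℓ) * g (j + ℓ) = g i * g j := fun i j => by
    rw [w.g_add, w.g_add, neg_mul_neg]
  induction t using Int.induction_on with
  | zero => simp
  | succ t ih =>
    rw [ih, ← this (i + t * ℓ)]
    ring_nf
  | pred t ih =>
    rw [ih, ← this (i + (-t - 1) * ℓ)]
    ring_nf

/-- Two turns restore the potential, so the lifts effectively live on a circle of length `2ℓ`. -/
theorem ear_shift_right (w : Wheel M σ C ℓ v e g) {i j : ℤ} (t : ℤ) (h : Ear M σ C v g i j) :
    Ear M σ C v g i (j + t * (2 * ℓ)) := by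
  obtain ⟨Q, h1, h2, h3⟩ := h
  refine ⟨Q, h1, by rw [← mul_assoc, w.v_add_mul, h2], ?_⟩
  rw [h3, add_mul_of_periodic (f := g) (ℓ := 2 * (ℓ : ℤ))]
  intro k
  rw [two_mul, ← add_assoc, w.g_add, w.g_add, neg_neg]

/-- Antipodal lifts belong to the same vertex; an ear between them would be an even set outside `C`
of negative sign. -/
theorem not_ear_add (w : Wheel M σ C ℓ v e g)
    (hbal : ∀ D, M.Circ D → Disjoint D C → sgn σ D = 1) (i : ℤ) : ¬ Ear M σ C v g i (i + ℓ) := by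
  rintro ⟨Q, h1, h2, h3⟩
  rw [w.v_add, add_self_fun] at h2
  rw [sgn_of_even_compl hbal h1 h2, w.g_add, mul_neg, Int.units_mul_self] at h3
  exact absurd h3 (by decide)

/-- Two edge sets outside `C` with the same boundary differ by an even set, which has positive sign.
-/
theorem sgn_of_ear (hbal : ∀ D, M.Circ D → Disjoint D C → sgn σ D = 1) {i j : ℤ}
    (h : Ear M σ C v g i j) {Q : Finset ε} (hQ : Q ⊆ Cᶜ) (hb : M.bd Q = dl (v i) + dl (v j)) :
    sgn σ Q = g i * g j := by
  obtain ⟨R, h1, h2, h3⟩ := h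
  have h4 := sgn_of_even_compl hbal (subset_symmDiff hQ h1)
    (by rw [bd_symmDiff, hb, h2, add_self_fun])
  rw [sgn_symmDiff] at h4
  rw [← h3]
  revert h4
  generalize sgn σ Q = a
  generalize sgn σ R = b
  revert a b; decide

/-- An ear together with its arc decomposes into balanced circuits. -/
theorem cov_ear (hc : M.Cubic) (hC : M.Circ C) (w : Wheel M σ C ℓ v e g)
    (hbal : ∀ D, M.Circ D → Disjoint D C → sgn σ D = 1) {i j : ℤ} (hij : i < j) (hj : j < i + ℓ)
    (h : Ear M σ C v g i j) {Q : Finset ε} (hQ : Q ⊆ Cᶜ) (hb : M.bd Q = dl (v i) + dl (v j)) :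
    M.Cov σ (arc e i j) (Q.card + (j - i).toNat) := by
  have hdis : Disjoint Q (arc e i j) := (disjoint_compl_left.mono_left hQ).mono_right
    (w.arc_subset i j)
  have hcov : M.Cov σ (Q ∪ arc e i j) (Q ∪ arc e i j).card := by
    refine cov_of_balanced ?_ fun D hD hDc => ?_
    · rw [bd_union hdis, hb, w.bd_arc hij.le hj.le, add_self_fun]
    · have hD1 : D \ C ⊆ Q := fun f hf => by
        rw [Finset.mem_sdiff] at hf
        exact (Finset.mem_union.1 (hD hf.1)).resolve_right fun h' => hf.2 (w.arc_subset i j h')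
      have hD2 : D ∩ C ⊆ arc e i j := fun f hf => by
        rw [Finset.mem_inter] at hf
        exact (Finset.mem_union.1 (hD hf.1)).resolve_left fun h' =>
          Finset.mem_compl.1 (hQ h') hf.2
      have hDd := Finset.disjoint_sdiff_inter D C
      have hDu := Finset.sdiff_union_inter D C
      have hsum : M.bd (D \ C) + M.bd (D ∩ C) = 0 := by
        rw [← bd_union hDd, hDu, hDc.2.1]
      have heq : M.bd (D ∩ C) = M.bd (D \ C) := by
        have h1 := add_self_fun (M.bd (D \ C))
        exact (add_left_cancel (h1.trans hsum.symm)).symm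
      have hempty : ∀ Z ⊆ arc e i j, M.bd Z = 0 → Z = ∅ := fun Z hZ hZb => by
        by_contra hne
        have h1 := hC.2.2 Z (hZ.trans (w.arc_subset i j)) (Finset.nonempty_iff_ne_empty.2 hne) hZb
        have h2 := Finset.card_le_card hZ
        have h3 := card_arc (e := e) i j
        have h4 := w.card
        rw [h1] at h2; omega
      have hsgn : sgn σ D = sgn σ (D \ C) * sgn σ (D ∩ C) := by
        rw [← sgn_union σ hDd, hDu]
      have hK : D \ C ⊆ Cᶜ := hD1.trans hQ
      -- Only `v i` and `v j` can carry the boundary of `D \ C`: other vertices of `C` do not meet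
      -- `Q`, and off `C` it agrees with the boundary of `D ∩ C`. So either `D` avoids `C`, or it
      -- contains the whole arc and the signs of the two parts agree.
      rcases bd_cases (M := M) (K := D \ C) (w.v_ne i j hij hj) (fun u hui huj => by
          by_cases hu : u ∈ M.verts C
          · have h1 : u ∉ M.verts Q := hc.notMem_verts hC.2.1 hQ hu (by
              rw [hb, Pi.add_apply, dl_ne hui, dl_ne huj, add_zero])
            exact bd_of_notMem fun h' => h1 (verts_mono hD1 h')
          · rw [← heq]
            exact bd_of_notMem fun h' => hu (verts_mono Finset.inter_subset_right h')) with h0 | h1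
      · rw [hsgn, sgn_of_even_compl hbal hK h0, hempty _ hD2 (heq.trans h0)]; simp
      · have h2 : (D ∩ C) ∆ arc e i j = ∅ := hempty _ (subset_symmDiff hD2 le_rfl) (by
          rw [bd_symmDiff, heq, h1, w.bd_arc hij.le hj.le, add_self_fun])
        rw [hsgn, sgn_of_ear hbal h hK h1, Finset.symmDiff_eq_empty.1 h2, w.sgn_arc hij.le hj.le,
          Int.units_mul_self]
  refine hcov.mono Finset.subset_union_right ?_
  rw [Finset.card_union_of_disjoint hdis]
  have := card_arc (e := e) i j
  omega

/-- Unless some edge of the circuit is the only negative one after switching, the arcs of ears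
cover the circuit. -/
theorem exists_ear_over (w : Wheel M σ C ℓ v e g)
    (hconn : ∀ u v, M.Reach Finset.univ u v) (hflow : ¬ M.SingleNegative σ)
    (hbal : ∀ D, M.Circ D → Disjoint D C → sgn σ D = 1) (k : ℤ) :
    ∃ i j, i ≤ k ∧ k < j ∧ j < i + ℓ ∧ Ear M σ C v g i j := by
  by_contra! hcon
  have : Nonempty ε := ⟨e 0⟩
  have hℓ := w.two_le
  have hreach : ∀ u, ∃ i, M.Reach Cᶜ (v i) u := fun u => by
    obtain ⟨n, p, f, hp, -, h0, hn, -, hB⟩ := (hconn u (v 0)).exists_isPath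
      (A := {u}) (B := (M.verts C : Set ν)) rfl (w.v_mem 0)
    obtain ⟨i, hi⟩ := w.exists_v hn
    refine ⟨i, ?_⟩
    rw [hi, ← show p 0 = u from h0]
    refine ((hp.reach_seg (Nat.zero_le n) le_rfl).mono fun x hx => ?_).symm
    obtain ⟨t, ht, rfl⟩ := Finset.mem_image.1 hx
    rw [Finset.mem_Ico] at ht
    rw [Finset.mem_compl]
    intro hm
    have := hB t ht.2.le (mem_verts.2 ⟨_, hm, (hp.link t ht.2).inc_left⟩)
    omega
  have hex : ∀ u, ∃ (i : ℤ) (Q : Finset ε), k + 1 ≤ i ∧ i < k + 1 + ℓ ∧ Q ⊆ Cᶜ ∧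
      M.bd Q = dl (v i) + dl u := fun u => by
    obtain ⟨i, hi⟩ := hreach u
    obtain ⟨t, h1, h2⟩ := exists_window ℓ (by omega) i (k + 1)
    obtain ⟨Q, hQ, hb⟩ := hi.exists_bd
    exact ⟨i + t * ℓ, Q, h1, h2, hQ, by rw [w.v_add_mul, hb]⟩
  -- With the other sign, `Q` would be an ear from `j - ℓ` to `i`, whose arc passes over the edge of
  -- index `k`.
  have key' : ∀ i j (Q : Finset ε), k + 1 ≤ i → i < j → j < k + 1 + ℓ → Q ⊆ Cᶜ →
      M.bd Q = dl (v i) + dl (v j) → sgn σ Q = g i * g j := fun i j Q hi hij hj hQ hb => by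
    by_contra hne
    refine hcon (j - ℓ) i (by omega) (by omega) (by omega) ⟨Q, hQ, ?_, ?_⟩
    · rw [hb, ← w.v_add (j - ℓ), sub_add_cancel, add_comm]
    · rw [w.g_sub]
      revert hne
      generalize sgn σ Q = a
      generalize g i = b
      generalize g j = c
      revert a b c; decide
  have key : ∀ u i i' (Q Q' : Finset ε), k + 1 ≤ i → i < k + 1 + ℓ → k + 1 ≤ i' → i' < k + 1 + ℓ →
      Q ⊆ Cᶜ → Q' ⊆ Cᶜ → M.bd Q = dl (v i) + dl u → M.bd Q' = dl (v i') + dl u →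
      g i * sgn σ Q = g i' * sgn σ Q' := by
    intro u i i' Q Q' h1 h2 h3 h4 hQ hQ' hb hb'
    have hs : Q ∆ Q' ⊆ Cᶜ := subset_symmDiff hQ hQ'
    have hbb : M.bd (Q ∆ Q') = dl (v i) + dl (v i') := by
      rw [bd_symmDiff, hb, hb', add_comm (dl (v i')), dl_add_cancel]
    have hsg : sgn σ (Q ∆ Q') = g i * g i' := by
      rcases lt_trichotomy i i' with h | h | h
      · exact key' i i' _ h1 h h4 hs hbb
      · subst h
        rw [add_self_fun] at hbb
        rw [sgn_of_even_compl hbal hs hbb, Int.units_mul_self]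
      · rw [mul_comm]
        exact key' i' i _ h3 h h2 hs (by rw [hbb, add_comm])
    rw [sgn_symmDiff] at hsg
    revert hsg
    generalize sgn σ Q = a
    generalize sgn σ Q' = b
    generalize g i = c
    generalize g i' = d
    revert a b c d; decide
  choose I Q hI1 hI2 hQ hQb using hex
  -- The potential on the window from `k + 1` to `k + ℓ` is carried into the bridges; by `key`
  -- neither the attachment nor the path matters.
  set h : ν → ℤˣ := fun u => g (I u) * sgn σ (Q u) with hh
  have hval : ∀ u i (R : Finset ε), k + 1 ≤ i → i < k + 1 + ℓ → R ⊆ Cᶜ →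
      M.bd R = dl (v i) + dl u → h u = g i * sgn σ R := fun u i R h1 h2 h3 h4 =>
    key u _ _ _ _ (hI1 u) (hI2 u) h1 h2 (hQ u) h3 (hQb u) h4
  have hvi : ∀ i, k + 1 ≤ i → i < k + 1 + ℓ → h (v i) = g i := fun i h1 h2 => by
    rw [hval (v i) i ∅ h1 h2 (Finset.empty_subset _) (by rw [add_self_fun, bd_empty]), sgn_empty,
      mul_one]
  have hst : ∀ f x y, M.Link f x y → h (M.s f) * h (M.t f) = h x * h y := fun f x y hl => by
    rcases hl with ⟨rfl, rfl⟩ | ⟨rfl, rfl⟩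
    · rfl
    · exact mul_comm _ _
  have hσ : ∀ i, σ (e i) = g i * g (i + 1) := fun i => by
    rw [w.g_succ, ← mul_assoc, Int.units_mul_self, one_mul]
  refine hflow ⟨e k, h, ?_, fun f hf => ?_⟩
  · have h1 : h (v k) = - g k := by
      rw [← w.v_add, hvi _ (by omega) (by omega), w.g_add]
    rw [hst _ _ _ (w.link k), h1, hvi (k + 1) le_rfl (by omega), hσ, neg_mul, neg_neg]
  · by_cases hfC : f ∈ C
    · obtain ⟨i, rfl⟩ := (w.mem f).1 hfC
      obtain ⟨t, h1, h2⟩ := exists_window ℓ (by omega) i k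
      rw [← w.e_add_mul i t] at hf ⊢
      generalize i + t * ℓ = m at h1 h2 hf ⊢
      have hmk : m ≠ k := fun h => hf (h ▸ rfl)
      rw [hst _ _ _ (w.link m), hvi m (by omega) (by omega), hvi (m + 1) (by omega) (by omega), hσ]
    · have h1 := hval (M.t f) (I (M.s f)) (Q (M.s f) ∆ {f}) (hI1 _) (hI2 _)
        (subset_symmDiff (hQ _) (by simpa using hfC))
        (by rw [bd_symmDiff, hQb, bd_singleton (link_st f), dl_add_cancel])
      rw [sgn_symmDiff, sgn_singleton, ← mul_assoc] at h1
      change h (M.t f) = h (M.s f) * σ f at h1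
      rw [h1, ← mul_assoc, Int.units_mul_self, one_mul]

end Wheel

/-! ### Covering an unbalanced circuit. -/

/-- An unbalanced circuit and an unbalanced circuit disjoint from it. -/
theorem cov_of_disjoint_unbalanced (hc : M.Cubic) (hconn : ∀ u v, M.Reach Finset.univ u v)
    {C D : Finset ε} (hC : M.Circ C) (hs : sgn σ C = -1) (hD : M.Circ D) (hDs : sgn σ D = -1)
    (hd : Disjoint D C) : M.Cov σ C (Fintype.card ν + 1) := by
  have hdv := hc.disjoint_verts hC.2.1 hD.2.1 hd.symm
  obtain ⟨u, hu⟩ := hC.verts_nonempty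
  obtain ⟨u', hu'⟩ := hD.verts_nonempty
  obtain ⟨n, p, e, hp, -, h1, h2, hsc⟩ := exists_barbell hC hD hs hDs hdv (hconn u u') hu hu'
  refine hsc.cov.mono (fun f hf => by simp [hf]) ?_
  have hn : n ≠ 0 := fun h => Finset.disjoint_left.1 hdv ((h1 0 (Nat.zero_le n)).2 rfl)
    ((h2 0 (Nat.zero_le n)).2 h.symm)
  set I := (Finset.Ico 1 n).image p with hI
  have hIc : I.card = n - 1 := by
    rw [hI, Finset.card_image_of_injOn, Nat.card_Ico]
    intro i hi j hj hij
    simp only [Finset.coe_Ico, Set.mem_Ico] at hi hj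
    exact hp.inj hi.2.le hj.2.le hij
  have hIC : Disjoint I (M.verts C) := by
    rw [Finset.disjoint_left]
    intro x hx hxC
    obtain ⟨i, hi, rfl⟩ := Finset.mem_image.1 hx
    rw [Finset.mem_Ico] at hi
    have := (h1 i hi.2.le).1 hxC; omega
  have hID : Disjoint I (M.verts D) := by
    rw [Finset.disjoint_left]
    intro x hx hxC
    obtain ⟨i, hi, rfl⟩ := Finset.mem_image.1 hx
    rw [Finset.mem_Ico] at hi
    have := (h2 i hi.2.le).1 hxC; omega
  -- The barbell has one edge more than it has vertices.
  have h3 : (I ∪ (M.verts C ∪ M.verts D)).card ≤ Fintype.card ν := Finset.card_le_univ _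
  rw [Finset.card_union_of_disjoint (Finset.disjoint_union_right.2 ⟨hIC, hID⟩),
    Finset.card_union_of_disjoint hdv, hc.card_verts hC.2.1, hc.card_verts hD.2.1, hIc] at h3
  have h4 := Finset.card_union_le (C ∪ (Finset.Ico 0 n).image e) D
  have h5 := Finset.card_union_le C ((Finset.Ico 0 n).image e)
  rw [hp.card_seg le_rfl] at h5
  omega

namespace Wheel

variable {C : Finset ε} {ℓ : ℕ} {v : ℤ → ν} {e : ℤ → ε} {g : ℤ → ℤˣ}

/-- A bridge of the circuit with three lifted attachments not contained in a half circle. -/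
theorem cov_of_triple (hc : M.Cubic) (hC : M.Circ C) (w : Wheel M σ C ℓ v e g)
    (hbal : ∀ D, M.Circ D → Disjoint D C → sgn σ D = 1) {i j k : ℤ} (hij : i < j) (hjk : j < k)
    (hki : k < i + 2 * ℓ) (h1 : j < i + ℓ) (h2 : k < j + ℓ) (h3 : i + 2 * ℓ < k + ℓ)
    (hE : Ear M σ C v g i j) (hE' : Ear M σ C v g j k) :
    ∃ L, 3 * L ≤ 4 * Fintype.card ν + 3 * C.card ∧ M.Cov σ C L := by
  have : Nonempty ε := ⟨e 0⟩
  have hℓ := w.card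
  obtain ⟨n, p, f, hp, hpK, hp0, hpn, -, -⟩ := (reach_of_ear hE).exists_isPath
    (A := {v i}) (B := {v j}) rfl rfl
  simp only [Set.mem_singleton_iff] at hp0 hpn
  set Q := (Finset.Ico 0 n).image f with hQdef
  have hn : 0 < n := Nat.pos_of_ne_zero fun h => w.v_ne i j hij h1 (by rw [← hp0, ← hpn, h])
  have hQK : ∀ a b, b ≤ n → (Finset.Ico a b).image f ⊆ Cᶜ := fun a b hb x hx => by
    obtain ⟨t, ht, rfl⟩ := Finset.mem_image.1 hx
    rw [Finset.mem_Ico] at ht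
    exact hpK t (by omega)
  have hpQ : p 0 ∈ M.verts Q := mem_verts.2 ⟨f 0, Finset.mem_image_of_mem f
    (Finset.mem_Ico.2 ⟨le_rfl, hn⟩), (hp.link 0 hn).inc_left⟩
  -- A second path attaches `v k` to the first one at `p a`. Ears between any two of the three
  -- attachments are found in the union of the two paths.
  obtain ⟨m, r, f', hr, hrK, hr0, hrm, -, hrQ⟩ := (reach_of_ear (ear_trans hE hE')).symm.exists_isPath
    (A := {v k}) (B := (M.verts Q : Set ν)) rfl (hp0 ▸ hpQ)
  simp only [Set.mem_singleton_iff] at hr0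
  obtain ⟨a, -, ha, hpa⟩ := hp.mem_verts_seg le_rfl hrm
  set R := (Finset.Ico 0 m).image f' with hRdef
  have hRK : R ⊆ Cᶜ := fun x hx => by
    obtain ⟨t, ht, rfl⟩ := Finset.mem_image.1 hx
    exact hrK t (Finset.mem_Ico.1 ht).2
  have hRQ : ∀ a b, b ≤ n → Disjoint R ((Finset.Ico a b).image f) := fun a b hb => by
    rw [Finset.disjoint_left]
    intro x hx hx'
    obtain ⟨t, ht, rfl⟩ := Finset.mem_image.1 hx
    rw [Finset.mem_Ico] at ht
    have hm : f' t ∈ Q := Finset.image_subset_image (Finset.Ico_subset_Ico (Nat.zero_le a) hb) hx'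
    have := hrQ t ht.2.le (mem_verts.2 ⟨_, hm, (hr.link t ht.2).inc_left⟩)
    omega
  have hbR : M.bd R = dl (v k) + dl (p a) := by
    rw [hr.bd_seg (Nat.zero_le m) le_rfl, hr0, hpa]
  -- the inner vertices of the two paths
  have hcount : (n - 1) + (m - 1) + ℓ ≤ Fintype.card ν := by
    set I := (Finset.Ico 1 n).image p
    set J := (Finset.Ico 1 m).image r
    have hIc : I.card = n - 1 := by
      rw [Finset.card_image_of_injOn, Nat.card_Ico]
      intro i hi j hj hij
      simp only [Finset.coe_Ico, Set.mem_Ico] at hi hj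
      exact hp.inj hi.2.le hj.2.le hij
    have hJc : J.card = m - 1 := by
      rw [Finset.card_image_of_injOn, Nat.card_Ico]
      intro i hi j hj hij
      simp only [Finset.coe_Ico, Set.mem_Ico] at hi hj
      exact hr.inj hi.2.le hj.2.le hij
    have hIC : Disjoint I (M.verts C) := by
      rw [Finset.disjoint_left]
      intro x hx hxC
      obtain ⟨i, hi, rfl⟩ := Finset.mem_image.1 hx
      rw [Finset.mem_Ico] at hi
      exact hp.inner_notMem hc hC.2.1 hpK (by omega) hi.2 hxC
    have hJC : Disjoint J (M.verts C) := by
      rw [Finset.disjoint_left]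
      intro x hx hxC
      obtain ⟨i, hi, rfl⟩ := Finset.mem_image.1 hx
      rw [Finset.mem_Ico] at hi
      exact hr.inner_notMem hc hC.2.1 hrK (by omega) hi.2 hxC
    have hIJ : Disjoint I J := by
      rw [Finset.disjoint_left]
      intro x hx hxJ
      obtain ⟨i, hi, rfl⟩ := Finset.mem_image.1 hx
      obtain ⟨t, ht, hti⟩ := Finset.mem_image.1 hxJ
      rw [Finset.mem_Ico] at hi ht
      have := hrQ t ht.2.le (hti ▸ mem_verts.2 ⟨f i, Finset.mem_image_of_mem f
        (Finset.mem_Ico.2 ⟨Nat.zero_le i, hi.2⟩), (hp.link i hi.2).inc_left⟩)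
      omega
    have h3 : ((I ∪ J) ∪ M.verts C).card ≤ Fintype.card ν := Finset.card_le_univ _
    rwa [Finset.card_union_of_disjoint (Finset.disjoint_union_left.2 ⟨hIC, hJC⟩),
      Finset.card_union_of_disjoint hIJ, hc.card_verts hC.2.1, hIc, hJc, w.card] at h3
  have hE'' : Ear M σ C v g k (i + 2 * ℓ) := by
    have := w.ear_shift_right 1 (ear_symm (ear_trans hE hE'))
    rwa [one_mul] at this
  have hvi : v (i + 2 * ℓ) = v i := w.v_add_mul i 2
  have c1 := cov_ear hc hC w hbal hij h1 hE (hQK 0 n le_rfl)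
    (by rw [hp.bd_seg (Nat.zero_le n) le_rfl, hp0, hpn])
  have c2 := cov_ear hc hC w hbal hjk h2 hE' (Q := R ∪ (Finset.Ico a n).image f)
    (Finset.union_subset hRK (hQK a n le_rfl)) (by
      rw [bd_union (hRQ a n le_rfl), hbR, hp.bd_seg ha le_rfl, dl_add_cancel, hpn, add_comm])
  have c3 := cov_ear hc hC w hbal hki h3 hE'' (Q := R ∪ (Finset.Ico 0 a).image f)
    (Finset.union_subset hRK (hQK 0 a ha)) (by
      rw [bd_union (hRQ 0 a ha), hbR, hp.bd_seg (Nat.zero_le a) ha, add_comm (dl (p 0)),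
        dl_add_cancel, hp0, hvi])
  rw [Finset.card_union_of_disjoint (hRQ a n le_rfl), hr.card_seg le_rfl, hp.card_seg le_rfl] at c2
  rw [Finset.card_union_of_disjoint (hRQ 0 a ha), hr.card_seg le_rfl, hp.card_seg ha] at c3
  rw [hp.card_seg le_rfl] at c1
  have harc : ∀ x y z : ℤ, x + ℓ ≤ z → C ⊆ arc e x y ∪ arc e y z := fun x y z hxz f hf => by
    obtain ⟨t, ht, rfl⟩ := Finset.mem_image.1 (w.subset_arc hxz hf)
    rw [Finset.mem_Ico] at ht
    rcases lt_or_ge t y with h | h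
    · exact Finset.mem_union_left _ (Finset.mem_image_of_mem e (Finset.mem_Ico.2 ⟨ht.1, h⟩))
    · exact Finset.mem_union_right _ (Finset.mem_image_of_mem e (Finset.mem_Ico.2 ⟨h, ht.2⟩))
  have hshift : arc e (i + 2 * ℓ) (j + 2 * ℓ) ⊆ arc e i j := fun f hf => by
    obtain ⟨t, ht, rfl⟩ := Finset.mem_image.1 hf
    rw [Finset.mem_Ico] at ht
    refine Finset.mem_image.2 ⟨t - 2 * ℓ, Finset.mem_Ico.2 ⟨by omega, by omega⟩, ?_⟩
    rw [← w.e_add_mul (t - 2 * ℓ) 2, sub_add_cancel]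
  -- The three arcs have total length `2ℓ` and each is shorter than `ℓ`, so any two of them go
  -- around `C`.
  have d12 := (c1.union c2).mono (harc i j k (by omega)) le_rfl
  have d23 := (c2.union c3).mono (harc j k (i + 2 * ℓ) (by omega)) le_rfl
  have d31 := (c3.union c1).mono ((harc k (i + 2 * ℓ) (j + 2 * ℓ) (by omega)).trans
    (Finset.union_subset_union le_rfl hshift)) le_rfl
  -- The three bounds add up to `4(n + m + ℓ)`, with `n`, `m` the lengths of the paths, which by
  -- `hcount` is at most `4(|ν| + 2)`. The smallest is good enough because three gaps below `ℓ` with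
  -- sum `2ℓ` force `ℓ ≥ 3`.
  by_contra! hcon
  have b12 := fun h => hcon _ h d12
  have b23 := fun h => hcon _ h d23
  have b31 := fun h => hcon _ h d31
  rw [imp_false, not_le] at b12 b23 b31
  omega

/-! ### Smallest covers of the circuit by arcs of ears. -/

/-- A finite set of arcs of ears that cover the circuit. -/
structure ArcCover (M : Multigraph ν ε) (σ : ε → ℤˣ) (C : Finset ε) (ℓ : ℕ) (v : ℤ → ν)
    (g : ℤ → ℤˣ) (S : Finset (ℤ × ℤ)) : Prop where
  lt : ∀ a ∈ S, a.1 < a.2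
  short : ∀ a ∈ S, a.2 < a.1 + ℓ
  ear : ∀ a ∈ S, Ear M σ C v g a.1 a.2
  cover : ∀ m : ℤ, ∃ a ∈ S, ∃ t : ℤ, a.1 ≤ m + t * ℓ ∧ m + t * ℓ < a.2

theorem exists_arcCover (w : Wheel M σ C ℓ v e g)
    (h : ∀ k : ℤ, ∃ i j, i ≤ k ∧ k < j ∧ j < i + ℓ ∧ Ear M σ C v g i j) :
    ∃ S, ArcCover M σ C ℓ v g S := by
  choose I J h1 h2 h3 h4 using h
  refine ⟨(Finset.Ico (0 : ℤ) ℓ).image fun k => (I k, J k), ?_, ?_, ?_, fun m => ?_⟩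
  · intro a ha
    obtain ⟨k, -, rfl⟩ := Finset.mem_image.1 ha
    exact (h1 k).trans_lt (h2 k)
  · intro a ha
    obtain ⟨k, -, rfl⟩ := Finset.mem_image.1 ha
    exact h3 k
  · intro a ha
    obtain ⟨k, -, rfl⟩ := Finset.mem_image.1 ha
    exact h4 k
  · have := w.two_le
    obtain ⟨t, ht1, ht2⟩ := exists_window ℓ (by omega) m 0
    exact ⟨_, Finset.mem_image_of_mem _ (Finset.mem_Ico.2 ⟨ht1, by omega⟩), t, h1 _, h2 _⟩

theorem ArcCover.erase {S : Finset (ℤ × ℤ)} (h : ArcCover M σ C ℓ v g S) {c : ℤ × ℤ}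
    (hred : ∀ s, c.1 ≤ s → s < c.2 → ∃ a ∈ S, a ≠ c ∧ ∃ t : ℤ, a.1 ≤ s + t * ℓ ∧ s + t * ℓ < a.2) :
    ArcCover M σ C ℓ v g (S.erase c) := by
  refine ⟨fun a ha => h.lt a (Finset.mem_of_mem_erase ha),
    fun a ha => h.short a (Finset.mem_of_mem_erase ha),
    fun a ha => h.ear a (Finset.mem_of_mem_erase ha), fun m => ?_⟩
  obtain ⟨a, ha, t, h1, h2⟩ := h.cover m
  by_cases hac : a = c
  · subst hac
    obtain ⟨b, hb, hba, t', h1', h2'⟩ := hred _ h1 h2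
    exact ⟨b, Finset.mem_erase.2 ⟨hba, hb⟩, t + t', by rw [add_mul, ← add_assoc]; exact ⟨h1', h2'⟩⟩
  · exact ⟨a, Finset.mem_erase.2 ⟨hac, ha⟩, t, h1, h2⟩

/-- In a cover with the fewest arcs, no lift of a vertex lies on three arcs. -/
theorem ArcCover.card_le_two {S : Finset (ℤ × ℤ)} (h : ArcCover M σ C ℓ v g S)
    (hmin : ∀ S', ArcCover M σ C ℓ v g S' → S.card ≤ S'.card) (m : ℤ) {S' : Finset (ℤ × ℤ)}
    (hS' : S' ⊆ S) (hm : ∀ a ∈ S', ∃ t : ℤ, a.1 ≤ m + t * ℓ ∧ m + t * ℓ ≤ a.2) : S'.card ≤ 2 := by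
  by_contra! hcard
  obtain ⟨a, ha, b, hb, c, hc, hab, hac, hbc⟩ := Finset.two_lt_card.1 hcard
  -- By minimality every arc has an edge that no other arc of the cover contains.
  have hno : ∀ x ∈ S, ¬ ∀ s, x.1 ≤ s → s < x.2 →
      ∃ a ∈ S, a ≠ x ∧ ∃ t : ℤ, a.1 ≤ s + t * ℓ ∧ s + t * ℓ < a.2 := fun x hx hred => by
    have h1 := hmin _ (h.erase hred)
    have h2 := Finset.card_erase_lt_of_mem hx
    omega
  obtain ⟨ta, a1, a2⟩ := hm a ha
  obtain ⟨tb, b1, b2⟩ := hm b hb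
  obtain ⟨tc, c1, c2⟩ := hm c hc
  have na := hno a (hS' ha)
  have nb := hno b (hS' hb)
  have nc := hno c (hS' hc)
  push Not at na nb nc
  obtain ⟨sa, a3, a4, a5⟩ := na
  obtain ⟨sb, b3, b4, b5⟩ := nb
  obtain ⟨sc, c3, c4, c5⟩ := nc
  -- With the lifts aligned at `m`, two of the three private edges lie on the same side of `m`, and
  -- the arc of the farther one contains the nearer one.
  have ab := a5 b (hS' hb) hab.symm (tb - ta)
  have ac := a5 c (hS' hc) hac.symm (tc - ta)
  have ba := b5 a (hS' ha) hab (ta - tb)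
  have bc := b5 c (hS' hc) hbc.symm (tc - tb)
  have ca := c5 a (hS' ha) hac (ta - tc)
  have cb := c5 b (hS' hb) hbc (tb - tc)
  rw [sub_mul] at ab ac ba bc ca cb
  generalize ta * (ℓ : ℤ) = x at *
  generalize tb * (ℓ : ℤ) = y at *
  generalize tc * (ℓ : ℤ) = z at *
  omega

/-- Two arcs inside a third one can be replaced by it, contradicting minimality. -/
theorem ArcCover.no_hull {S : Finset (ℤ × ℤ)} (h : ArcCover M σ C ℓ v g S)
    (hmin : ∀ S', ArcCover M σ C ℓ v g S' → S.card ≤ S'.card) {a b : ℤ × ℤ} (ha : a ∈ S)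
    (hb : b ∈ S) (hab : a ≠ b) {x y : ℤ} (hxy : x < y) (hy : y < x + ℓ) (hE : Ear M σ C v g x y)
    (s t : ℤ) (ha1 : x ≤ a.1 + s * ℓ) (ha2 : a.2 + s * ℓ ≤ y) (hb1 : x ≤ b.1 + t * ℓ)
    (hb2 : b.2 + t * ℓ ≤ y) : False := by
  have hcov : ArcCover M σ C ℓ v g (insert (x, y) ((S.erase a).erase b)) := by
    refine ⟨fun c hc => ?_, fun c hc => ?_, fun c hc => ?_, fun m => ?_⟩
    · rcases Finset.mem_insert.1 hc with rfl | hc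
      · exact hxy
      · exact h.lt c (Finset.mem_of_mem_erase (Finset.mem_of_mem_erase hc))
    · rcases Finset.mem_insert.1 hc with rfl | hc
      · exact hy
      · exact h.short c (Finset.mem_of_mem_erase (Finset.mem_of_mem_erase hc))
    · rcases Finset.mem_insert.1 hc with rfl | hc
      · exact hE
      · exact h.ear c (Finset.mem_of_mem_erase (Finset.mem_of_mem_erase hc))
    · obtain ⟨c, hc, u, h1, h2⟩ := h.cover m
      by_cases hca : c = a
      · subst hca
        exact ⟨(x, y), Finset.mem_insert_self _ _, u + s, by rw [add_mul]; constructor <;> simp only <;> omega⟩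
      by_cases hcb : c = b
      · subst hcb
        exact ⟨(x, y), Finset.mem_insert_self _ _, u + t, by rw [add_mul]; constructor <;> simp only <;> omega⟩
      · exact ⟨c, by simp [hca, hcb, hc], u, h1, h2⟩
  have h1 := hmin _ hcov
  have h2 := Finset.card_insert_le (x, y) ((S.erase a).erase b)
  have h3 := Finset.card_erase_of_mem (Finset.mem_erase.2 ⟨hab.symm, hb⟩)
  have h4 := Finset.card_erase_of_mem ha
  have h5 : 0 < (S.erase a).card := Finset.card_pos.2 ⟨b, Finset.mem_erase.2 ⟨hab.symm, hb⟩⟩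
  omega

/-- In a cover with the fewest arcs, distinct arcs come from distinct bridges of the circuit. -/
theorem ArcCover.not_reach (w : Wheel M σ C ℓ v e g)
    (hbal : ∀ D, M.Circ D → Disjoint D C → sgn σ D = 1)
    (htriple : ¬ ∃ i j k : ℤ, i < j ∧ j < k ∧ k < i + 2 * ℓ ∧ j < i + ℓ ∧ k < j + ℓ ∧
      i + 2 * ℓ < k + ℓ ∧ Ear M σ C v g i j ∧ Ear M σ C v g j k)
    {S : Finset (ℤ × ℤ)} (h : ArcCover M σ C ℓ v g S)
    (hmin : ∀ S', ArcCover M σ C ℓ v g S' → S.card ≤ S'.card) {a b : ℤ × ℤ} (ha : a ∈ S)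
    (hb : b ∈ S) (hab : a ≠ b) : ¬ M.Reach Cᶜ (v a.1) (v b.1) := by
  intro hr
  have hℓ := w.two_le
  -- The second arc is lifted so that its start is related to `a.1` and lies within one round of the
  -- circle of length `2ℓ`; all four ends are then in one class.
  obtain ⟨s, hs1, hs2, hE1⟩ : ∃ s : ℤ, a.1 ≤ b.1 + s * ℓ ∧ b.1 + s * ℓ < a.1 + 2 * ℓ ∧
      Ear M σ C v g a.1 (b.1 + s * ℓ) := by
    rcases w.ear_of_reach hr with hE | hE
    · obtain ⟨t, h1, h2⟩ := exists_window (2 * ℓ) (by omega) b.1 a.1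
      push_cast at h1 h2
      refine ⟨t * 2, by rw [mul_assoc]; exact h1, by rw [mul_assoc]; exact h2, ?_⟩
      rw [mul_assoc]; exact w.ear_shift_right t hE
    · obtain ⟨t, h1, h2⟩ := exists_window (2 * ℓ) (by omega) (b.1 + ℓ) a.1
      push_cast at h1 h2
      have h3 : b.1 + (t * 2 + 1) * ℓ = b.1 + ℓ + t * (2 * ℓ) := by ring
      refine ⟨t * 2 + 1, by rw [h3]; exact h1, by rw [h3]; exact h2, ?_⟩
      rw [h3]; exact w.ear_shift_right t hE
  have hEa := h.ear a ha
  have hEb := w.ear_shift s (h.ear b hb)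
  have hla := h.lt a ha
  have hlb := h.lt b hb
  have hsa := h.short a ha
  have hsb := h.short b hb
  have hull := fun x y hxy hy hE s t => h.no_hull hmin ha hb hab (x := x) (y := y) hxy hy hE s t
  have hE2 := ear_trans hE1 hEb
  have hanti : ∀ {x y : ℤ}, Ear M σ C v g x y → y ≠ x + ℓ := fun hE hxy =>
    w.not_ear_add hbal _ (hxy ▸ hE)
  have n1 := hanti hE1
  have n2 := hanti hE2
  have n3 := hanti (ear_trans (ear_symm hEa) hE1)
  -- No two related lifts are antipodal. Either three of the four ends lie in no half circle, or an
  -- arc shorter than `ℓ` between two of them contains both given arcs and can replace them.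
  rcases lt_or_gt_of_ne n1 with c1 | c1
  · rcases lt_or_gt_of_ne n2 with c2 | c2
    · rcases le_total a.2 (b.2 + s * ℓ) with c3 | c3
      · exact hull _ _ (by omega) c2 hE2 0 s (by omega) (by omega) hs1 le_rfl
      · exact hull _ _ hla hsa hEa 0 s (by omega) (by omega) hs1 c3
    · exact htriple ⟨a.1, b.1 + s * ℓ, b.2 + s * ℓ, by omega, by omega, by omega, c1, by omega,
        by omega, hE1, hEb⟩
  · rcases lt_or_gt_of_ne n3 with c2 | c2
    · exact htriple ⟨a.1, a.2, b.1 + s * ℓ, hla, by omega, hs2, hsa, c2, by omega, hEa,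
        ear_trans (ear_symm hEa) hE1⟩
    · have hE3 : Ear M σ C v g (b.1 + s * ℓ) (a.2 + 2 * ℓ) := by
        have := w.ear_shift_right 1 (ear_trans (ear_symm hE1) hEa)
        rwa [one_mul] at this
      rcases le_total (a.2 + 2 * ℓ) (b.2 + s * ℓ) with c3 | c3
      · exact hull _ _ (by omega) (by omega) hEb 2 s (by omega) c3 le_rfl le_rfl
      · exact hull _ _ (by omega) (by omega) hE3 2 s (by omega) le_rfl le_rfl c3

/-- An ear with its inner vertices. -/
theorem exists_ear_inner (hc : M.Cubic) (hC : M.Circ C) {i j : ℤ} (hE : Ear M σ C v g i j) :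
    ∃ Q ⊆ Cᶜ, M.bd Q = dl (v i) + dl (v j) ∧ ∃ I : Finset ν, Q.card ≤ I.card + 1 ∧
      Disjoint I (M.verts C) ∧ ∀ u ∈ I, M.Reach Cᶜ (v i) u := by
  have : Nonempty ε := ⟨hC.1.choose⟩
  obtain ⟨n, p, f, hp, hpK, hp0, hpn, -, -⟩ := (reach_of_ear hE).exists_isPath
    (A := {v i}) (B := {v j}) rfl rfl
  simp only [Set.mem_singleton_iff] at hp0 hpn
  have hsub : ∀ b ≤ n, (Finset.Ico 0 b).image f ⊆ Cᶜ := fun b hb x hx => by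
    obtain ⟨t, ht, rfl⟩ := Finset.mem_image.1 hx
    exact hpK t ((Finset.mem_Ico.1 ht).2.trans_le hb)
  refine ⟨(Finset.Ico 0 n).image f, hsub n le_rfl, ?_, (Finset.Ico 1 n).image p, ?_, ?_, ?_⟩
  · rw [hp.bd_seg (Nat.zero_le n) le_rfl, hp0, hpn]
  · rw [hp.card_seg le_rfl, Finset.card_image_of_injOn, Nat.card_Ico]
    · omega
    · intro i hi j hj hij
      simp only [Finset.coe_Ico, Set.mem_Ico] at hi hj
      exact hp.inj hi.2.le hj.2.le hij
  · rw [Finset.disjoint_left]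
    intro x hx hxC
    obtain ⟨i, hi, rfl⟩ := Finset.mem_image.1 hx
    rw [Finset.mem_Ico] at hi
    exact hp.inner_notMem hc hC.2.1 hpK (by omega) hi.2 hxC
  · intro u hu
    obtain ⟨t, ht, rfl⟩ := Finset.mem_image.1 hu
    rw [Finset.mem_Ico] at ht
    rw [← hp0]
    exact (hp.reach_seg (Nat.zero_le t) ht.2.le).mono (hsub t ht.2.le)

/-- Without three lifted attachments of a bridge outside every half circle, a smallest cover by
arcs of ears is short. -/
theorem cov_of_no_triple (hc : M.Cubic) (hC : M.Circ C) (w : Wheel M σ C ℓ v e g)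
    (hbal : ∀ D, M.Circ D → Disjoint D C → sgn σ D = 1)
    (hcover : ∀ k : ℤ, ∃ i j, i ≤ k ∧ k < j ∧ j < i + ℓ ∧ Ear M σ C v g i j)
    (htriple : ¬ ∃ i j k : ℤ, i < j ∧ j < k ∧ k < i + 2 * ℓ ∧ j < i + ℓ ∧ k < j + ℓ ∧
      i + 2 * ℓ < k + ℓ ∧ Ear M σ C v g i j ∧ Ear M σ C v g j k) :
    M.Cov σ C (Fintype.card ν + C.card) := by
  classical
  obtain ⟨S, h, hmin⟩ : ∃ S, ArcCover M σ C ℓ v g S ∧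
      ∀ S', ArcCover M σ C ℓ v g S' → S.card ≤ S'.card := by
    have hex : ∃ n S, ArcCover M σ C ℓ v g S ∧ S.card = n := by
      obtain ⟨S, hS⟩ := w.exists_arcCover hcover
      exact ⟨_, S, hS, rfl⟩
    obtain ⟨S, hS, hn⟩ := Nat.find_spec hex
    exact ⟨S, hS, fun S' hS' => hn ▸ Nat.find_min' hex ⟨S', hS', rfl⟩⟩
  have hQ : ∀ a : ℤ × ℤ, ∃ (Q : Finset ε) (I : Finset ν), a ∈ S → Q ⊆ Cᶜ ∧
      M.bd Q = dl (v a.1) + dl (v a.2) ∧ Q.card ≤ I.card + 1 ∧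
      Disjoint I (M.verts C) ∧ ∀ u ∈ I, M.Reach Cᶜ (v a.1) u := fun a => by
    by_cases ha : a ∈ S
    · obtain ⟨Q, h1, h2, I, h3⟩ := exists_ear_inner hc hC (h.ear a ha)
      exact ⟨Q, I, fun _ => ⟨h1, h2, h3⟩⟩
    · exact ⟨∅, ∅, fun h => absurd h ha⟩
  choose Q I hQI using hQ
  have hcov := Cov.biUnion (M := M) (σ := σ) S (fun a => arc e a.1 a.2)
    (fun a => (Q a).card + (a.2 - a.1).toNat) fun a ha =>
      cov_ear hc hC w hbal (h.lt a ha) (h.short a ha) (h.ear a ha) (hQI a ha).1 (hQI a ha).2.1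
  refine hcov.mono (fun f hf => ?_) ?_
  · obtain ⟨m, rfl⟩ := (w.mem f).1 hf
    obtain ⟨a, ha, t, h1, h2⟩ := h.cover m
    exact Finset.mem_biUnion.2 ⟨a, ha, Finset.mem_image.2
      ⟨m + t * ℓ, Finset.mem_Ico.2 ⟨h1, h2⟩, w.e_add_mul m t⟩⟩
  -- inner vertices of the ears
  have hI : ∑ a ∈ S, (I a).card + C.card ≤ Fintype.card ν := by
    have h1 : (S.biUnion I).card = ∑ a ∈ S, (I a).card := Finset.card_biUnion fun a ha b hb hab => by
      change Disjoint (I a) (I b)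
      rw [Finset.disjoint_left]
      intro u hu hu'
      exact h.not_reach w hbal htriple hmin ha hb hab
        (((hQI a ha).2.2.2.2 u hu).trans ((hQI b hb).2.2.2.2 u hu').symm)
    have h2 : Disjoint (S.biUnion I) (M.verts C) := by
      rw [Finset.disjoint_biUnion_left]
      exact fun a ha => (hQI a ha).2.2.2.1
    have h3 : (S.biUnion I ∪ M.verts C).card ≤ Fintype.card ν := Finset.card_le_univ _
    rwa [Finset.card_union_of_disjoint h2, h1, hc.card_verts hC.2.1] at h3
  -- vertices of the arcs
  have harc : ∑ a ∈ S, ((a.2 - a.1).toNat + 1) ≤ 2 * C.card := by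
    let B : ℤ × ℤ → Finset ν := fun a => (Finset.Icc a.1 a.2).image v
    have hB : ∀ a ∈ S, (a.2 - a.1).toNat + 1 = (B a).card := fun a ha => by
      have h1 := h.lt a ha
      have h2 := h.short a ha
      rw [Finset.card_image_of_injOn, Int.card_Icc]
      · omega
      · intro i hi j hj hij
        simp only [Finset.coe_Icc, Set.mem_Icc] at hi hj
        rcases lt_trichotomy i j with h' | h' | h'
        · exact absurd hij (w.v_ne i j h' (by omega))
        · exact h'
        · exact absurd hij.symm (w.v_ne j i h' (by omega))
    have hBC : ∀ a, B a ⊆ M.verts C := fun a u hu => by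
      obtain ⟨i, -, rfl⟩ := Finset.mem_image.1 hu
      exact w.v_mem i
    calc ∑ a ∈ S, ((a.2 - a.1).toNat + 1) = ∑ a ∈ S, (B a).card := Finset.sum_congr rfl hB
      _ = ∑ a ∈ S, ∑ u ∈ M.verts C, if u ∈ B a then 1 else 0 :=
        Finset.sum_congr rfl fun a _ => by
          rw [← Finset.card_filter, Finset.filter_mem_eq_inter, Finset.inter_eq_right.2 (hBC a)]
      _ = ∑ u ∈ M.verts C, (S.filter fun a => u ∈ B a).card := by
        rw [Finset.sum_comm]
        exact Finset.sum_congr rfl fun u _ => (Finset.card_filter _ _).symm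
      _ ≤ ∑ u ∈ M.verts C, 2 := Finset.sum_le_sum fun u hu => by
        obtain ⟨m, rfl⟩ := w.exists_v hu
        refine h.card_le_two hmin m (Finset.filter_subset _ _) fun a ha => ?_
        obtain ⟨i, hi, him⟩ := Finset.mem_image.1 (Finset.mem_filter.1 ha).2
        rw [Finset.mem_Icc] at hi
        obtain ⟨t, rfl⟩ := w.eq_add_mul him
        exact ⟨t, hi⟩
      _ = 2 * C.card := by
        rw [Finset.sum_const, hc.card_verts hC.2.1, smul_eq_mul, mul_comm]
  -- An ear has at most one edge more than inner vertices; the extra edge is charged to its arc,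
  -- which has one vertex more than edges. The total is at most `(n - |C|) + 2|C|`.
  have hsum : ∑ a ∈ S, ((Q a).card + (a.2 - a.1).toNat) ≤
      ∑ a ∈ S, (I a).card + ∑ a ∈ S, ((a.2 - a.1).toNat + 1) := by
    rw [← Finset.sum_add_distrib]
    exact Finset.sum_le_sum fun a ha => by
      have := (hQI a ha).2.2.1
      omega
  omega

end Wheel

/-- An unbalanced circuit of a flow-admissible cubic signed multigraph is covered by sign-circuits
of total length at most `4 / 3` times the number of vertices plus its own length. -/
theorem cov_of_unbalanced_circ (hc : M.Cubic)
    (hconn : ∀ u v, M.Reach Finset.univ u v) (hflow : ¬ M.SingleNegative σ) {C : Finset ε}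
    (hC : M.Circ C) (hs : sgn σ C = -1) :
    ∃ L, 3 * L ≤ 4 * Fintype.card ν + 3 * C.card ∧ M.Cov σ C L := by
  have hpos := hC.card_pos
  by_cases hbal : ∀ D, M.Circ D → Disjoint D C → sgn σ D = 1
  · obtain ⟨ℓ, v, e, g, w⟩ := hC.exists_wheel hs
    by_cases htriple : ∃ i j k : ℤ, i < j ∧ j < k ∧ k < i + 2 * ℓ ∧ j < i + ℓ ∧ k < j + ℓ ∧
      i + 2 * ℓ < k + ℓ ∧ Ear M σ C v g i j ∧ Ear M σ C v g j k
    · obtain ⟨i, j, k, hij, hjk, hki, h1, h2, h3, hE, hE'⟩ := htriple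
      exact w.cov_of_triple hc hC hbal hij hjk hki h1 h2 h3 hE hE'
    · exact ⟨_, by omega, w.cov_of_no_triple hc hC hbal (w.exists_ear_over hconn hflow hbal) htriple⟩
  · push Not at hbal
    obtain ⟨D, hD, hDC, hDs⟩ := hbal
    -- The extra `1` is absorbed since `C` is nonempty.
    exact ⟨_, by omega, cov_of_disjoint_unbalanced hc hconn hC hs hD
      ((sgn_cases σ D).resolve_left hDs) hDC⟩

/-! ### Assembling the cover of a connected graph. -/

/-- The cover of a connected cubic signed multigraph with a proper coloring. -/
theorem cov_univ [Nonempty ν] (hc : M.Cubic) (hconn : ∀ u v, M.Reach Finset.univ u v)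
    (hflow : ¬ M.SingleNegative σ) {c : ε → Fin 3} (h : M.Proper c) :
    ∃ L, 3 * L ≤ 10 * Fintype.card ν ∧ M.Cov σ Finset.univ L := by
  have hb := h.bridgeless hc
  by_cases hgood : ∃ c, M.Proper c ∧ ∀ i, sgn σ (offColor c i) = 1
  · obtain ⟨c, h, hs⟩ := hgood
    obtain ⟨k, hk, hk'⟩ := cov_of_even hc hb hconn (h.bd_offColor hc 0) (hs 0)
    obtain ⟨l, hl, hl'⟩ := cov_of_even hc hb hconn (h.bd_offColor hc 1) (hs 1)
    rw [h.card_offColor hc] at hk' hl'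
    refine ⟨_, ?_, (hk'.union hl').mono (fun e _ => ?_) le_rfl⟩
    · omega
    · rw [Finset.mem_union, mem_offColor, mem_offColor]
      by_contra! hcon
      rw [hcon.1] at hcon
      exact absurd hcon.2 (by decide)
  · obtain ⟨i, j, k, hij, hik, hjk, hi⟩ : ∃ i j k : Fin 3, i ≠ j ∧ i ≠ k ∧ j ≠ k ∧
        sgn σ (offColor c i) = 1 := by
      have hprod := sgn_offColor_mul (σ := σ) c (i := 0) (j := 1) (k := 2)
        (by decide) (by decide) (by decide)
      rcases sgn_cases σ (offColor c 0) with h0 | h0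
      · exact ⟨0, 1, 2, by decide, by decide, by decide, h0⟩
      rcases sgn_cases σ (offColor c 1) with h1 | h1
      · exact ⟨1, 0, 2, by decide, by decide, by decide, h1⟩
      rw [h0, h1] at hprod
      exact ⟨2, 0, 1, by decide, by decide, by decide, by simpa using hprod⟩
    obtain ⟨hj, hk, hbal⟩ := h.balanced hc hgood hij hik hjk hi
    have hcovi := cov_of_balanced (σ := σ) (h.bd_offColor hc i) hbal
    rw [h.card_offColor hc] at hcovi
    obtain ⟨T, h1, h2, h3⟩ := exists_circ_decomposition _ (h.bd_offColor hc j)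
    have hT : ∀ C ∈ T, C ⊆ offColor c j := fun C hC => h3 ▸ Finset.subset_biUnion_of_mem id hC
    obtain ⟨C, hC, hCs⟩ := exists_unbalanced hj h2 h3
    -- Exchanging `i` and `k` on an unbalanced circuit of the set avoiding `j` makes the set
    -- avoiding `k` positive, hence a union of balanced circuits.
    have hsymm : ∀ C ∈ T, sgn σ C = -1 →
        M.Cov σ (offColor c k ∆ C) (Fintype.card ν) := by
      intro C hC hCs
      have hp := h.kempe hc hij.symm hjk (h1 C hC).2.1 (hT C hC)
      obtain ⟨e1, e2⟩ := offColor_kempe hij.symm hjk hik (hT C hC)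
      have hs : sgn σ (offColor (kempe c C i k) k) = 1 := by rw [e2, sgn_symmDiff, hk, hCs]; rfl
      obtain ⟨-, -, hbal'⟩ := hp.balanced hc hgood hik.symm hjk.symm hij hs
      have := cov_of_balanced (σ := σ) (hp.bd_offColor hc k) hbal'
      rwa [hp.card_offColor hc, e2] at this
    have hmemi : ∀ e, e ∉ offColor c i → e ∈ offColor c j ∧ e ∈ offColor c k := by
      intro e he
      rw [mem_offColor, not_not] at he
      rw [mem_offColor, mem_offColor, he]
      exact ⟨hij, hik⟩
    -- With two unbalanced circuits, an edge of color `i` misses one of them and so lies in one of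
    -- the two symmetric differences.
    by_cases hC' : ∃ C' ∈ T, C' ≠ C ∧ sgn σ C' = -1
    · obtain ⟨C', hC', hne, hCs'⟩ := hC'
      refine ⟨_, ?_, ((hcovi.union (hsymm C hC hCs)).union (hsymm C' hC' hCs')).mono
        (fun e _ => ?_) le_rfl⟩
      · omega
      · simp only [Finset.mem_union]
        by_cases hei : e ∈ offColor c i
        · exact Or.inl (Or.inl hei)
        · have hek := (hmemi e hei).2
          by_cases heC : e ∈ C
          · exact Or.inr (Finset.mem_symmDiff.2 (Or.inl ⟨hek, fun heC' =>
              Finset.disjoint_left.1 (h2 C' hC' C hC hne) heC' heC⟩))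
          · exact Or.inl (Or.inr (Finset.mem_symmDiff.2 (Or.inl ⟨hek, heC⟩)))
    · push Not at hC'
      -- Here the lengths are `n`, `n - |C|` and `4n/3 + |C|`.
      obtain ⟨L, hL, hcovC⟩ := cov_of_unbalanced_circ hc hconn hflow (h1 C hC) hCs
      have hcovj := Cov.biUnion (M := M) (σ := σ) (T.erase C) id Finset.card fun D hD => by
        rw [Finset.mem_erase] at hD
        exact SignCircuit.cov (Or.inl ⟨h1 D hD.2, (sgn_cases σ D).resolve_right (hC' D hD.2 hD.1)⟩)
      refine ⟨_, ?_, ((hcovi.union hcovj).union hcovC).mono (fun e _ => ?_) le_rfl⟩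
      · have h4 := card_biUnion_circ h2
        rw [h3, h.card_offColor hc, ← Finset.add_sum_erase T _ hC] at h4
        omega
      · simp only [Finset.mem_union]
        by_cases hei : e ∈ offColor c i
        · exact Or.inl (Or.inl hei)
        · have hej := (hmemi e hei).1
          rw [← h3] at hej
          obtain ⟨D, hD, heD⟩ := Finset.mem_biUnion.1 hej
          by_cases hDC : D = C
          · exact Or.inr (hDC ▸ heD)
          · exact Or.inl (Or.inr (Finset.mem_biUnion.2 ⟨D, Finset.mem_erase.2 ⟨hDC, hD⟩, heD⟩))

end Multigraph

namespace Graph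

/-! ### Multigraphs inside graphs -/

variable {ν ε α β : Type*} {M : Multigraph ν ε} {G : Graph α β} {φ : ν → α} {ψ : ε → β}

/-- The maps `φ` and `ψ` identify the multigraph `M` with a subgraph of `G`. -/
structure Realizes (M : Multigraph ν ε) (G : Graph α β) (φ : ν → α) (ψ : ε → β) : Prop where
  inj_vert : Function.Injective φ
  inj_edge : Function.Injective ψ
  mem : ∀ v, φ v ∈ V(G)
  isLink : ∀ e, G.IsLink (ψ e) (φ (M.s e)) (φ (M.t e))

namespace Realizes

theorem inc_iff (h : Realizes M G φ ψ) {e : ε} {v : ν} : G.Inc (ψ e) (φ v) ↔ M.Inc e v := by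
  constructor
  · intro hi
    rcases hi.eq_or_eq_of_isLink (h.isLink e) with hv | hv
    · exact Or.inl (h.inj_vert hv).symm
    · exact Or.inr (h.inj_vert hv).symm
  · rintro (rfl | rfl)
    · exact (h.isLink e).inc_left
    · exact (h.isLink e).inc_right

theorem link (h : Realizes M G φ ψ) {e : ε} {x y : ν} (hl : M.Link e x y) :
    G.IsLink (ψ e) (φ x) (φ y) := by
  rcases hl with ⟨rfl, rfl⟩ | ⟨rfl, rfl⟩
  · exact h.isLink e
  · exact (h.isLink e).symm

theorem link_iff (h : Realizes M G φ ψ) {e : ε} {x y : ν} :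
    G.IsLink (ψ e) (φ x) (φ y) ↔ M.Link e x y := by
  refine ⟨fun hl => ?_, h.link⟩
  rcases hl.eq_and_eq_or_eq_and_eq (h.isLink e) with ⟨h1, h2⟩ | ⟨h1, h2⟩
  · exact Or.inl ⟨(h.inj_vert h1).symm, (h.inj_vert h2).symm⟩
  · exact Or.inr ⟨(h.inj_vert h2).symm, (h.inj_vert h1).symm⟩

/-- The subgraph of `G` given by sets of vertices and edges of `M`. -/
def sub (h : Realizes M G φ ψ) (V : Set ν) (A : Set ε) (hA : ∀ e ∈ A, M.s e ∈ V ∧ M.t e ∈ V) :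
    Graph α β where
  vertexSet := φ '' V
  edgeSet := ψ '' A
  IsLink f x y := f ∈ ψ '' A ∧ G.IsLink f x y
  isLink_symm _ _ := ⟨fun _ _ hl => ⟨hl.1, hl.2.symm⟩⟩
  eq_or_eq_of_isLink_of_isLink _ _ _ _ _ hl hl' := hl.2.left_eq_or_eq hl'.2
  edge_mem_iff_exists_isLink f := by
    constructor
    · rintro ⟨e, he, rfl⟩
      exact ⟨_, _, ⟨e, he, rfl⟩, h.isLink e⟩
    · rintro ⟨_, _, hl⟩
      exact hl.1
  left_mem_of_isLink := by
    rintro _ x y ⟨⟨e, he, rfl⟩, hl⟩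
    rcases hl.left_eq_or_eq (h.isLink e) with rfl | rfl
    · exact ⟨_, (hA e he).1, rfl⟩
    · exact ⟨_, (hA e he).2, rfl⟩

theorem sub_le (h : Realizes M G φ ψ) {V : Set ν} {A : Set ε}
    (hA : ∀ e ∈ A, M.s e ∈ V ∧ M.t e ∈ V) : h.sub V A hA ≤ G :=
  ⟨by rintro _ ⟨v, _, rfl⟩; exact h.mem v, fun _ _ _ hl => hl.2⟩

theorem sub_mono (h : Realizes M G φ ψ) {V V' : Set ν} {A A' : Set ε}
    (hA : ∀ e ∈ A, M.s e ∈ V ∧ M.t e ∈ V) (hA' : ∀ e ∈ A', M.s e ∈ V' ∧ M.t e ∈ V')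
    (hV : V ⊆ V') (hAA : A ⊆ A') : h.sub V A hA ≤ h.sub V' A' hA' :=
  ⟨Set.image_mono hV, fun _ _ _ hl => ⟨Set.image_mono hAA hl.1, hl.2⟩⟩

variable [Fintype ν] [Fintype ε] [DecidableEq ν] [DecidableEq ε]

theorem ends_mem_verts (A : Finset ε) :
    ∀ e ∈ (A : Set ε), M.s e ∈ (M.verts A : Set ν) ∧ M.t e ∈ (M.verts A : Set ν) :=
  fun e he => ⟨Multigraph.mem_verts.2 ⟨e, he, Or.inl rfl⟩,
    Multigraph.mem_verts.2 ⟨e, he, Or.inr rfl⟩⟩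

/-- The subgraph of `G` formed by a set of edges of `M`. -/
def edgeSub (h : Realizes M G φ ψ) (A : Finset ε) : Graph α β :=
  h.sub (M.verts A) A (ends_mem_verts A)

theorem vertexSet_edgeSub (h : Realizes M G φ ψ) (A : Finset ε) :
    V(h.edgeSub A) = φ '' M.verts A := rfl

theorem edgeSet_edgeSub (h : Realizes M G φ ψ) (A : Finset ε) :
    E(h.edgeSub A) = ψ '' A := rfl

theorem edgeSub_le (h : Realizes M G φ ψ) (A : Finset ε) : h.edgeSub A ≤ G := h.sub_le _

theorem edgeSub_mono (h : Realizes M G φ ψ) {A B : Finset ε} (hAB : A ⊆ B) :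
    h.edgeSub A ≤ h.edgeSub B :=
  h.sub_mono _ _ (by exact_mod_cast Multigraph.verts_mono hAB) (by exact_mod_cast hAB)

theorem ncard_edgeSub (h : Realizes M G φ ψ) (A : Finset ε) :
    E(h.edgeSub A).ncard = A.card := by
  rw [edgeSet_edgeSub, Set.ncard_image_of_injective _ h.inj_edge, Set.ncard_coe_finset]

theorem deg_edgeSub (h : Realizes M G φ ψ) (A : Finset ε) (v : ν) :
    (h.edgeSub A).deg (φ v) = M.dg A v := by
  have h1 : {f | (h.edgeSub A).Inc f (φ v)} = ψ '' (A.filter fun e => M.Inc e v : Finset ε) := by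
    ext f
    constructor
    · rintro ⟨y, ⟨e, he, rfl⟩, hl⟩
      exact ⟨e, Finset.mem_coe.2 (Finset.mem_filter.2 ⟨he, h.inc_iff.1 ⟨y, hl⟩⟩), rfl⟩
    · rintro ⟨e, he, rfl⟩
      obtain ⟨he, hi⟩ := Finset.mem_filter.1 (Finset.mem_coe.1 he)
      obtain ⟨y, hl⟩ := hi.exists_link
      exact ⟨φ y, ⟨e, he, rfl⟩, h.link hl⟩
  have h2 : {f | (h.edgeSub A).IsLoopAt f (φ v)} = ∅ := by
    refine Set.eq_empty_of_forall_notMem ?_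
    rintro _ ⟨⟨e, _, rfl⟩, hl⟩
    exact (h.link_iff.1 hl).ne rfl
  rw [deg, h1, h2, Set.ncard_empty, add_zero, Set.ncard_image_of_injective _ h.inj_edge,
    Set.ncard_coe_finset]
  rfl

theorem isCircuit (h : Realizes M G φ ψ) (hc : M.Cubic) {C : Finset ε} (hC : M.Circ C) :
    (h.edgeSub C).IsCircuit := by
  refine ⟨(Finset.finite_toSet _).image φ, ⟨?_, ?_⟩, ?_⟩
  · obtain ⟨e, he⟩ := hC.1
    exact ⟨_, _, (ends_mem_verts C e he).1, rfl⟩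
  · rintro _ ⟨u, hu, rfl⟩ _ ⟨v, hv, rfl⟩
    exact Relation.ReflTransGen.lift φ
      (fun _ _ ⟨e, he, hl⟩ => ⟨ψ e, ⟨e, he, rfl⟩, h.link hl⟩) _ _ (hC.reach hu hv)
  · rintro _ ⟨v, hv, rfl⟩
    rw [deg_edgeSub, hc.dg_eq_two hC.2.1 hv]

variable {σ : β → ℤˣ}

theorem sgn_eq (h : Realizes M G φ ψ) (A : Finset ε) :
    Multigraph.sgn (σ ∘ ψ) A = (-1) ^ {f | f ∈ E(h.edgeSub A) ∧ σ f = -1}.ncard := by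
  have h1 : {f | f ∈ E(h.edgeSub A) ∧ σ f = -1} =
      ψ '' (A.filter fun e => σ (ψ e) = -1 : Finset ε) := by
    ext f
    simp only [edgeSet_edgeSub, Set.mem_ofPred_eq, Set.mem_image, Finset.mem_coe,
      Finset.mem_filter]
    constructor
    · rintro ⟨⟨e, he, rfl⟩, hs⟩
      exact ⟨e, ⟨he, hs⟩, rfl⟩
    · rintro ⟨e, ⟨he, hs⟩, rfl⟩
      exact ⟨⟨e, he, rfl⟩, hs⟩
  rw [h1, Set.ncard_image_of_injective _ h.inj_edge, Set.ncard_coe_finset, Multigraph.sgn,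
    ← Finset.prod_const, Finset.prod_filter]
  refine Finset.prod_congr rfl fun e _ => ?_
  split_ifs with hs
  · exact hs
  · exact (Int.units_eq_one_or _).resolve_right hs

theorem isBalancedCircuit (h : Realizes M G φ ψ) (hc : M.Cubic) {C : Finset ε} (hC : M.Circ C)
    (hs : Multigraph.sgn (σ ∘ ψ) C = 1) : (h.edgeSub C).IsBalancedCircuit σ := by
  refine ⟨h.isCircuit hc hC, ?_⟩
  by_contra hodd
  rw [h.sgn_eq, (Nat.not_even_iff_odd.1 hodd).neg_one_pow] at hs
  exact absurd hs (by decide)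

theorem isUnbalancedCircuit (h : Realizes M G φ ψ) (hc : M.Cubic) {C : Finset ε}
    (hC : M.Circ C) (hs : Multigraph.sgn (σ ∘ ψ) C = -1) :
    (h.edgeSub C).IsUnbalancedCircuit σ := by
  refine ⟨h.isCircuit hc hC, ?_⟩
  by_contra heven
  rw [h.sgn_eq, (Nat.not_odd_iff_even.1 heven).neg_one_pow] at hs
  exact absurd hs (by decide)

theorem isBarbell (h : Realizes M G φ ψ) (hc : M.Cubic) {A : Finset ε}
    (hA : M.Barbell (σ ∘ ψ) A) : (h.edgeSub A).IsBarbell σ := by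
  obtain ⟨C₁, C₂, n, p, e, h₁, h₂, hs₁, hs₂, hd, hp, hp₁, hp₂, rfl⟩ := hA
  have hP : ∀ f ∈ e '' Set.Iio n, M.s f ∈ p '' Set.Iic n ∧ M.t f ∈ p '' Set.Iic n := by
    rintro _ ⟨i, hi, rfl⟩
    have hi : i < n := hi
    have hl : p i ∈ p '' Set.Iic n := ⟨i, hi.le, rfl⟩
    have hr : p (i + 1) ∈ p '' Set.Iic n := ⟨i + 1, hi, rfl⟩
    rcases hp.link i hi with ⟨hs, ht⟩ | ⟨hs, ht⟩
    · rw [hs, ht]; exact ⟨hl, hr⟩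
    · rw [hs, ht]; exact ⟨hr, hl⟩
  have h0 : p 0 ∈ M.verts C₁ := (hp₁ 0 n.zero_le).2 rfl
  have hn : p n ∈ M.verts C₂ := (hp₂ n le_rfl).2 rfl
  have hne : p 0 ≠ p n := fun heq => Finset.disjoint_left.1 hd h0 (heq ▸ hn)
  have himg : e '' Set.Iio n = ((Finset.Ico 0 n).image e : Finset ε) := by
    ext f; simp
  have hV : ∀ i ≤ n, p i ∈ M.verts (C₁ ∪ (Finset.Ico 0 n).image e ∪ C₂) := by
    intro i hi
    by_cases hin : i = n
    · exact Multigraph.verts_mono Finset.subset_union_right (hin ▸ hn)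
    · have hlt : i < n := by omega
      refine Multigraph.mem_verts.2 ⟨e i, ?_, (hp.link i hlt).inc_left⟩
      exact Finset.mem_union_left _ (Finset.mem_union_right _
        (Finset.mem_image_of_mem e (Finset.mem_Ico.2 ⟨i.zero_le, hlt⟩)))
  have hinter : ∀ (C : Finset ε) (k : ℕ), k ≤ n → (∀ i ≤ n, p i ∈ M.verts C ↔ i = k) →
      V(h.edgeSub C) ∩ V(h.sub (p '' Set.Iic n) (e '' Set.Iio n) hP) = {φ (p k)} := by
    intro C k hk hC
    change φ '' _ ∩ φ '' _ = _
    rw [← Set.image_inter h.inj_vert, ← Set.image_singleton]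
    congr 1
    ext x
    constructor
    · rintro ⟨hx, i, hi, rfl⟩
      rw [(hC i hi).1 hx]; rfl
    · rintro rfl
      exact ⟨(hC k hk).2 rfl, k, hk, rfl⟩
  refine ⟨h.edgeSub C₁, h.edgeSub C₂, h.sub (p '' Set.Iic n) (e '' Set.Iio n) hP,
    φ (p 0), φ (p n), h.edgeSub_mono fun f hf => ?_, h.edgeSub_mono Finset.subset_union_right,
    h.sub_mono _ _ ?_ ?_, ?_, ?_, h.isUnbalancedCircuit hc h₁ hs₁,
    h.isUnbalancedCircuit hc h₂ hs₂, ?_, hinter C₁ 0 n.zero_le hp₁, hinter C₂ n le_rfl hp₂, ?_,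
    Or.inr ⟨h.inj_vert.ne hne, ?_⟩⟩
  · exact Finset.mem_union_left _ (Finset.mem_union_left _ hf)
  · rintro _ ⟨i, hi, rfl⟩
    exact hV i hi
  · rw [himg]
    exact_mod_cast fun f hf => Finset.mem_union_left _ (Finset.mem_union_right _ hf)
  · change φ '' _ = φ '' _ ∪ φ '' _ ∪ φ '' _
    rw [← Set.image_union, ← Set.image_union]
    congr 1
    ext x
    constructor
    · intro hx
      rw [Finset.mem_coe, Multigraph.verts_union, Multigraph.verts_union, Finset.mem_union,
        Finset.mem_union] at hx
      rcases hx with (hx | hx) | hx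
      · exact Or.inl (Or.inl hx)
      · obtain ⟨i, _, hi, rfl⟩ := hp.mem_verts_seg le_rfl hx
        exact Or.inl (Or.inr ⟨i, hi, rfl⟩)
      · exact Or.inr hx
    · rintro ((hx | ⟨i, hi, rfl⟩) | hx)
      · rw [Multigraph.verts_union, Multigraph.verts_union]
        exact Finset.mem_union_left _ (Finset.mem_union_left _ hx)
      · exact hV i hi
      · rw [Multigraph.verts_union]
        exact Finset.mem_union_right _ hx
  · change ψ '' _ = ψ '' _ ∪ ψ '' _ ∪ ψ '' _
    rw [himg, Finset.coe_union, Finset.coe_union, Set.image_union, Set.image_union]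
  · refine ⟨n, φ ∘ p, ψ ∘ e, rfl, rfl, fun i hi j hj hij => hp.inj hi hj (h.inj_vert hij),
      fun i hi => ⟨⟨e i, ⟨i, hi, rfl⟩, rfl⟩, h.link (hp.link i hi)⟩, ?_, ?_⟩
    · rw [Set.image_comp]; rfl
    · rw [Set.image_comp]; rfl
  · rw [edgeSet_edgeSub, edgeSet_edgeSub, Set.disjoint_image_iff h.inj_edge,
      Finset.disjoint_coe]
    exact Multigraph.disjoint_of_verts hd
  · rw [vertexSet_edgeSub, vertexSet_edgeSub, Set.disjoint_image_iff h.inj_vert,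
      Finset.disjoint_coe]
    exact hd

theorem isSignCircuit (h : Realizes M G φ ψ) (hc : M.Cubic) {A : Finset ε}
    (hA : M.SignCircuit (σ ∘ ψ) A) : (h.edgeSub A).IsSignCircuit σ :=
  hA.imp (fun hA => h.isBalancedCircuit hc hA.1 hA.2) (h.isBarbell hc)

/-- A cover in `M` gives a family of sign-circuits in `G`. -/
theorem exists_family (h : Realizes M G φ ψ) (hc : M.Cubic) {S : Finset ε} {L : ℕ}
    (hS : M.Cov (σ ∘ ψ) S L) :
    ∃ F : Multiset (Graph α β), (∀ C ∈ F, C ≤ G ∧ C.IsSignCircuit σ) ∧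
      (∀ e ∈ S, ∃ C ∈ F, ψ e ∈ E(C)) ∧ familyLength F ≤ L := by
  obtain ⟨F, h1, h2, h3⟩ := hS
  refine ⟨F.map h.edgeSub, fun C hC => ?_, fun e he => ?_, ?_⟩
  · obtain ⟨A, hA, rfl⟩ := Multiset.mem_map.1 hC
    exact ⟨h.edgeSub_le A, h.isSignCircuit hc (h1 A hA)⟩
  · obtain ⟨A, hA, heA⟩ := h2 e he
    exact ⟨_, Multiset.mem_map_of_mem _ hA, e, heA, rfl⟩
  · rw [familyLength, Multiset.map_map]
    simpa only [Function.comp_def, ncard_edgeSub] using h3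

/-- A flow on `G` sums to a contradiction over a part of `G` that is balanced up to one edge. -/
theorem not_singleNegative (h : Realizes M G φ ψ)
    (hclosed : ∀ f v, G.Inc f (φ v) → f ∈ Set.range ψ) (hflow : G.IsFlowAdmissible σ) :
    ¬ M.SingleNegative (σ ∘ ψ) := by
  classical
  rintro ⟨e₀, k, hk₀, hk⟩
  obtain ⟨τ, f, hf, hτ⟩ := hflow
  have hnet : ∀ v, τ.netFlow f (φ v) =
      ∑ e, ((if τ.fst (ψ e) = φ v then (τ.dirFst (ψ e) : ℤ) * f (ψ e) else 0) +
        (if τ.snd (ψ e) = φ v then (τ.dirSnd (ψ e) : ℤ) * f (ψ e) else 0)) := by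
    intro v
    rw [SignedOrientation.netFlow, ← finsum_eq_sum_of_fintype, ← finsum_mem_range h.inj_edge
      (f := fun b => (if τ.fst b = φ v then (τ.dirFst b : ℤ) * f b else 0) +
        (if τ.snd b = φ v then (τ.dirSnd b : ℤ) * f b else 0))]
    apply finsum_mem_inter_support_eq
    ext b
    simp only [Set.mem_inter_iff, and_congr_left_iff, Function.mem_support]
    intro hb
    constructor
    · intro hbE
      by_cases h1 : τ.fst b = φ v
      · exact hclosed b v (h1 ▸ (τ.isLink b hbE).inc_left)
      · by_cases h2 : τ.snd b = φ v
        · exact hclosed b v (h2 ▸ (τ.isLink b hbE).inc_right)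
        · simp [h1, h2] at hb
    · rintro ⟨e, rfl⟩
      exact (h.isLink e).edge_mem
  -- Conservation is summed with the switching signs `k` as weights. The two half-edges of every
  -- edge but `e₀` cancel, while `e₀` contributes `±2` times its nonzero flow value.
  have hsum : ∑ v, (k v : ℤ) * τ.netFlow f (φ v) = 0 :=
    Finset.sum_eq_zero fun v _ => by rw [hτ _ (h.mem v), mul_zero]
  have hedge : ∀ e, ∃ x y, k x * k y = k (M.s e) * k (M.t e) ∧
      ∑ v, (k v : ℤ) *
        ((if τ.fst (ψ e) = φ v then (τ.dirFst (ψ e) : ℤ) * f (ψ e) else 0) +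
        (if τ.snd (ψ e) = φ v then (τ.dirSnd (ψ e) : ℤ) * f (ψ e) else 0)) =
      ((k x * τ.dirFst (ψ e) : ℤˣ) + (k y * τ.dirSnd (ψ e) : ℤˣ) : ℤ) * f (ψ e) := by
    intro e
    obtain ⟨x, y, hxy, hx, hy⟩ : ∃ x y, k x * k y = k (M.s e) * k (M.t e) ∧
        τ.fst (ψ e) = φ x ∧ τ.snd (ψ e) = φ y := by
      rcases (τ.isLink _ (h.isLink e).edge_mem).eq_and_eq_or_eq_and_eq (h.isLink e) with hl | hl
      · exact ⟨_, _, rfl, hl⟩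
      · exact ⟨_, _, mul_comm _ _, hl⟩
    refine ⟨x, y, hxy, ?_⟩
    rw [hx, hy]
    simp only [h.inj_vert.eq_iff, mul_add, mul_ite, mul_zero, Finset.sum_add_distrib,
      Finset.sum_ite_eq, Finset.mem_univ, if_true]
    push_cast
    ring
  have hdir : ∀ e, τ.dirFst (ψ e) * τ.dirSnd (ψ e) = - σ (ψ e) := fun e =>
    τ.dir_mul _ (h.isLink e).edge_mem
  simp only [hnet, Finset.mul_sum] at hsum
  rw [Finset.sum_comm, Finset.sum_eq_single e₀] at hsum
  · obtain ⟨x, y, hxy, he⟩ := hedge e₀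
    rw [he, mul_eq_zero] at hsum
    have h1 : k x * k y = τ.dirFst (ψ e₀) * τ.dirSnd (ψ e₀) := by
      rw [hxy, hdir]
      exact (neg_eq_iff_eq_neg.2 hk₀).symm
    refine hsum.elim (fun hs => ?_) (hf _ (h.isLink e₀).edge_mem)
    generalize k x = a at *
    generalize k y = b at *
    generalize τ.dirFst (ψ e₀) = c at *
    generalize τ.dirSnd (ψ e₀) = d at *
    clear * - h1 hs
    revert a b c d
    decide
  · intro e _ hne
    obtain ⟨x, y, hxy, he⟩ := hedge e
    rw [he]
    have h1 : k x * k y = -(τ.dirFst (ψ e) * τ.dirSnd (ψ e)) := by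
      rw [hxy, hdir, neg_neg]
      exact (hk e hne).symm
    generalize k x = a at *
    generalize k y = b at *
    generalize τ.dirFst (ψ e) = c at *
    generalize τ.dirSnd (ψ e) = d at *
    have h2 : ((a * c : ℤˣ) + (b * d : ℤˣ) : ℤ) = 0 := by
      clear * - h1
      revert a b c d
      decide
    rw [h2, zero_mul]
  · exact fun hn => absurd (Finset.mem_univ e₀) hn

end Realizes

/-! ### Components -/

/-- The edges with an end in `U`. -/
def edgesAt (G : Graph α β) (U : Set α) : Set β := {e | ∃ x ∈ U, G.Inc e x}

theorem edgesAt_subset (G : Graph α β) (U : Set α) : G.edgesAt U ⊆ E(G) :=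
  fun _ ⟨_, _, hi⟩ => hi.edge_mem

/-- A loopless multigraph on the component of a vertex. -/
theorem exists_realizes (hloop : ∀ e v, ¬ G.IsLoopAt e v) {S : Set α}
    (hSV : S ⊆ V(G)) (hS : ∀ x ∈ S, ∀ y, G.Adj x y → y ∈ S) :
    ∃ M : Multigraph S (G.edgesAt S), Realizes M G Subtype.val Subtype.val := by
  have hex : ∀ e : G.edgesAt S, ∃ x y : S, G.IsLink e x y := by
    rintro ⟨e, x, hx, y, hl⟩
    exact ⟨⟨x, hx⟩, ⟨y, hS x hx y hl.adj⟩, hl⟩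
  choose s t hst using hex
  refine ⟨⟨s, t, fun e he => hloop e (s e) ?_⟩, Subtype.val_injective, Subtype.val_injective,
    fun v => hSV v.2, hst⟩
  have := hst e
  rwa [← he] at this

theorem exists_family_component {σ : β → ℤˣ} (hV : V(G).Finite) (hE : E(G).Finite)
    (hcubic : G.IsRegular 3) (hcol : G.IsEdgeColorable 3) (hflow : G.IsFlowAdmissible σ)
    {S : Set α} (hSV : S ⊆ V(G)) (hS : ∀ x ∈ S, ∀ y, G.Adj x y → y ∈ S) {v₀ : α} (hv₀ : v₀ ∈ S)
    (hconn : ∀ v ∈ S, Relation.ReflTransGen G.Adj v₀ v) :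
    ∃ F : Multiset (Graph α β), (∀ C ∈ F, C ≤ G ∧ C.IsSignCircuit σ) ∧
      (∀ e ∈ G.edgesAt S, ∃ C ∈ F, e ∈ E(C)) ∧
      9 * familyLength F ≤ 20 * (G.edgesAt S).ncard := by
  classical
  obtain ⟨c, hloop, hcol⟩ := hcol
  obtain ⟨M, hM⟩ := exists_realizes hloop hSV hS
  have : Finite S := hV.subset hSV
  have : Finite (G.edgesAt S) := hE.subset (G.edgesAt_subset S)
  have := Fintype.ofFinite S
  have := Fintype.ofFinite (G.edgesAt S)
  have : Nonempty S := ⟨⟨v₀, hv₀⟩⟩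
  have hc : M.Cubic := by
    intro v
    have h1 : {e | G.IsLoopAt e v} = ∅ := Set.eq_empty_of_forall_notMem fun e => hloop e v
    have h2 : {e | G.Inc e v} = Subtype.val ''
        ((Finset.univ.filter fun e => M.Inc e v : Finset (G.edgesAt S)) : Set (G.edgesAt S)) := by
      ext e
      constructor
      · intro hi
        have hi' : G.Inc ((⟨e, v, v.2, hi⟩ : G.edgesAt S) : β) (v : α) := hi
        exact ⟨⟨e, v, v.2, hi⟩, by simpa using hM.inc_iff.1 hi', rfl⟩
      · rintro ⟨e, he, rfl⟩
        exact hM.inc_iff.2 (by simpa using he)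
    rw [← hcubic v (hSV v.2), deg, h1, h2, Set.ncard_empty, add_zero,
      Set.ncard_image_of_injective _ Subtype.val_injective, Set.ncard_coe_finset]
    rfl
  have hreach : ∀ v (hv : v ∈ S), M.Reach Finset.univ ⟨v₀, hv₀⟩ ⟨v, hv⟩ := by
    intro v hv
    have := hconn v hv
    induction this with
    | refl => exact Multigraph.Reach.refl _
    | @tail x y hx hxy ih =>
      have hxS : x ∈ S := hS y hv x hxy.symm
      obtain ⟨e, hl⟩ := hxy
      exact (ih hxS).trans (Multigraph.Reach.of_link (e := ⟨e, x, hxS, y, hl⟩) (Finset.mem_univ _)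
        (hM.link_iff.1 hl))
  have hproper : M.Proper fun e => c e := fun v e f he hf hne =>
    hcol v e f (hM.inc_iff.2 he) (hM.inc_iff.2 hf) fun h => hne (Subtype.ext h)
  obtain ⟨L, hL, hcov⟩ := Multigraph.cov_univ hc
    (fun u v => (hreach u u.2).symm.trans (hreach v v.2))
    (hM.not_singleNegative (fun f v hi => ⟨⟨f, v, v.2, hi⟩, rfl⟩) hflow) hproper
  obtain ⟨F, h1, h2, h3⟩ := hM.exists_family hc hcov
  refine ⟨F, h1, fun e he => h2 ⟨e, he⟩ (Finset.mem_univ _), ?_⟩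
  -- In a cubic graph `2|E| = 3|V|`, which turns `10/3` per vertex into `20/9` per edge.
  have h4 := Multigraph.sum_dg (M := M) Finset.univ
  have h5 : ∑ v, M.dg Finset.univ v = Fintype.card S * 3 := by
    rw [Finset.sum_congr rfl fun v _ => hc v, Finset.sum_const, smul_eq_mul, Finset.card_univ]
  rw [← Nat.card_coe_set_eq, Nat.card_eq_fintype_card]
  rw [h5, Finset.card_univ] at h4
  omega

/-- One component is split off at a time; no edge joins it to the rest, so lengths and edge numbers
add. -/
theorem exists_family_closed {σ : β → ℤˣ} (hV : V(G).Finite) (hE : E(G).Finite)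
    (hcubic : G.IsRegular 3) (hcol : G.IsEdgeColorable 3) (hflow : G.IsFlowAdmissible σ)
    (n : ℕ) : ∀ U ⊆ V(G), U.ncard = n → (∀ x ∈ U, ∀ y, G.Adj x y → y ∈ U) →
    ∃ F : Multiset (Graph α β), (∀ C ∈ F, C ≤ G ∧ C.IsSignCircuit σ) ∧
      (∀ e ∈ G.edgesAt U, ∃ C ∈ F, e ∈ E(C)) ∧
      9 * familyLength F ≤ 20 * (G.edgesAt U).ncard := by
  induction n using Nat.strong_induction_on with
  | _ n ih =>
    intro U hUV hn hU
    rcases U.eq_empty_or_nonempty with rfl | ⟨v₀, hv₀⟩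
    · exact ⟨0, by simp, by rintro e ⟨x, hx, _⟩; exact hx.elim, by simp [familyLength]⟩
    set S : Set α := {v | Relation.ReflTransGen G.Adj v₀ v} with hSdef
    have hSU : S ⊆ U := by
      intro v hv
      induction hv with
      | refl => exact hv₀
      | tail _ hxy ih => exact hU _ ih _ hxy
    have hS : ∀ x ∈ S, ∀ y, G.Adj x y → y ∈ S := fun x hx y hxy =>
      Relation.ReflTransGen.tail hx hxy
    have hv₀S : v₀ ∈ S := Relation.ReflTransGen.refl
    have hR : ∀ x ∈ U \ S, ∀ y, G.Adj x y → y ∈ U \ S := fun x hx y hxy =>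
      ⟨hU x hx.1 y hxy, fun hy => hx.2 (hS y hy x hxy.symm)⟩
    obtain ⟨F, f1, f2, f3⟩ := exists_family_component hV hE hcubic hcol hflow
      (hSU.trans hUV) hS hv₀S fun v hv => hv
    obtain ⟨F', g1, g2, g3⟩ := ih (U \ S).ncard
      (hn ▸ Set.ncard_lt_ncard ⟨Set.sdiff_subset, fun h => (h hv₀).2 hv₀S⟩ (hV.subset hUV))
      (U \ S) (Set.sdiff_subset.trans hUV) rfl hR
    have hun : G.edgesAt U = G.edgesAt S ∪ G.edgesAt (U \ S) := by
      ext e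
      constructor
      · rintro ⟨x, hx, hi⟩
        by_cases hxS : x ∈ S
        · exact Or.inl ⟨x, hxS, hi⟩
        · exact Or.inr ⟨x, ⟨hx, hxS⟩, hi⟩
      · rintro (⟨x, hx, hi⟩ | ⟨x, hx, hi⟩)
        · exact ⟨x, hSU hx, hi⟩
        · exact ⟨x, hx.1, hi⟩
    have hdis : Disjoint (G.edgesAt S) (G.edgesAt (U \ S)) := by
      rw [Set.disjoint_left]
      rintro e ⟨x, hx, y, hl⟩ ⟨z, hz, hi⟩
      rcases hi.eq_or_eq_of_isLink hl with rfl | rfl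
      · exact hz.2 hx
      · exact hz.2 (hS x hx _ hl.adj)
    refine ⟨F + F', fun C hC => ?_, fun e he => ?_, ?_⟩
    · exact (Multiset.mem_add.1 hC).elim (f1 C) (g1 C)
    · rw [hun] at he
      rcases he with he | he
      · obtain ⟨C, hC, h⟩ := f2 e he
        exact ⟨C, Multiset.mem_add.2 (Or.inl hC), h⟩
      · obtain ⟨C, hC, h⟩ := g2 e he
        exact ⟨C, Multiset.mem_add.2 (Or.inr hC), h⟩
    · rw [hun, Set.ncard_union_eq hdis (hE.subset (G.edgesAt_subset _))
        (hE.subset (G.edgesAt_subset _))]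
      simp only [familyLength, Multiset.map_add, Multiset.sum_add] at *
      omega

end Graph

theorem mainTheorem1 {α β : Type*} (G : Graph α β) (σ : β → ℤˣ)
    (hV : V(G).Finite) (hE : E(G).Finite)
    (hcubic : G.IsRegular 3) (hcol : G.IsEdgeColorable 3)
    (hflow : G.IsFlowAdmissible σ) :
    ∃ F : Multiset (Graph α β), G.IsSignCircuitCover σ F ∧
      (Graph.familyLength F : ℚ) ≤ 20 / 9 * (E(G).ncard : ℚ) := by
  obtain ⟨F, h1, h2, h3⟩ := Graph.exists_family_closed hV hE hcubic hcol hflow _ V(G)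
    subset_rfl rfl fun _ _ _ h => h.right_mem
  refine ⟨F, ⟨h1, fun e he => h2 e ?_⟩, ?_⟩
  · obtain ⟨x, y, hl⟩ := G.exists_isLink_of_mem_edgeSet he
    exact ⟨x, hl.left_mem, hl.inc_left⟩
  · have h4 : 9 * Graph.familyLength F ≤ 20 * E(G).ncard :=
      h3.trans (Nat.mul_le_mul_left 20 (Set.ncard_le_ncard (G.edgesAt_subset _) hE))
    have h5 : (9 * Graph.familyLength F : ℚ) ≤ 20 * E(G).ncard := by exact_mod_cast h4
    linarith
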